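/- **Setting.** A *$C^*$-seminorm* on a complex $*$-algebra is a seminorm $p$ with $p(ab)\le p(a)p(b)$ and $p(a^*a)=p(a)^2$. An *l.m.c.-$C^*$-algebra* is a (not necessarily unital) complex $*$-algebra with a Hausdorff topology defined by some set of $C^*$-seminorms. Fix an ordinal $\nu$ of cardinality at least $\aleph_0$. An l.m.c.-$C^*$-algebra is *$\nu$-complete* if every Cauchy sequence indexed by $\nu$ converges in it. Let $\mathbb A_\nu$ be the category of $\nu$-complete l.m.c.-$C^*$-algebras and continuous $*$-homomorphisms. The set $\operatorname{Hom}(A,B)$ of morphisms carries the compact-open topology and the base point $0$. Let $\mathrm{Cpt}_*$ be the category of pointed compact Hausdorff spaces. For $X\in\mathrm{Cpt}_*$ and a pointed space $Z$, let $C_*(X,Z)$ be the set of pointed continuous maps with the compact-open topology; for $B\in\mathbb A_\nu$, pointed at $0$, $C_*(X,B)$ with pointwise operations is an object of $\mathbb A_\nu$. For $A\in\mathbb A_\nu$ and $X\in\mathrm{Cpt}_*$, let $A\,\hat\wedge\,X\in\mathbb A_\nu$ be the algebra with the universal continuous map $A\wedge X\to A\,\hat\wedge\,X$ that restricts to a $*$-homomorphism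 on $A\times\{x\}$ for each $x\in X$. Here $A\wedge X$ is the quotient of $A\times X$ by $A\times\{*\}\cup\{0\}\times X$, so that a continuous map out of it is a jointly continuous map on $A\times X$ vanishing on this subset. This is a functor of $X$. A morphism $f:A\to B$ of $\mathbb A_\nu$ has the *seminorm extension property* if every continuous $C^*$-seminorm on $A$ is of the form $q\circ f$ for a continuous $C^*$-seminorm $q$ on $B$. **Proposition.** Suppose that $A\in\mathbb A_\nu$ satisfies the following conditions. 1. $A\,\hat\wedge\,(-)$ is a partial left adjoint of $\operatorname{Hom}(A,-)$ on $\mathrm{Cpt}_*$: there is a bijection $\operatorname{Hom}(A\,\hat\wedge\,X,B)\cong C_*(X,\operatorname{Hom}(A,B))$, natural in $X\in\mathrm{Cpt}_*$ and $B\in\mathbb A_\nu$. 2. There is a homeomorphism $\operatorname{Hom}(A,C_*(X,B))\cong C_*(X,\operatorname{Hom}(A,B))$, natural in $X\in\mathrm{Cpt}_*$ and $B\in\mathbb A_\nu$. 3. $A$ has the strong cylinder seminorm extension property: for every $X\in\mathrm{Cpt}_*$, the morphism $i_1:A\,\hat\wedge\,X\to (A\,\hat\wedge\,X)\,\hat\wedge\,I$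 given by the point $1\in I$ has the seminorm extension property, where $I=[0,1]$ has base point $0$. Then $\mathbb A_\nu$ has all small limits and colimits, and there is a model structure on $\mathbb A_\nu$ such that: * a morphism $f$ is a fibration if and only if $\operatorname{Hom}(A,f)$ is a Serre fibration; * a morphism $f$ is a weak equivalence if and only if $\operatorname{Hom}(A,f)$ is a weak homotopy equivalence (a bijection on path components and on all homotopy groups at all base points); * $A$ is cofibrant and every object is fibrant; * the structure is right proper, that is, weak equivalences are stable under pullback along fibrations; * the structure is cofibrantly generated, with the set $\mathcal I$ of generating cofibrations consisting of the morphisms $A\,\hat\wedge\,(S^{n-1}_+\to D^n_+)$, $n\ge 0$ (where $S^{-1}=\emptyset$). That is, for some set $\mathcal J$ of morphisms, the fibrations are the morphisms with the right lifting property with respect to $\mathcal J$, the trivial fibrations are those with the right lifting property with respect to $\mathcal I$, and the domains of the morphisms in $\mathcal I$ (resp. $\mathcal J$) are small relative to the relative $\mathcal I$-cell (resp. $\mathcal J$-cell) complexes. -/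

import Mathlib

open CategoryTheory CategoryTheory.Limits HomotopicalAlgebra Topology Filter

universe u w

noncomputable section

namespace LMCStar

section Unbundled

variable {E : Type w} [NonUnitalRing E] [StarRing E] [Module ℂ E]

/-- A (submultiplicative) C*-seminorm on a complex *-algebra. -/
structure IsCStarSeminorm (p : Seminorm ℂ E) : Prop where
  mul_le : ∀ a b : E, p (a * b) ≤ p a * p b
  star_mul_self : ∀ a : E, p (star a * a) = p a * p a

theorem IsCStarSeminorm.le_star {p : Seminorm ℂ E} (hp : IsCStarSeminorm p) (a : E) :
    p a ≤ p (star a) := by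
  rcases (apply_nonneg p a).eq_or_lt with h | h
  · rw [← h]; exact apply_nonneg p _
  · have h1 := hp.mul_le (star a) a
    rw [hp.star_mul_self] at h1
    exact le_of_mul_le_mul_right h1 h

theorem IsCStarSeminorm.map_star {p : Seminorm ℂ E} (hp : IsCStarSeminorm p) (a : E) :
    p (star a) = p a := by
  refine le_antisymm ?_ (hp.le_star a)
  simpa using hp.le_star (star a)

theorem IsCStarSeminorm.comp {F : Type*} [NonUnitalRing F] [StarRing F] [Module ℂ F]
    {p : Seminorm ℂ F} (hp : IsCStarSeminorm p) (f : E →ₗ[ℂ] F)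
    (hmul : ∀ a b, f (a * b) = f a * f b) (hstar : ∀ a, f (star a) = star (f a)) :
    IsCStarSeminorm (p.comp f) where
  mul_le a b := by simpa [hmul] using hp.mul_le (f a) (f b)
  star_mul_self a := by simpa [hmul, hstar] using hp.star_mul_self (f a)

variable (E) in
/-- The topology of the *-algebra `E` is an l.m.c.-C*-topology: it is the vector space topology
defined by some set of C*-seminorms.  Addition, scalar multiplication, multiplication and the
involution are then automatically continuous. -/
class IsLMCCStar [TopologicalSpace E] : Prop where
  exists_seminorms : ∃ S : Set (Seminorm ℂ E),
    (∀ p ∈ S, IsCStarSeminorm p) ∧ WithSeminorms (fun p : S ↦ (p : Seminorm ℂ E))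

/-- A `ν`-indexed sequence is Cauchy if its differences eventually lie in any given neighbourhood
of zero. -/
def IsCauchySeq (ν : Ordinal.{u}) {E : Type w} [NonUnitalRing E] [TopologicalSpace E] (x : ν.ToType → E) : Prop :=
  ∀ U ∈ 𝓝 (0 : E), ∃ γ : ν.ToType, ∀ α β : ν.ToType, γ ≤ α → γ ≤ β → x α - x β ∈ U

/-- Every Cauchy `ν`-sequence converges. -/
def IsNuComplete (E : Type w) [NonUnitalRing E] [TopologicalSpace E] (ν : Ordinal.{u}) : Prop :=
  ∀ x : ν.ToType → E, IsCauchySeq ν x → ∃ a : E, Tendsto x atTop (𝓝 a)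

/-- The set `S` contains all limits of `ν`-sequences in `S`. -/
def IsNuClosed (ν : Ordinal.{u}) {E : Type w} [TopologicalSpace E] (S : Set E) : Prop :=
  ∀ x : ν.ToType → E, (∀ α, x α ∈ S) → ∀ a : E, Tendsto x atTop (𝓝 a) → a ∈ S

section Lemmas

theorem isTopologicalAddGroup [TopologicalSpace E] [hE : IsLMCCStar E] : IsTopologicalAddGroup E := by
  obtain ⟨S, -, h⟩ := hE.exists_seminorms
  exact h.topologicalAddGroup

theorem continuousSMul [TopologicalSpace E] [hE : IsLMCCStar E] : ContinuousSMul ℂ E := by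
  obtain ⟨S, -, h⟩ := hE.exists_seminorms
  exact h.continuousSMul

theorem isTopologicalRing [TopologicalSpace E] [hE : IsLMCCStar E] : IsTopologicalRing E := by
  obtain ⟨S, hS, h⟩ := hE.exists_seminorms
  have := h.topologicalAddGroup
  have h0 : ∀ p : S, Tendsto (p : Seminorm ℂ E) (𝓝 0) (𝓝 0) := fun p ↦ by
    have := (h.continuous_seminorm p).tendsto 0
    rwa [map_zero] at this
  refine IsTopologicalRing.of_addGroup_of_nhds_zero ?_ (fun a ↦ ?_) (fun a ↦ ?_)
  · refine (h.tendsto_nhds _ _).2 fun p ε hε ↦ ?_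
    have h1 : Tendsto (fun x : E × E ↦ (p : Seminorm ℂ E) x.1 * (p : Seminorm ℂ E) x.2)
        (𝓝 0 ×ˢ 𝓝 0) (𝓝 0) := by
      simpa using ((h0 p).comp tendsto_fst).mul ((h0 p).comp tendsto_snd)
    filter_upwards [h1.eventually_lt_const hε] with x hx
    rw [sub_zero]
    exact ((hS p p.2).mul_le x.1 x.2).trans_lt hx
  · refine (h.tendsto_nhds _ _).2 fun p ε hε ↦ ?_
    have h1 : Tendsto (fun x : E ↦ (p : Seminorm ℂ E) a * (p : Seminorm ℂ E) x) (𝓝 0) (𝓝 0) := by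
      simpa using (h0 p).const_mul ((p : Seminorm ℂ E) a)
    filter_upwards [h1.eventually_lt_const hε] with x hx
    simpa using ((hS p p.2).mul_le a x).trans_lt hx
  · refine (h.tendsto_nhds _ _).2 fun p ε hε ↦ ?_
    have h1 : Tendsto (fun x : E ↦ (p : Seminorm ℂ E) x * (p : Seminorm ℂ E) a) (𝓝 0) (𝓝 0) := by
      simpa using (h0 p).mul_const ((p : Seminorm ℂ E) a)
    filter_upwards [h1.eventually_lt_const hε] with x hx
    simpa using ((hS p p.2).mul_le x a).trans_lt hx

theorem continuousStar [TopologicalSpace E] [hE : IsLMCCStar E] : ContinuousStar E := by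
  obtain ⟨S, hS, h⟩ := hE.exists_seminorms
  refine ⟨continuous_iff_continuousAt.2 fun a ↦ (h.tendsto_nhds _ _).2 fun p ε hε ↦ ?_⟩
  filter_upwards [(h.tendsto_nhds id a).1 tendsto_id p ε hε] with x hx
  rw [← star_sub, (hS p p.2).map_star]
  exact hx

end Lemmas

theorem IsLMCCStar.of_withSeminorms [TopologicalSpace E] {ι : Type*} (p : ι → Seminorm ℂ E)
    (hp : ∀ i, IsCStarSeminorm (p i)) (h : WithSeminorms p) : IsLMCCStar E := by
  have := h.topologicalAddGroup
  refine ⟨Set.range p, ?_, ?_⟩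
  · rintro _ ⟨i, rfl⟩
    exact hp i
  · rw [SeminormFamily.withSeminorms_iff_nhds_eq_iInf] at h ⊢
    rw [h]
    exact (iInf_range' (fun q : Seminorm ℂ E ↦ comap q (𝓝 0)) p).symm

/-- A *-algebra with the topology induced along a *-homomorphism to an l.m.c.-C*-algebra. -/
theorem IsLMCCStar.of_isInducing {F : Type*} [NonUnitalRing F] [StarRing F] [Module ℂ F]
    [TopologicalSpace E] [TopologicalSpace F] [hF : IsLMCCStar F] (f : E →ₗ[ℂ] F)
    (hmul : ∀ a b, f (a * b) = f a * f b) (hstar : ∀ a, f (star a) = star (f a))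
    (hf : IsInducing f) : IsLMCCStar E := by
  obtain ⟨S, hS, h⟩ := hF.exists_seminorms
  exact .of_withSeminorms (ι := S) _ (fun p : S ↦ (hS p.1 p.2).comp f hmul hstar) (hf.withSeminorms h)

theorem IsNuComplete.of_isInducing {E F : Type*} [NonUnitalRing E] [Module ℂ E]
    [NonUnitalRing F] [Module ℂ F] [TopologicalSpace E] [TopologicalSpace F] {ν : Ordinal.{u}} (hF : IsNuComplete F ν)
    (f : E →ₗ[ℂ] F) (hf : IsInducing f) (hc : IsNuClosed ν (Set.range f)) :
    IsNuComplete E ν := by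
  intro x hx
  obtain ⟨b, hb⟩ := hF (f ∘ x) (fun U hU ↦ by
    have : f ⁻¹' U ∈ 𝓝 (0 : E) := by
      rw [hf.nhds_eq_comap, map_zero]; exact preimage_mem_comap hU
    obtain ⟨γ, hγ⟩ := hx _ this
    exact ⟨γ, fun α β h1 h2 ↦ by simpa using hγ α β h1 h2⟩)
  obtain ⟨a, rfl⟩ := hc _ (fun α ↦ ⟨x α, rfl⟩) b hb
  exact ⟨a, hf.tendsto_nhds_iff.2 hb⟩

instance isLMCCStar_pi {ι : Type*} {F : ι → Type*} [∀ i, NonUnitalRing (F i)]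
    [∀ i, StarRing (F i)] [∀ i, Module ℂ (F i)] [∀ i, TopologicalSpace (F i)]
    [hF : ∀ i, IsLMCCStar (F i)] : IsLMCCStar (∀ i, F i) := by
  choose S hS h using fun i ↦ (hF i).exists_seminorms
  exact .of_withSeminorms _ (fun ⟨i, p⟩ ↦ (hS i p p.2).comp (LinearMap.proj i)
    (fun _ _ ↦ rfl) (fun _ ↦ rfl)) (withSeminorms_pi h)

theorem isNuComplete_pi {ν : Ordinal.{u}} {ι : Type*} {F : ι → Type*} [∀ i, NonUnitalRing (F i)]
    [∀ i, TopologicalSpace (F i)] (h : ∀ i, IsNuComplete (F i) ν) :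
    IsNuComplete (∀ i, F i) ν := by
  intro x hx
  choose a ha using fun i ↦ h i (fun α ↦ x α i) (fun U hU ↦ by
    obtain ⟨γ, hγ⟩ := hx ((fun y : ∀ i, F i ↦ y i) ⁻¹' U)
      ((continuous_apply i).continuousAt.preimage_mem_nhds (by simpa using hU))
    exact ⟨γ, fun α β h1 h2 ↦ hγ α β h1 h2⟩)
  exact ⟨a, tendsto_pi_nhds.2 ha⟩

end Unbundled

/-! ### The category of `ν`-complete l.m.c.-C*-algebras -/

/-- A `ν`-complete l.m.c.-C*-algebra: a complex *-algebra, not necessarily unital, with a Hausdorff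
l.m.c.-C*-topology in which all Cauchy `ν`-sequences converge. -/
structure NuAlg (ν : Ordinal.{u}) : Type (u + 1) where
  carrier : Type u
  [nonUnitalRing : NonUnitalRing carrier]
  [starRing : StarRing carrier]
  [module : Module ℂ carrier]
  [starModule : StarModule ℂ carrier]
  [isScalarTower : IsScalarTower ℂ carrier carrier]
  [smulCommClass : SMulCommClass ℂ carrier carrier]
  [topologicalSpace : TopologicalSpace carrier]
  [t2Space : T2Space carrier]
  [isLMCCStar : IsLMCCStar carrier]
  isNuComplete : IsNuComplete carrier ν

namespace NuAlg

variable {ν : Ordinal.{u}}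

instance : CoeSort (NuAlg ν) (Type u) := ⟨carrier⟩

attribute [instance] nonUnitalRing starRing module starModule isScalarTower smulCommClass
  topologicalSpace t2Space isLMCCStar

instance (B : NuAlg ν) : IsTopologicalAddGroup B := isTopologicalAddGroup
instance (B : NuAlg ν) : ContinuousSMul ℂ B := continuousSMul
instance (B : NuAlg ν) : IsTopologicalRing B := isTopologicalRing
instance (B : NuAlg ν) : ContinuousStar B := continuousStar

/-- Continuous *-homomorphisms. -/
@[ext]
structure Hom (A B : NuAlg ν) where
  toStarHom : A →⋆ₙₐ[ℂ] B
  continuous : Continuous toStarHom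

instance : Category (NuAlg ν) where
  Hom := Hom
  id A := ⟨NonUnitalStarAlgHom.id ℂ A, continuous_id⟩
  comp f g := ⟨g.toStarHom.comp f.toStarHom, g.continuous.comp f.continuous⟩

instance {A B : NuAlg ν} : FunLike (A ⟶ B) A B where
  coe f := f.toStarHom
  coe_injective _ _ h := Hom.ext (DFunLike.coe_injective h)

instance {A B : NuAlg ν} : NonUnitalAlgHomClass (A ⟶ B) ℂ A B where
  map_add f := map_add f.toStarHom
  map_zero f := map_zero f.toStarHom
  map_mul f := map_mul f.toStarHom
  map_smulₛₗ f := map_smulₛₗ f.toStarHom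

instance {A B : NuAlg ν} : StarHomClass (A ⟶ B) A B where
  map_star f := map_star f.toStarHom

instance {A B : NuAlg ν} : ContinuousMapClass (A ⟶ B) A B where
  map_continuous f := f.continuous

@[simp] theorem id_apply {A : NuAlg ν} (a : A) : (𝟙 A : A ⟶ A) a = a := rfl

@[simp] theorem comp_apply {A B D : NuAlg ν} (f : A ⟶ B) (g : B ⟶ D) (a : A) :
    (f ≫ g) a = g (f a) := rfl

@[ext] theorem hom_ext {A B : NuAlg ν} {f g : A ⟶ B} (h : ∀ a, f a = g a) : f = g :=
  DFunLike.ext _ _ h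

/-- The underlying continuous map of a morphism. -/
def toContinuousMap {A B : NuAlg ν} (f : A ⟶ B) : C(A, B) := ⟨f, f.continuous⟩

/-- The set `Hom(A, B)` carries the compact-open topology. -/
instance {A B : NuAlg ν} : TopologicalSpace (A ⟶ B) :=
  TopologicalSpace.induced toContinuousMap inferInstance

/-- The base point of `Hom(A, B)` is the zero homomorphism. -/
instance {A B : NuAlg ν} : Zero (A ⟶ B) := ⟨⟨0, continuous_const⟩⟩

@[simp] theorem zero_apply {A B : NuAlg ν} (a : A) : (0 : A ⟶ B) a = 0 := rfl

/-- The continuous map `Hom(A, f) : Hom(A, B) → Hom(A, D)` given by composition with `f`. -/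
def homMap (A : NuAlg ν) {B D : NuAlg ν} (f : B ⟶ D) : C(A ⟶ B, A ⟶ D) where
  toFun g := g ≫ f
  continuous_toFun := by
    refine continuous_induced_rng.2 ?_
    exact ((toContinuousMap f).continuous_postcomp).comp
      (continuous_induced_dom (f := toContinuousMap (A := A) (B := B)))

/-- A `ν`-closed *-subalgebra `S` of an arbitrary (possibly large) `ν`-complete Hausdorff
l.m.c.-C*-algebra is again one. -/
theorem isNuComplete_subalgebra {E : Type w} [NonUnitalRing E] [StarRing E] [Module ℂ E]
    [TopologicalSpace E] (h : IsNuComplete E ν) (S : NonUnitalStarSubalgebra ℂ E)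
    (hS : IsNuClosed ν (S : Set E)) : IsNuComplete S ν :=
  h.of_isInducing (NonUnitalStarSubalgebraClass.subtype S : S →ₗ[ℂ] E) IsInducing.subtypeVal
    (by simpa using hS)

instance isLMCCStar_subalgebra {E : Type w} [NonUnitalRing E] [StarRing E] [Module ℂ E]
    [TopologicalSpace E] [IsLMCCStar E] (S : NonUnitalStarSubalgebra ℂ E) : IsLMCCStar S :=
  IsLMCCStar.of_isInducing (NonUnitalStarSubalgebraClass.subtype S : S →ₗ[ℂ] E)
    (fun _ _ ↦ rfl) (fun _ ↦ rfl) IsInducing.subtypeVal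

end NuAlg

/-! ### Pointed compact spaces and mapping spaces -/

/-- Pointed compact Hausdorff spaces. -/
structure PtCpt : Type (u + 1) where
  carrier : Type u
  [topologicalSpace : TopologicalSpace carrier]
  [compactSpace : CompactSpace carrier]
  [t2Space : T2Space carrier]
  pt : carrier

namespace PtCpt

instance : CoeSort PtCpt.{u} (Type u) := ⟨carrier⟩

attribute [instance] topologicalSpace compactSpace t2Space

/-- Base point preserving continuous maps. -/
@[ext]
structure Hom (X Y : PtCpt.{u}) where
  toMap : C(X, Y)
  map_pt : toMap X.pt = Y.pt

instance : Category PtCpt.{u} where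
  Hom := Hom
  id X := ⟨ContinuousMap.id X, rfl⟩
  comp f g := ⟨g.toMap.comp f.toMap, by simp [f.map_pt, g.map_pt]⟩

instance {X Y : PtCpt.{u}} : FunLike (X ⟶ Y) X Y where
  coe f := f.toMap
  coe_injective _ _ h := Hom.ext (DFunLike.coe_injective h)

@[simp] theorem id_apply {X : PtCpt.{u}} (x : X) : (𝟙 X : X ⟶ X) x = x := rfl

@[simp] theorem comp_apply {X Y Z : PtCpt.{u}} (f : X ⟶ Y) (g : Y ⟶ Z) (x : X) :
    (f ≫ g) x = g (f x) := rfl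

theorem apply_pt {X Y : PtCpt.{u}} (f : X ⟶ Y) : f X.pt = Y.pt := f.map_pt

/-- The pointed compact space `X₊` obtained by adding a disjoint base point. -/
def plus (X : Type u) [TopologicalSpace X] [CompactSpace X] [T2Space X] : PtCpt.{u} where
  carrier := X ⊕ PUnit.{u + 1}
  pt := Sum.inr PUnit.unit

/-- The pointed map `f₊ : X₊ → Y₊`. -/
def plusMap {X Y : Type u} [TopologicalSpace X] [CompactSpace X] [T2Space X] [TopologicalSpace Y]
    [CompactSpace Y] [T2Space Y] (f : C(X, Y)) : plus X ⟶ plus Y where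
  toMap := ⟨Sum.map f id, f.continuous.sumMap continuous_id⟩
  map_pt := rfl

/-- The unit interval, with base point `0`. -/
def interval : PtCpt.{u} where
  carrier := ULift.{u} unitInterval
  pt := ULift.up 0

end PtCpt

/-- The space of base point preserving maps from `X` to a space `Z` whose base point is denoted by
`0`, as a subspace of the space of all continuous maps with the compact-open topology. -/
abbrev PtMap (X : PtCpt.{u}) (Z : Type w) [TopologicalSpace Z] [Zero Z] : Type (max u w) :=
  {f : C(X, Z) // f X.pt = 0}

section MappingSpaces

variable {ν : Ordinal.{u}}

theorem nonempty_toType (ν : Ordinal.{u}) [hν : Fact (Cardinal.aleph0 ≤ ν.card)] :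
    Nonempty ν.ToType := by
  rw [Ordinal.nonempty_toType_iff]
  rintro rfl
  exact absurd (hν.out.trans_eq Ordinal.card_zero) (by simp [Cardinal.aleph0_ne_zero])

/-- The C*-seminorm `f ↦ sup_x p (f x)`. -/
def supSeminorm (X : PtCpt.{u}) (B : NuAlg ν) (p : Seminorm ℂ B) (hp : Continuous p) :
    Seminorm ℂ C(X, B) :=
  have hb : ∀ f : C(X, B), BddAbove (Set.range fun x ↦ p (f x)) := fun f ↦
    (isCompact_range (hp.comp f.continuous)).bddAbove
  have : Nonempty X := ⟨X.pt⟩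
  Seminorm.of (fun f ↦ ⨆ x, p (f x))
    (fun f g ↦ ciSup_le fun x ↦ (map_add_le_add p _ _).trans
      (add_le_add (le_ciSup (hb f) x) (le_ciSup (hb g) x)))
    (fun c f ↦ by
      simp only [ContinuousMap.coe_smul, Pi.smul_apply, map_smul_eq_mul]
      exact (Real.mul_iSup_of_nonneg (norm_nonneg c) _).symm)

variable {X : PtCpt.{u}} {B : NuAlg ν}

theorem le_supSeminorm (p : Seminorm ℂ B) (hp : Continuous p) (f : C(X, B)) (x : X) :
    p (f x) ≤ supSeminorm X B p hp f :=
  le_ciSup (f := fun x ↦ p (f x)) (isCompact_range (hp.comp f.continuous)).bddAbove x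

theorem supSeminorm_le (p : Seminorm ℂ B) (hp : Continuous p) (f : C(X, B)) {c : ℝ}
    (h : ∀ x, p (f x) ≤ c) : supSeminorm X B p hp f ≤ c :=
  have : Nonempty X := ⟨X.pt⟩
  ciSup_le h

theorem isCStarSeminorm_supSeminorm (p : Seminorm ℂ B) (hp : Continuous p)
    (h : IsCStarSeminorm p) : IsCStarSeminorm (supSeminorm X B p hp) where
  mul_le f g := supSeminorm_le _ _ _ fun x ↦ (h.mul_le _ _).trans
    (mul_le_mul (le_supSeminorm p hp f x) (le_supSeminorm p hp g x) (apply_nonneg p _)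
      (apply_nonneg _ _))
  star_mul_self f := by
    refine le_antisymm (supSeminorm_le _ _ _ fun x ↦ ?_) ?_
    · simp only [ContinuousMap.coe_mul, ContinuousMap.coe_star, Pi.mul_apply, Pi.star_apply,
        h.star_mul_self]
      exact mul_self_le_mul_self (apply_nonneg p _) (le_supSeminorm p hp f x)
    · have h1 : supSeminorm X B p hp f ≤ √(supSeminorm X B p hp (star f * f)) := by
        refine supSeminorm_le _ _ _ fun x ↦ Real.le_sqrt_of_sq_le ?_
        have h2 := le_supSeminorm p hp (star f * f) x
        simp only [ContinuousMap.coe_mul, ContinuousMap.coe_star, Pi.mul_apply, Pi.star_apply,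
          h.star_mul_self] at h2
        rwa [sq]
      calc _ ≤ √(supSeminorm X B p hp (star f * f)) * √(supSeminorm X B p hp (star f * f)) :=
            mul_self_le_mul_self (apply_nonneg _ _) h1
        _ = _ := Real.mul_self_sqrt (apply_nonneg _ _)

theorem withSeminorms_continuousMap {S : Set (Seminorm ℂ B)}
    (h : WithSeminorms (fun p : S ↦ (p : Seminorm ℂ B))) :
    WithSeminorms (fun p : S ↦ supSeminorm X B p (h.continuous_seminorm p)) := by
  rw [SeminormFamily.withSeminorms_iff_nhds_eq_iInf]
  refine le_antisymm (le_iInf fun p ↦ ?_) ?_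
  · rw [← tendsto_iff_comap, Metric.tendsto_nhds]
    intro ε hε
    have ho : IsOpen {b : B | (p : Seminorm ℂ B) b < ε / 2} :=
      isOpen_lt (h.continuous_seminorm p) continuous_const
    have h1 : ∀ᶠ f : C(X, B) in 𝓝 0, Set.MapsTo f Set.univ
        {b : B | (p : Seminorm ℂ B) b < ε / 2} :=
      ContinuousMap.eventually_mapsTo isCompact_univ ho fun x _ ↦ by simpa using half_pos hε
    filter_upwards [h1] with f hf
    rw [Real.dist_0_eq_abs, abs_of_nonneg (apply_nonneg _ _)]
    exact (supSeminorm_le _ _ _ fun x ↦ (hf (Set.mem_univ x)).le).trans_lt (half_lt_self hε)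
  · rw [ContinuousMap.nhds_compactOpen]
    simp only [le_iInf_iff, le_principal_iff]
    intro K _ U hU hKU
    rcases K.eq_empty_or_nonempty with rfl | ⟨x₀, hx₀⟩
    · exact Filter.mem_of_superset Filter.univ_mem fun g _ ↦ Set.mapsTo_empty g U
    obtain ⟨s, r, hr, hs⟩ := (h.mem_nhds_iff 0 U).1 (hU.mem_nhds (by simpa using hKU hx₀))
    have h1 : ∀ p ∈ s, {f : C(X, B) | supSeminorm X B p (h.continuous_seminorm p) f < r} ∈
        ⨅ p : S, comap (supSeminorm X B p (h.continuous_seminorm p)) (𝓝 0) := fun p _ ↦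
      mem_iInf_of_mem p (preimage_mem_comap (Iio_mem_nhds hr))
    filter_upwards [(s.iInter_mem_sets).2 h1] with f hf x _
    refine hs ?_
    rw [Seminorm.ball_finset_sup_eq_iInter _ _ _ hr]
    simp only [Set.mem_iInter, Set.mem_ofPred_eq, Seminorm.mem_ball, sub_zero] at hf ⊢
    exact fun p hp ↦ (le_supSeminorm _ _ f x).trans_lt (hf p hp)

instance (X : PtCpt.{u}) (B : NuAlg ν) : IsLMCCStar C(X, B) := by
  obtain ⟨S, hS, h⟩ := B.isLMCCStar.exists_seminorms
  exact .of_withSeminorms (ι := S) _ (fun p : S ↦ isCStarSeminorm_supSeminorm _ _ (hS p.1 p.2))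
    (withSeminorms_continuousMap h)

theorem isNuComplete_continuousMap (X : PtCpt.{u}) (B : NuAlg ν) [hν : Fact (Cardinal.aleph0 ≤ ν.card)] :
    IsNuComplete C(X, B) ν := by
  intro f hf
  have := nonempty_toType ν
  obtain ⟨S, -, h⟩ := B.isLMCCStar.exists_seminorms
  have hX := withSeminorms_continuousMap (X := X) h
  choose g hg using fun x ↦ B.isNuComplete (fun α ↦ f α x) (fun U hU ↦ by
    obtain ⟨γ, hγ⟩ := hf ((fun k : C(X, B) ↦ k x) ⁻¹' U)
      ((continuous_eval_const x).continuousAt.preimage_mem_nhds (by simpa using hU))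
    exact ⟨γ, fun α β h1 h2 ↦ hγ α β h1 h2⟩)
  have key : ∀ (p : S) (ε : ℝ), 0 < ε → ∃ γ, ∀ α, γ ≤ α → ∀ x,
      (p : Seminorm ℂ B) (f α x - g x) ≤ ε := by
    intro p ε hε
    have h0 : {k : C(X, B) | supSeminorm X B p (h.continuous_seminorm p) k < ε} ∈ 𝓝 0 :=
      (isOpen_lt (hX.continuous_seminorm p) continuous_const).mem_nhds (by simpa using hε)
    obtain ⟨γ, hγ⟩ := hf _ h0
    refine ⟨γ, fun α hα x ↦ ?_⟩
    have h1 : Tendsto (fun β ↦ (p : Seminorm ℂ B) (f α x - f β x)) atTop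
        (𝓝 ((p : Seminorm ℂ B) (f α x - g x))) :=
      ((h.continuous_seminorm p).tendsto _).comp (tendsto_const_nhds.sub (hg x))
    refine le_of_tendsto h1 ?_
    filter_upwards [eventually_ge_atTop γ] with β hβ
    exact (le_supSeminorm _ _ (f α - f β) x).trans (hγ α β hα hβ).le
  have hgc : Continuous g := by
    refine continuous_iff_continuousAt.2 fun x ↦ (h.tendsto_nhds _ _).2 fun p ε hε ↦ ?_
    obtain ⟨γ, hγ⟩ := key p (ε / 4) (by positivity)
    filter_upwards [(h.tendsto_nhds (f γ) (f γ x)).1 (f γ).continuous.continuousAt p (ε / 4)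
      (by positivity)] with y hy
    have e : g y - g x = -(f γ y - g y) + (f γ y - f γ x) + (f γ x - g x) := by abel
    have h2 := map_add_le_add (p : Seminorm ℂ B) (-(f γ y - g y) + (f γ y - f γ x)) (f γ x - g x)
    have h3 := map_add_le_add (p : Seminorm ℂ B) (-(f γ y - g y)) (f γ y - f γ x)
    have h4 := map_neg_eq_map (p : Seminorm ℂ B) (f γ y - g y)
    rw [e]
    linarith [hγ γ le_rfl y, hγ γ le_rfl x]
  refine ⟨⟨g, hgc⟩, (hX.tendsto_nhds _ _).2 fun p ε hε ↦ ?_⟩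
  obtain ⟨γ, hγ⟩ := key p (ε / 2) (by positivity)
  filter_upwards [eventually_ge_atTop γ] with α hα
  exact (supSeminorm_le _ _ _ (hγ α hα)).trans_lt (half_lt_self hε)

/-- The *-algebra of base point preserving continuous maps from `X` to `B`, where the base point of
`B` is zero, with pointwise operations and the compact-open topology. -/
def ptSubalgebra (X : PtCpt.{u}) (B : NuAlg ν) : NonUnitalStarSubalgebra ℂ C(X, B) where
  carrier := {f | f X.pt = 0}
  zero_mem' := rfl
  add_mem' {f g} hf hg := by simp_all
  mul_mem' {f g} hf hg := by simp_all
  smul_mem' c f hf := by simp_all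
  star_mem' {f} hf := by simp_all

theorem isNuClosed_ptSubalgebra [Fact (Cardinal.aleph0 ≤ ν.card)] (X : PtCpt.{u}) (B : NuAlg ν) :
    IsNuClosed ν (ptSubalgebra X B : Set C(X, B)) := by
  intro f hf g hg
  have := nonempty_toType ν
  have h1 := ((continuous_eval_const (F := C(X, B)) X.pt).tendsto g).comp hg
  have h2 : ((fun k : C(X, B) ↦ k X.pt) ∘ f) = fun _ ↦ 0 := funext hf
  rw [h2] at h1
  exact (tendsto_nhds_unique h1 tendsto_const_nhds)

/-- The object `C_*(X, B)` of base point preserving continuous maps. -/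
def ptcof [Fact (Cardinal.aleph0 ≤ ν.card)] (X : PtCpt.{u}) (B : NuAlg ν) : NuAlg ν where
  carrier := ptSubalgebra X B
  isNuComplete := NuAlg.isNuComplete_subalgebra (isNuComplete_continuousMap X B) _
    (isNuClosed_ptSubalgebra X B)


theorem ptcofMap_aux {X : PtCpt.{u}} {B D : NuAlg ν} (f : B ⟶ D) (g : ptSubalgebra X B) :
    (NuAlg.toContinuousMap f).comp g.1 ∈ ptSubalgebra X D := by
  change f (g.1 X.pt) = 0
  rw [show g.1 X.pt = 0 from g.2, map_zero]

theorem ptcofPrecomp_aux {X Y : PtCpt.{u}} (h : X ⟶ Y) {B : NuAlg ν} (g : ptSubalgebra Y B) :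
    g.1.comp h.toMap ∈ ptSubalgebra X B := by
  change g.1 (h X.pt) = 0
  rw [PtCpt.apply_pt]
  exact g.2

variable [Fact (Cardinal.aleph0 ≤ ν.card)]

/-- Composition with a morphism `f : B ⟶ D`, as a morphism `C_*(X, B) ⟶ C_*(X, D)`. -/
def ptcofMap (X : PtCpt.{u}) {B D : NuAlg ν} (f : B ⟶ D) : ptcof X B ⟶ ptcof X D where
  toStarHom :=
    { toFun := fun g ↦ (⟨(NuAlg.toContinuousMap f).comp g.1, ptcofMap_aux f g⟩ : ptSubalgebra X D)
      map_smul' := fun c g ↦ Subtype.ext (ContinuousMap.ext fun x ↦ map_smul f c (g.1 x))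
      map_zero' := Subtype.ext (ContinuousMap.ext fun _ ↦ map_zero f)
      map_add' := fun g k ↦ Subtype.ext (ContinuousMap.ext fun x ↦ map_add f (g.1 x) (k.1 x))
      map_mul' := fun g k ↦ Subtype.ext (ContinuousMap.ext fun x ↦ map_mul f (g.1 x) (k.1 x))
      map_star' := fun g ↦ Subtype.ext (ContinuousMap.ext fun x ↦ map_star f (g.1 x)) }
  continuous := Continuous.subtype_mk
    ((NuAlg.toContinuousMap f).continuous_postcomp.comp continuous_subtype_val) _

/-- Composition with a pointed map `h : X ⟶ Y`, as a morphism `C_*(Y, B) ⟶ C_*(X, B)`. -/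
def ptcofPrecomp {X Y : PtCpt.{u}} (h : X ⟶ Y) (B : NuAlg ν) : ptcof Y B ⟶ ptcof X B where
  toStarHom :=
    { toFun := fun g ↦ (⟨g.1.comp h.toMap, ptcofPrecomp_aux h g⟩ : ptSubalgebra X B)
      map_smul' := fun _ _ ↦ rfl
      map_zero' := rfl
      map_add' := fun _ _ ↦ rfl
      map_mul' := fun _ _ ↦ rfl
      map_star' := fun _ ↦ rfl }
  continuous := Continuous.subtype_mk
    (h.toMap.continuous_precomp.comp continuous_subtype_val) _

end MappingSpaces

/-! ### The algebra `A ∧̂ X` -/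

section Small

instance (E : Type w) [NonUnitalRing E] [StarRing E] [Small.{u} E] : StarRing (Shrink.{u} E) where
  star a := equivShrink E (star ((equivShrink E).symm a))
  star_involutive a := by simp
  star_mul a b := by simp
  star_add a b := by simp

theorem equivShrink_symm_star (E : Type w) [NonUnitalRing E] [StarRing E] [Small.{u} E]
    (a : Shrink.{u} E) : (equivShrink E).symm (star a) = star ((equivShrink E).symm a) :=
  (equivShrink E).symm_apply_apply _

variable {ν : Ordinal.{u}} (E : Type w) [NonUnitalRing E] [StarRing E] [Module ℂ E]
  [StarModule ℂ E] [IsScalarTower ℂ E E] [SMulCommClass ℂ E E] [TopologicalSpace E] [T2Space E]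
  [IsLMCCStar E] [Small.{u} E]

/-- The linear equivalence of a small algebra with its model in `Type u`. -/
def shrinkLinearEquiv : Shrink.{u} E ≃ₗ[ℂ] E where
  __ := (equivShrink E).symm
  map_add' a b := by simp
  map_smul' c a := by simp

instance : StarModule ℂ (Shrink.{u} E) where
  star_smul c a := (equivShrink E).symm.injective (by simp [equivShrink_symm_star])

instance : IsScalarTower ℂ (Shrink.{u} E) (Shrink.{u} E) where
  smul_assoc c a b := (equivShrink E).symm.injective (by simp [smul_mul_assoc])

instance : SMulCommClass ℂ (Shrink.{u} E) (Shrink.{u} E) where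
  smul_comm c a b := (equivShrink E).symm.injective (by simp [mul_smul_comm])

/-- A `ν`-complete Hausdorff l.m.c.-C*-algebra whose underlying set is small, as an object. -/
def NuAlg.ofSmall (h : IsNuComplete E ν) : NuAlg ν where
  carrier := Shrink.{u} E
  t2Space := (Shrink.homeomorph E).t2Space
  isLMCCStar := IsLMCCStar.of_isInducing (shrinkLinearEquiv E : Shrink.{u} E →ₗ[ℂ] E)
    (equivShrink_symm_mul) (equivShrink_symm_star E) (Shrink.homeomorph E).symm.isInducing
  isNuComplete := h.of_isInducing (shrinkLinearEquiv E : Shrink.{u} E →ₗ[ℂ] E)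
    (Shrink.homeomorph E).symm.isInducing
      (by intro _ _ a _; exact (shrinkLinearEquiv E).surjective a)

/-- The canonical *-isomorphism `NuAlg.ofSmall E h → E`. -/
def NuAlg.fromSmall (h : IsNuComplete E ν) : NuAlg.ofSmall E h →⋆ₙₐ[ℂ] E where
  toFun := (equivShrink E).symm
  map_smul' c a := (shrinkLinearEquiv E).map_smul c a
  map_zero' := (shrinkLinearEquiv E).map_zero
  map_add' := (shrinkLinearEquiv E).map_add
  map_mul' := equivShrink_symm_mul
  map_star' := equivShrink_symm_star E

/-- The inverse of `NuAlg.fromSmall`. -/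
def NuAlg.toSmall (h : IsNuComplete E ν) : E →⋆ₙₐ[ℂ] NuAlg.ofSmall E h where
  toFun := equivShrink E
  map_smul' c a := (shrinkLinearEquiv E).symm.map_smul c a
  map_zero' := (shrinkLinearEquiv E).symm.map_zero
  map_add' := (shrinkLinearEquiv E).symm.map_add
  map_mul' := equivShrink_mul
  map_star' a := (equivShrink E).symm.injective <|
    ((equivShrink E).symm_apply_apply _).trans (((equivShrink_symm_star E _).trans
      (congrArg star ((equivShrink E).symm_apply_apply a))).symm)

theorem NuAlg.continuous_fromSmall (h : IsNuComplete E ν) : Continuous (NuAlg.fromSmall E h) :=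
  (Shrink.homeomorph E).symm.continuous

theorem NuAlg.continuous_toSmall (h : IsNuComplete E ν) : Continuous (NuAlg.toSmall E h) :=
  (Shrink.homeomorph E).continuous

theorem NuAlg.fromSmall_toSmall (h : IsNuComplete E ν) (a : E) :
    NuAlg.fromSmall E h (NuAlg.toSmall E h a) = a :=
  (equivShrink E).symm_apply_apply a

theorem NuAlg.toSmall_fromSmall (h : IsNuComplete E ν) (a : NuAlg.ofSmall E h) :
    NuAlg.toSmall E h (NuAlg.fromSmall E h a) = a :=
  (equivShrink E).apply_symm_apply a

end Small

section HatSmash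

variable {ν : Ordinal.{u}}

/-- A representation of `A ∧ X` in `B`: a base point preserving family of *-homomorphisms
`A → B` indexed by the points of `X` for which the map `A × X → B` is (jointly) continuous. Such a
map is the same as a continuous map `A ∧ X → B` that is a *-homomorphism on each copy
`A × {x}` of `A`. -/
@[ext]
structure SmashRep (A : NuAlg ν) (X : PtCpt.{u}) (B : NuAlg ν) where
  hom : X → (A ⟶ B)
  hom_pt : hom X.pt = 0
  continuous_uncurry : Continuous fun z : A × X ↦ hom z.2 z.1

variable (A : NuAlg ν) (X : PtCpt.{u})

/-- The product of the targets of all representations of `A ∧ X`. -/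
abbrev RepProduct : Type (u + 1) := ∀ i : (Σ B : NuAlg ν, SmashRep A X B), i.1

/-- The tautological representation of `A ∧ X` in the product of all representations. -/
def tautological (a : A) (x : X) : RepProduct A X := fun i ↦ i.2.hom x a

/-- The `ν`-closed *-subalgebra generated by the tautological representation. -/
def hatSmashSubalgebra : NonUnitalStarSubalgebra ℂ (RepProduct A X) :=
  sInf {S | IsNuClosed ν (S : Set (RepProduct A X)) ∧ ∀ a x, tautological A X a x ∈ S}

theorem isNuClosed_hatSmashSubalgebra :
    IsNuClosed ν (hatSmashSubalgebra A X : Set (RepProduct A X)) := by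
  intro x hx a ha
  simp only [hatSmashSubalgebra, SetLike.mem_coe, NonUnitalStarAlgebra.mem_sInf] at hx ⊢
  exact fun S hS ↦ hS.1 x (fun α ↦ hx α S hS) a ha

theorem tautological_mem (a : A) (x : X) : tautological A X a x ∈ hatSmashSubalgebra A X :=
  NonUnitalStarAlgebra.mem_sInf.2 fun _ hS ↦ hS.2 a x

/-- The tautological representation at a point of `X`, as a *-homomorphism. -/
def tautologicalHom (x : X) : A →⋆ₙₐ[ℂ] hatSmashSubalgebra A X where
  toFun a := ⟨tautological A X a x, tautological_mem A X a x⟩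
  map_smul' c a := Subtype.ext (funext fun i ↦ map_smul (i.2.hom x) c a)
  map_zero' := Subtype.ext (funext fun i ↦ map_zero (i.2.hom x))
  map_add' a b := Subtype.ext (funext fun i ↦ map_add (i.2.hom x) a b)
  map_mul' a b := Subtype.ext (funext fun i ↦ map_mul (i.2.hom x) a b)
  map_star' a := Subtype.ext (funext fun i ↦ map_star (i.2.hom x) a)

theorem continuous_tautologicalHom :
    Continuous fun z : A × X ↦ tautologicalHom A X z.2 z.1 :=
  Continuous.subtype_mk (continuous_pi fun i ↦ i.2.continuous_uncurry) _

theorem isNuComplete_hatSmashSubalgebra : IsNuComplete (hatSmashSubalgebra A X) ν :=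
  NuAlg.isNuComplete_subalgebra (isNuComplete_pi fun i ↦ i.1.isNuComplete) _
    (isNuClosed_hatSmashSubalgebra A X)

/-- Formal *-algebra expressions in elements of `G`. -/
inductive Term (G : Type u) : Type u
  | gen (g : G) : Term G
  | zero : Term G
  | add (s t : Term G) : Term G
  | mul (s t : Term G) : Term G
  | smul (c : ℂ) (t : Term G) : Term G
  | star (t : Term G) : Term G

/-- The value of an expression. -/
def Term.eval {G : Type u} {E : Type w} [NonUnitalRing E] [StarRing E] [Module ℂ E] (v : G → E) :
    Term G → E
  | gen g => v g
  | zero => 0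
  | add s t => s.eval v + t.eval v
  | mul s t => s.eval v * t.eval v
  | smul c t => c • t.eval v
  | star t => Star.star (t.eval v)

/-- The *-subalgebra of all values of expressions. -/
def Term.range {G : Type u} {E : Type w} [NonUnitalRing E] [StarRing E] [Module ℂ E] (v : G → E) :
    NonUnitalStarSubalgebra ℂ E where
  carrier := Set.range (Term.eval v)
  zero_mem' := ⟨.zero, rfl⟩
  add_mem' := by rintro _ _ ⟨s, rfl⟩ ⟨t, rfl⟩; exact ⟨.add s t, rfl⟩
  mul_mem' := by rintro _ _ ⟨s, rfl⟩ ⟨t, rfl⟩; exact ⟨.mul s t, rfl⟩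
  smul_mem' := by rintro c _ ⟨t, rfl⟩; exact ⟨.smul c t, rfl⟩
  star_mem' := by rintro _ ⟨t, rfl⟩; exact ⟨.star t, rfl⟩

theorem small_closure_range {G : Type u} {E : Type w} [TopologicalSpace E] [T2Space E]
    (v : G → E) : Small.{u} (closure (Set.range v)) := by
  refine small_of_injective (β := Set (Set G))
    (f := fun b ↦ {s | ∃ U ∈ 𝓝 (b : E), v ⁻¹' U = s}) ?_
  intro b b' h
  by_contra hne
  obtain ⟨U, V, hU, hV, hbU, hbV, hUV⟩ := t2_separation (fun h ↦ hne (Subtype.ext h))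
  have h1 : v ⁻¹' U ∈ {s | ∃ U ∈ 𝓝 (b' : E), v ⁻¹' U = s} := by
    rw [← show _ = {s | ∃ U ∈ 𝓝 (b' : E), v ⁻¹' U = s} from h]
    exact ⟨U, hU.mem_nhds hbU, rfl⟩
  obtain ⟨W, hW, hWU⟩ := h1
  obtain ⟨_, ⟨hy1, hy2⟩, ⟨g, rfl⟩⟩ :=
    mem_closure_iff_nhds.1 b'.2 (V ∩ W) (inter_mem (hV.mem_nhds hbV) hW)
  have : g ∈ v ⁻¹' U := hWU ▸ hy2
  exact (Set.disjoint_left.1 hUV this) hy1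

variable [hν : Fact (Cardinal.aleph0 ≤ ν.card)]

instance small_hatSmashSubalgebra : Small.{u} (hatSmashSubalgebra A X) := by
  have := nonempty_toType ν
  let v : A × X → RepProduct A X := fun z ↦ tautological A X z.1 z.2
  have h1 : hatSmashSubalgebra A X ≤ (Term.range v).topologicalClosure := by
    refine sInf_le ⟨fun x hx a ha ↦ ?_, fun a x ↦ ?_⟩
    · exact (NonUnitalStarSubalgebra.isClosed_topologicalClosure _).mem_of_tendsto ha
        (Eventually.of_forall hx)
    · exact NonUnitalStarSubalgebra.le_topologicalClosure _ ⟨.gen (a, x), rfl⟩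
  have := small_closure_range (Term.eval v)
  exact small_subset (s := closure (Set.range (Term.eval v))) h1

/-- The algebra `A ∧̂ X`: the universal `ν`-complete l.m.c.-C*-algebra with a representation of
`A ∧ X`. It is realised as the `ν`-closed *-subalgebra generated by the tautological representation
in the product of all representations. -/
def hatSmashObj : NuAlg ν :=
  NuAlg.ofSmall (hatSmashSubalgebra A X) (isNuComplete_hatSmashSubalgebra A X)

/-- The universal representation `j` of `A ∧ X` in `A ∧̂ X`. -/
def hatSmashIncl : SmashRep A X (hatSmashObj A X) where
  hom x :=
    { toStarHom := (NuAlg.toSmall _ (isNuComplete_hatSmashSubalgebra A X)).comp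
        (tautologicalHom A X x)
      continuous := (NuAlg.continuous_toSmall _ (isNuComplete_hatSmashSubalgebra A X)).comp
        ((continuous_tautologicalHom A X).comp (continuous_id.prodMk continuous_const)) }
  hom_pt := by
    refine NuAlg.hom_ext fun a ↦ ?_
    have : tautologicalHom A X X.pt a = 0 := Subtype.ext (funext fun i ↦ by
      change i.2.hom X.pt a = 0
      rw [i.2.hom_pt, NuAlg.zero_apply])
    exact (congrArg (NuAlg.toSmall _ (isNuComplete_hatSmashSubalgebra A X)) this).trans
      (map_zero _)
  continuous_uncurry := (NuAlg.continuous_toSmall _ (isNuComplete_hatSmashSubalgebra A X)).comp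
    (continuous_tautologicalHom A X)

variable {A X} {B : NuAlg ν}

/-- The projection to the factor given by a representation. -/
def hatSmashProj (φ : SmashRep A X B) : hatSmashSubalgebra A X →⋆ₙₐ[ℂ] B where
  toFun t := t.1 ⟨B, φ⟩
  map_smul' _ _ := rfl
  map_zero' := rfl
  map_add' _ _ := rfl
  map_mul' _ _ := rfl
  map_star' _ := rfl

/-- A representation of `A ∧ X` in `B` induces a morphism `A ∧̂ X ⟶ B`. -/
def hatSmashLift (φ : SmashRep A X B) : hatSmashObj A X ⟶ B where
  toStarHom := (hatSmashProj φ).comp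
    (NuAlg.fromSmall _ (isNuComplete_hatSmashSubalgebra A X))
  continuous := (continuous_apply (A := fun i : (Σ B : NuAlg ν, SmashRep A X B) ↦ i.1.carrier)
    (⟨B, φ⟩ : Σ B : NuAlg ν, SmashRep A X B)).comp
      (continuous_subtype_val.comp
        (NuAlg.continuous_fromSmall _ (isNuComplete_hatSmashSubalgebra A X)))

theorem hatSmashIncl_lift (φ : SmashRep A X B) (x : X) :
    (hatSmashIncl A X).hom x ≫ hatSmashLift φ = φ.hom x := by
  refine NuAlg.hom_ext fun a ↦ ?_
  change (NuAlg.fromSmall _ (isNuComplete_hatSmashSubalgebra A X)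
    (NuAlg.toSmall _ (isNuComplete_hatSmashSubalgebra A X) (tautologicalHom A X x a))).1
      ⟨B, φ⟩ = _
  rw [NuAlg.fromSmall_toSmall]
  rfl

/-- A morphism out of `A ∧̂ X` is determined by its restriction along the universal
representation. -/
theorem hatSmash_hom_ext {f g : hatSmashObj A X ⟶ B}
    (h : ∀ x, (hatSmashIncl A X).hom x ≫ f = (hatSmashIncl A X).hom x ≫ g) : f = g := by
  have := nonempty_toType ν
  let k := NuAlg.toSmall _ (isNuComplete_hatSmashSubalgebra A X)
  have hk := NuAlg.continuous_toSmall _ (isNuComplete_hatSmashSubalgebra A X)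
  let f' : hatSmashSubalgebra A X →⋆ₙₐ[ℂ] B := f.toStarHom.comp k
  let g' : hatSmashSubalgebra A X →⋆ₙₐ[ℂ] B := g.toStarHom.comp k
  let T : NonUnitalStarSubalgebra ℂ (RepProduct A X) :=
    (NonUnitalStarAlgHom.equalizer f' g').map
      (NonUnitalStarSubalgebraClass.subtype (hatSmashSubalgebra A X))
  have hT : hatSmashSubalgebra A X ≤ T := by
    refine sInf_le ⟨fun x hx a ha ↦ ?_, fun a x ↦ ?_⟩
    · choose y hy hyx using hx
      have haG : a ∈ hatSmashSubalgebra A X :=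
        isNuClosed_hatSmashSubalgebra A X x (fun α ↦ hyx α ▸ (y α).2) a ha
      have hya : Tendsto y atTop (𝓝 ⟨a, haG⟩) := by
        refine tendsto_subtype_rng.2 ?_
        convert ha using 2 with α
        exact hyx α
      refine ⟨⟨a, haG⟩, ?_, rfl⟩
      have h1 := ((f.continuous.comp hk).tendsto _).comp hya
      have h2 := ((g.continuous.comp hk).tendsto _).comp hya
      have h3 : (fun α ↦ f' (y α)) = fun α ↦ g' (y α) := funext hy
      refine tendsto_nhds_unique h1 (Tendsto.congr (fun α ↦ ?_) h2)
      exact (congrFun h3 α).symm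
    · exact ⟨tautologicalHom A X x a, DFunLike.congr_fun (h x) a, rfl⟩
  refine NuAlg.hom_ext fun t ↦ ?_
  obtain ⟨s, rfl⟩ : ∃ s, k s = t := ⟨_, NuAlg.toSmall_fromSmall _ _ t⟩
  obtain ⟨s', hs', hss⟩ := hT s.2
  obtain rfl : s' = s := Subtype.ext hss
  exact hs'

/-- A pointed map `h : X ⟶ Y` pulls back representations. -/
def SmashRep.precomp {Y : PtCpt.{u}} (h : X ⟶ Y) (φ : SmashRep A Y B) : SmashRep A X B where
  hom x := φ.hom (h x)
  hom_pt := by rw [PtCpt.apply_pt, φ.hom_pt]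
  continuous_uncurry := φ.continuous_uncurry.comp
    (continuous_fst.prodMk (h.toMap.continuous.comp continuous_snd))

variable (A) in
/-- The functor `A ∧̂ (–)` from pointed compact spaces to `ν`-complete l.m.c.-C*-algebras. -/
def hatSmash : PtCpt.{u} ⥤ NuAlg ν where
  obj X := hatSmashObj A X
  map {_ Y} h := hatSmashLift ((hatSmashIncl A Y).precomp h)
  map_id X := hatSmash_hom_ext fun x ↦ by
    rw [hatSmashIncl_lift, Category.comp_id]; rfl
  map_comp {X Y Z} h k := hatSmash_hom_ext fun x ↦ by
    rw [hatSmashIncl_lift, ← Category.assoc, hatSmashIncl_lift]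
    exact (hatSmashIncl_lift ((hatSmashIncl A Z).precomp k) (h x)).symm

end HatSmash

/-! ### The three conditions -/

section Conditions

variable {ν : Ordinal.{u}} [Fact (Cardinal.aleph0 ≤ ν.card)]

/-- A functor `L` from pointed compact spaces is a partial left adjoint of `Hom(A, –)`: there is a
bijection `Hom(L X, B) ≅ C_*(X, Hom(A, B))` natural in `X` and `B`. -/
structure PartialLeftAdjoint (L : PtCpt.{u} ⥤ NuAlg ν) (A : NuAlg ν) where
  homEquiv (X : PtCpt.{u}) (B : NuAlg ν) : (L.obj X ⟶ B) ≃ PtMap X (A ⟶ B)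
  naturality_right {X : PtCpt.{u}} {B D : NuAlg ν} (f : L.obj X ⟶ B) (g : B ⟶ D) (x : X) :
    (homEquiv X D (f ≫ g)).1 x = A.homMap g ((homEquiv X B f).1 x)
  naturality_left {X Y : PtCpt.{u}} {B : NuAlg ν} (h : X ⟶ Y) (f : L.obj Y ⟶ B) (x : X) :
    (homEquiv X B (L.map h ≫ f)).1 x = (homEquiv Y B f).1 (h x)

/-- A homeomorphism `Hom(A, C_*(X, B)) ≅ C_*(X, Hom(A, B))` natural in `X` and `B`. -/
structure MappingSpaceHomeo (A : NuAlg ν) where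
  homeo (X : PtCpt.{u}) (B : NuAlg ν) : (A ⟶ ptcof X B) ≃ₜ PtMap X (A ⟶ B)
  naturality_right {X : PtCpt.{u}} {B D : NuAlg ν} (f : A ⟶ ptcof X B) (g : B ⟶ D) (x : X) :
    (homeo X D (f ≫ ptcofMap X g)).1 x = A.homMap g ((homeo X B f).1 x)
  naturality_left {X Y : PtCpt.{u}} {B : NuAlg ν} (h : X ⟶ Y) (f : A ⟶ ptcof Y B) (x : X) :
    (homeo X B (f ≫ ptcofPrecomp h B)).1 x = (homeo Y B f).1 (h x)

/-- The seminorm extension property: every continuous C*-seminorm on the source is the pullback of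
a continuous C*-seminorm on the target. -/
def HasSeminormExtension {A B : NuAlg ν} (f : A ⟶ B) : Prop :=
  ∀ p : Seminorm ℂ A, Continuous p → IsCStarSeminorm p →
    ∃ q : Seminorm ℂ B, Continuous q ∧ IsCStarSeminorm q ∧ ∀ a, q (f a) = p a

/-- The strong cylinder seminorm extension property: for every pointed compact space `X`, the
inclusion `i₁ : A ∧̂ X ⟶ (A ∧̂ X) ∧̂ I` of the end `1` of the (reduced) cylinder, where `I` has base
point `0`, has the seminorm extension property. -/
def StrongCylinderSeminormExtension (A : NuAlg ν) : Prop :=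
  ∀ X : PtCpt.{u}, HasSeminormExtension
    ((hatSmashIncl ((hatSmash A).obj X) PtCpt.interval.{u}).hom (ULift.up (1 : unitInterval)))

/-- The inclusion `S^{n-1} → D^n`. -/
def sphereInclusion (n : ℕ) : C(TopCat.diskBoundary.{u} n, TopCat.disk.{u} n) :=
  (TopCat.diskBoundaryInclusion n).hom

instance (n : ℕ) : T2Space (TopCat.disk.{u} n) :=
  inferInstanceAs (T2Space (ULift (Metric.closedBall (0 : EuclideanSpace ℝ (Fin n)) 1)))

instance (n : ℕ) : T2Space (TopCat.diskBoundary.{u} n) :=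
  inferInstanceAs (T2Space (ULift (Metric.sphere (0 : EuclideanSpace ℝ (Fin n)) 1)))

/-- The class of the morphisms `A ∧̂ (S^{n-1}₊ → D^n₊)`, for `n ≥ 0`, where `S^{-1} = ∅`. -/
def generatingCells (A : NuAlg ν) : MorphismProperty (NuAlg ν) :=
  MorphismProperty.ofHoms fun n : ℕ ↦ (hatSmash A).map (PtCpt.plusMap (sphereInclusion.{u} n))

end Conditions

/-! ### Serre fibrations and weak homotopy equivalences -/

section Serre

variable {X Y : Type u} [TopologicalSpace X] [TopologicalSpace Y]

/-- A Serre fibration: a map with the homotopy lifting property for all cubes. -/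
def IsSerreFibration (f : C(X, Y)) : Prop :=
  ∀ (n : ℕ) (g : C(Fin n → unitInterval, X)) (H : C((Fin n → unitInterval) × unitInterval, Y)), (∀ t, H (t, 0) = f (g t)) →
    ∃ K : C((Fin n → unitInterval) × unitInterval, X), (∀ t, K (t, 0) = g t) ∧ ∀ z, f (K z) = H z

/-- The map induced on sets of path components. -/
def zerothHomotopyMap (f : C(X, Y)) : ZerothHomotopy X → ZerothHomotopy Y :=
  Quotient.map f fun _ _ h ↦ h.map f.continuous

/-- The map induced on homotopy groups. -/
def homotopyGroupMap (n : ℕ) (f : C(X, Y)) (x : X) :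
    HomotopyGroup.Pi n X x → HomotopyGroup.Pi n Y (f x) :=
  Quotient.map (fun γ ↦ ⟨f.comp γ.1, fun t ht ↦ congrArg f (γ.2 t ht)⟩)
    fun _ _ h ↦ ContinuousMap.HomotopicRel.comp_continuousMap h f

/-- A weak homotopy equivalence: a map inducing bijections on path components and on the homotopy
groups at all base points. -/
def IsWeakHomotopyEquiv (f : C(X, Y)) : Prop :=
  Function.Bijective (zerothHomotopyMap f) ∧
    ∀ (n : ℕ) (x : X), Function.Bijective (homotopyGroupMap (n + 1) f x)

end Serre

/-! ### Cofibrantly generated and right proper model categories -/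

section Model

variable {C : Type (u + 1)} [Category.{u} C]

/-- `I`-cell: transfinite compositions of pushouts of coproducts of morphisms in `I`. -/
def relativeCells (I : MorphismProperty C) : MorphismProperty C :=
  MorphismProperty.transfiniteCompositions.{u} (MorphismProperty.coproducts.{u} I).pushouts

/-- An object `A` is small relative to a class `D` of morphisms: for some cardinal `κ`, and every
`κ`-filtered ordinal `o` (that is, a limit ordinal of cofinality `> κ`), the functor `Hom(A, –)`
preserves the colimit of every `o`-sequence of morphisms in `D`. -/
def IsSmallRelativeTo (A : C) (D : MorphismProperty C) : Prop :=
  ∃ κ : Cardinal.{u}, ∀ o : Ordinal.{u}, Order.IsSuccLimit o → κ < o.cof →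
    ∀ F : o.ToType ⥤ C, F.IsWellOrderContinuous →
      (∀ j : o.ToType, D (F.map (homOfLE (Order.le_succ j)))) →
        PreservesColimit F (coyoneda.obj (Opposite.op A))

/-- The model category `C` is cofibrantly generated by the sets `I` of generating cofibrations and
`J` of generating trivial cofibrations. -/
structure IsCofibrantlyGeneratedBy [ModelCategory C] (I J : MorphismProperty C) : Prop where
  isSmall_I : MorphismProperty.IsSmall.{u} I
  isSmall_J : MorphismProperty.IsSmall.{u} J
  small_I : ∀ ⦃A B : C⦄ (i : A ⟶ B), I i → IsSmallRelativeTo A (relativeCells I)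
  small_J : ∀ ⦃A B : C⦄ (j : A ⟶ B), J j → IsSmallRelativeTo A (relativeCells J)
  fibrations_eq : fibrations C = J.rlp
  trivialFibrations_eq : trivialFibrations C = I.rlp

variable (C) in
/-- A model category is right proper if weak equivalences are stable under pullback along
fibrations. -/
def IsRightProper [ModelCategory C] : Prop :=
  ∀ ⦃P X Y Z : C⦄ (p' : P ⟶ X) (w' : P ⟶ Y) (w : X ⟶ Z) (p : Y ⟶ Z), IsPullback p' w' w p →
    Fibration p → WeakEquivalence w → WeakEquivalence w'

end Model

end LMCStar

end

/-!
The classes of morphisms are those forced on the model structure: the fibrations and the weak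
equivalences are the morphisms that `Hom(A, –)` sends to Serre fibrations and to weak homotopy
equivalences, and the cofibrations are defined by the left lifting property. The partial adjunction
turns the lifting property of a cell `A ∧̂ (S₊ → D₊)` against `f` into the lifting property of `S →
D` against `Hom(A, f)` (`hasLiftingProperty_iff`). So the morphisms with the right lifting property
with respect to `A ∧̂ (I^n₊ → (I^n × I)₊)` are the fibrations, and those with the right lifting
property with respect to `A ∧̂ (S^{n-1}₊ → D^n₊)` are the fibrations that are weak equivalences
(`generatingCells_rlp`).

The factorizations come from the small object argument, and smallness is where the seminorm
extension property enters. The class of morphisms along which all continuous C*-seminorms extend is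
closed under coproducts, pushouts and transfinite compositions
(`relativeCells_le_seminormExtensions`). For pushouts this is the amalgamation of C*-algebras over a
common C*-subalgebra (`exists_amalgam`): states of the subalgebra extend to the larger algebras, so
that sums of GNS representations, taken with large multiplicity, become unitarily equivalent after
restriction to it (`exists_unitary_intertwiner`). The cells belong to the class because `A ∧̂
S^{n-1}₊ → A ∧̂ D^n₊` is a factor of the end of a cylinder, as the disk is a cone on the sphere
(`hasSeminormExtension_map_of_cone`). The morphisms in the class are embeddings with `ν`-closed
range. In the colimit of a chain of them whose cofinality is larger than the cardinality of `ν`,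
every `ν`-sequence in the union of the stages lies in a single stage, so that the union is
`ν`-closed and is the whole colimit (`mem_unionOfRanges`). Hence every object is small relative to
the class (`isSmallRelativeTo_of_le_seminormExtensions`).

What remains is that morphisms with the left lifting property against all fibrations are weak
equivalences (`compressible_of_llp`). By the mapping space homeomorphism, `C_*(I₊, D)` is a path
object: `Hom(A, C_*(I₊, D))` is the path space of `Hom(A, D)`, so the evaluation at the end points
is a fibration. Lifting against it, and against `B → 0`, exhibits `Hom(A, j)` as the inclusion of a
strong deformation retract. Every other part of the model structure is formal, or is elementary
homotopy theory of maps on cubes: a map is a weak homotopy equivalence if and only if maps of cubes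
relative to their boundaries can be compressed into its source
(`isWeakHomotopyEquiv_iff_compressible`). This criterion gives the two-out-of-three property, the
lifting of boundaries of cubes against trivial fibrations, and right properness.
-/

noncomputable section

namespace LMCStar

/-! ### Isometries and states -/

section States

open scoped ComplexOrder InnerProductSpace
open PositiveLinearMap

attribute [local instance] CStarAlgebra.spectralOrder CStarAlgebra.spectralOrderedRing

/-- Two linear maps with the same norms, the first of dense range, differ by an isometry. -/
theorem exists_linearIsometry_of_norm_eq {G H H' : Type*} [AddCommGroup G] [Module ℂ G]
    [NormedAddCommGroup H] [NormedSpace ℂ H] [NormedAddCommGroup H'] [NormedSpace ℂ H']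
    [CompleteSpace H'] (a : G →ₗ[ℂ] H) (b : G →ₗ[ℂ] H') (hab : ∀ g, ‖b g‖ = ‖a g‖)
    (ha : DenseRange a) : ∃ V : H →ₗᵢ[ℂ] H', ∀ g, V (a g) = b g := by
  have hb : ∀ g, ‖b g‖ ≤ 1 * ‖a g‖ := fun g ↦ by rw [one_mul, hab]
  have h1 := LinearMap.extendOfNorm_eq (f := b) (e := a) ha ⟨1, hb⟩
  refine ⟨⟨(b.extendOfNorm a : H →ₗ[ℂ] H'), fun v ↦ ?_⟩, h1⟩
  refine ha.induction_on (p := fun v ↦ ‖b.extendOfNorm a v‖ = ‖v‖) v ?_ fun g ↦ ?_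
  · exact isClosed_eq (b.extendOfNorm a).continuous.norm continuous_norm
  · rw [h1, hab]

/-- A functional of norm at most `1` with value `1` at the unit is real on self-adjoint elements. -/
theorem im_apply_eq_zero_of_norm_le_one {P : Type*} [CStarAlgebra P] (f : StrongDual ℂ P)
    (hf : ‖f‖ ≤ 1) (h1 : f 1 = 1) {a : P} (ha : IsSelfAdjoint a) : (f a).im = 0 := by
  -- `|f (a + i t)| ≤ ‖a + i t‖`, and the square of the right side is at most `‖a‖ ^ 2 + t ^ 2`
  have key : ∀ t : ℝ, ((f a).im + t) ^ 2 ≤ ‖a‖ ^ 2 + t ^ 2 := by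
    intro t
    have hn : ‖a + (t * Complex.I) • (1 : P)‖ ^ 2 ≤ ‖a‖ ^ 2 + t ^ 2 := by
      rw [sq, ← CStarRing.norm_star_mul_self]
      have e : star (a + (t * Complex.I) • (1 : P)) * (a + (t * Complex.I) • (1 : P)) =
          a * a + ((t ^ 2 : ℝ) : ℂ) • (1 : P) := by
        rw [star_add, ha.star_eq, star_smul, star_one, add_mul, mul_add, mul_add]
        simp only [mul_smul_comm, smul_mul_assoc, mul_one, one_mul, smul_smul]
        have e1 : star ((t : ℂ) * Complex.I) = -((t : ℂ) * Complex.I) := by simp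
        have e2 : -((t : ℂ) * Complex.I) * ((t : ℂ) * Complex.I) = ((t ^ 2 : ℝ) : ℂ) := by
          push_cast
          linear_combination (-(t : ℂ) ^ 2) * Complex.I_mul_I
        rw [e1, show (t : ℂ) * Complex.I * -((t : ℂ) * Complex.I) = ((t ^ 2 : ℝ) : ℂ) by
          rw [← e2]; ring, neg_smul]
        abel
      rw [e]
      refine (norm_add_le _ _).trans (add_le_add ((norm_mul_le _ _).trans_eq (sq _).symm) ?_)
      rw [norm_smul, Complex.norm_real, Real.norm_of_nonneg (sq_nonneg t)]
      refine mul_le_of_le_one_right (sq_nonneg t) ?_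
      rcases subsingleton_or_nontrivial P with _ | _
      · simp [Subsingleton.elim (1 : P) 0]
      · rw [CStarRing.norm_one]
    have hle : ‖f (a + (t * Complex.I) • (1 : P))‖ ≤ ‖a + (t * Complex.I) • (1 : P)‖ :=
      (f.le_opNorm _).trans (mul_le_of_le_one_left (norm_nonneg _) hf)
    have him : (f (a + (t * Complex.I) • (1 : P))).im = (f a).im + t := by
      rw [map_add, map_smul, h1]; simp
    rw [← him]
    calc _ ≤ ‖f (a + (t * Complex.I) • (1 : P))‖ ^ 2 := by
            rw [← sq_abs]; exact pow_le_pow_left₀ (abs_nonneg _) (Complex.abs_im_le_norm _) 2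
      _ ≤ _ := (pow_le_pow_left₀ (norm_nonneg _) hle 2).trans hn
  by_contra h
  have h2 := key ((‖a‖ ^ 2 + 1) / (2 * (f a).im))
  have h3 : (f a).im * ((‖a‖ ^ 2 + 1) / (2 * (f a).im)) = (‖a‖ ^ 2 + 1) / 2 := by field_simp
  nlinarith [sq_nonneg (f a).im]

theorem nonneg_apply_of_norm_le_one {P : Type*} [CStarAlgebra P] (f : StrongDual ℂ P)
    (hf : ‖f‖ ≤ 1) (h1 : f 1 = 1) {a : P} (ha : 0 ≤ a) : 0 ≤ f a := by
  have him := im_apply_eq_zero_of_norm_le_one f hf h1 (IsSelfAdjoint.of_nonneg ha)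
  rw [Complex.nonneg_iff]
  refine ⟨?_, him.symm⟩
  have h2 : ‖(algebraMap ℝ P ‖a‖) - a‖ ≤ ‖a‖ := by
    rw [CStarAlgebra.norm_le_iff_le_algebraMap _ (norm_nonneg a)
      (sub_nonneg.2 (IsSelfAdjoint.of_nonneg ha).le_algebraMap_norm_self)]
    exact sub_le_self _ ha
  have h3 : ‖f ((algebraMap ℝ P ‖a‖) - a)‖ ≤ ‖a‖ :=
    ((f.le_opNorm _).trans (mul_le_of_le_one_left (norm_nonneg _) hf)).trans h2
  have h4 : f (algebraMap ℝ P ‖a‖) = ‖a‖ := by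
    rw [IsScalarTower.algebraMap_apply ℝ ℂ P, Algebra.algebraMap_eq_smul_one, map_smul, h1]
    simp
  have h5 := (Complex.re_le_norm _).trans h3
  rw [map_sub, h4] at h5
  simp at h5
  linarith

/-- A state on a unital C*-subalgebra extends to a positive functional on the C*-algebra: a
norm-preserving extension is positive because it attains its norm at the unit. -/
theorem exists_positiveLinearMap_extension {X P : Type*} [CStarAlgebra X] [CStarAlgebra P]
    (j : X →⋆ₐ[ℂ] P) (hj : Function.Injective j) (ω : StrongDual ℂ X) (hω : ‖ω‖ ≤ 1)
    (h1 : ω 1 = 1) : ∃ φ : P →ₚ[ℂ] ℂ, ∀ x, φ (j x) = ω x := by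
  have hji : Isometry j := NonUnitalStarAlgHom.isometry j hj
  let e : X →ₗᵢ[ℂ] P := ⟨(j : X →ₗ[ℂ] P), fun x ↦ NonUnitalStarAlgHom.norm_map j hj x⟩
  let r := e.equivRange
  obtain ⟨g, hg, hgn⟩ := exists_extension_norm_eq (LinearMap.range e.toLinearMap)
    (ω.comp (r.symm : LinearMap.range e.toLinearMap →L[ℂ] X))
  have hg' : ∀ x, g (j x) = ω x := fun x ↦ by
    have := hg (r x)
    rw [show ((r x : LinearMap.range e.toLinearMap) : P) = j x from rfl] at this
    simpa [r] using this
  have hgn' : ‖g‖ ≤ 1 := by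
    rw [hgn]
    refine ContinuousLinearMap.opNorm_le_bound _ zero_le_one fun y ↦ ?_
    have := ω.le_of_opNorm_le hω (r.symm y)
    simpa using this
  have hg1 : g 1 = 1 := by rw [← map_one j, hg', h1]
  exact ⟨PositiveLinearMap.mk₀ (g : P →ₗ[ℂ] ℂ) fun a ha ↦
    nonneg_apply_of_norm_le_one g hgn' hg1 ha, hg'⟩

/-- Positive functionals separate the elements of a C*-algebra. -/
theorem exists_positiveLinearMap_ne_zero {P : Type*} [CStarAlgebra P] {b : P} (hb : b ≠ 0) :
    ∃ φ : P →ₚ[ℂ] ℂ, φ (star b * b) ≠ 0 := by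
  have : Nontrivial P := ⟨b, 0, hb⟩
  let a : P := star b * b
  have ha : IsSelfAdjoint a := .star_mul_self b
  have hn : ‖a‖ ≠ 0 := by
    rw [CStarRing.norm_star_mul_self]
    simpa using hb
  have := ha.isStarNormal
  let E := StarAlgebra.elemental ℂ a
  let a' : E := ⟨a, StarAlgebra.elemental.self_mem ℂ a⟩
  have ha' : IsSelfAdjoint a' := Subtype.ext ha
  have hs : ∃ r : ℝ, r ≠ 0 ∧ r ∈ spectrum ℝ a' := by
    have hne : ‖a'‖ ≠ 0 := hn
    rcases CStarAlgebra.norm_or_neg_norm_mem_spectrum ha' with h | h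
    · exact ⟨_, hne, h⟩
    · exact ⟨_, neg_ne_zero.2 hne, h⟩
  obtain ⟨r, hr, hrs⟩ := hs
  have hrs' : (r : ℂ) ∈ spectrum ℂ a' := (spectrum.algebraMap_mem_iff ℂ).2 hrs
  obtain ⟨χ, hχ⟩ := WeakDual.CharacterSpace.mem_spectrum_iff_exists.1 hrs'
  obtain ⟨φ, hφ⟩ := exists_positiveLinearMap_extension E.subtype Subtype.val_injective
    (WeakDual.toStrongDual (χ : WeakDual ℂ E)) (WeakDual.CharacterSpace.norm_le_norm_one χ |>.trans
      (by rw [CStarRing.norm_one])) (map_one χ)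
  refine ⟨φ, ?_⟩
  have h2 : φ a = χ a' := hφ a'
  change φ a ≠ 0
  rw [h2, hχ]
  exact_mod_cast hr

end States

/-! ### Representations on Hilbert sums -/

section Representations

open scoped ComplexOrder InnerProductSpace ENNReal
open PositiveLinearMap ContinuousLinearMap

attribute [local instance] CStarAlgebra.spectralOrder CStarAlgebra.spectralOrderedRing

section DirectSum

variable {ι : Type*} {H : ι → Type*} [∀ i, NormedAddCommGroup (H i)]
  [∀ i, InnerProductSpace ℂ (H i)]

theorem memℓp_diagonal (T : ∀ i, H i →L[ℂ] H i) {C : ℝ} (hT : ∀ i, ‖T i‖ ≤ C)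
    (v : lp H 2) : Memℓp (fun i ↦ T i (v i)) 2 := by
  refine ((lp.memℓp v).const_smul (C : ℂ)).mono' fun i ↦ ?_
  rw [Pi.smul_apply, norm_smul]
  refine ((T i).le_of_opNorm_le (hT i) (v i)).trans ?_
  rw [Complex.norm_real, Real.norm_eq_abs]
  exact mul_le_mul_of_nonneg_right (le_abs_self C) (norm_nonneg _)

theorem norm_diagonal_le (T : ∀ i, H i →L[ℂ] H i) {C : ℝ} (h0 : 0 ≤ C) (hT : ∀ i, ‖T i‖ ≤ C)
    (v : lp H 2) : ‖(⟨fun i ↦ T i (v i), memℓp_diagonal T hT v⟩ : lp H 2)‖ ≤ C * ‖v‖ := by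
  have h : ‖(C : ℂ) • v‖ = C * ‖v‖ := by
    rw [norm_smul, Complex.norm_real, Real.norm_of_nonneg h0]
  rw [← h]
  refine lp.norm_mono (by norm_num) fun i ↦ ?_
  rw [lp.coeFn_smul, Pi.smul_apply, norm_smul, Complex.norm_real, Real.norm_of_nonneg h0]
  exact (T i).le_of_opNorm_le (hT i) (v i)

/-- The Hilbert sum of a family of representations of a C*-algebra. -/
def directSumRep {P : Type*} [CStarAlgebra P] [∀ i, CompleteSpace (H i)]
    (π : ∀ i, P →⋆ₐ[ℂ] (H i →L[ℂ] H i)) : P →⋆ₐ[ℂ] (lp H 2 →L[ℂ] lp H 2) where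
  toFun a := LinearMap.mkContinuous
    { toFun v := ⟨fun i ↦ π i a (v i), memℓp_diagonal (fun i ↦ π i a)
        (fun i ↦ NonUnitalStarAlgHom.norm_apply_le (π i) a) v⟩
      map_add' v v' := lp.ext (funext fun i ↦ map_add (π i a) _ _)
      map_smul' c v := lp.ext (funext fun i ↦ map_smul (π i a) _ _) } ‖a‖
    (norm_diagonal_le _ (norm_nonneg a) fun i ↦ NonUnitalStarAlgHom.norm_apply_le (π i) a)
  map_one' := by
    ext v i
    change (π i 1) (v i) = v i
    rw [map_one]; rfl
  map_zero' := by
    ext v i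
    change (π i 0) (v i) = 0
    rw [map_zero]; rfl
  map_mul' a b := by
    ext v i
    change (π i (a * b)) (v i) = π i a (π i b (v i))
    rw [map_mul]; rfl
  map_add' a b := by
    ext v i
    change (π i (a + b)) (v i) = π i a (v i) + π i b (v i)
    rw [map_add]; rfl
  commutes' c := by
    ext v i
    change (π i (algebraMap ℂ P c)) (v i) = c • v i
    rw [AlgHomClass.commutes, Algebra.algebraMap_eq_smul_one]; rfl
  map_star' a := by
    rw [star_eq_adjoint, eq_adjoint_iff]
    intro v v'
    rw [lp.inner_eq_tsum, lp.inner_eq_tsum]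
    refine tsum_congr fun i ↦ ?_
    change ⟪(π i (star a)) (v i), v' i⟫_ℂ = ⟪v i, (π i a) (v' i)⟫_ℂ
    rw [map_star, star_eq_adjoint, adjoint_inner_left]

theorem directSumRep_apply {P : Type*} [CStarAlgebra P] [∀ i, CompleteSpace (H i)]
    (π : ∀ i, P →⋆ₐ[ℂ] (H i →L[ℂ] H i)) (a : P) (v : lp H 2) (i : ι) :
    directSumRep π a v i = π i a (v i) := rfl

theorem directSumRep_single {P : Type*} [CStarAlgebra P] [∀ i, CompleteSpace (H i)]
    [DecidableEq ι] (π : ∀ i, P →⋆ₐ[ℂ] (H i →L[ℂ] H i)) (a : P) (i : ι) (v : H i) :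
    directSumRep π a (lp.single 2 i v) = lp.single 2 i (π i a v) := by
  refine lp.ext (funext fun k ↦ ?_)
  rw [directSumRep_apply]
  rcases eq_or_ne k i with rfl | h
  · rw [lp.single_apply_self, lp.single_apply_self]
  · rw [lp.single_apply_ne _ _ _ h, lp.single_apply_ne _ _ _ h, map_zero]

theorem inner_directSumRep_single_self [DecidableEq ι] {P : Type*} [CStarAlgebra P]
    [∀ i, CompleteSpace (H i)]
    (π : ∀ i, P →⋆ₐ[ℂ] (H i →L[ℂ] H i)) (a : P) (i : ι) (v : H i) :
    ⟪(lp.single 2 i v : lp H 2), directSumRep π a (lp.single 2 i v)⟫_ℂ = ⟪v, π i a v⟫_ℂ := by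
  rw [directSumRep_single, lp.inner_single_left, lp.single_apply_self]

theorem inner_directSumRep_single_of_ne [DecidableEq ι] {P : Type*} [CStarAlgebra P]
    [∀ i, CompleteSpace (H i)]
    (π : ∀ i, P →⋆ₐ[ℂ] (H i →L[ℂ] H i)) (a : P) {i k : ι} (h : i ≠ k) (v : H i) (v' : H k) :
    ⟪(lp.single 2 i v : lp H 2), directSumRep π a (lp.single 2 k v')⟫_ℂ = 0 := by
  rw [directSumRep_single, lp.inner_single_left, lp.single_apply_ne _ _ _ h, inner_zero_right]

end DirectSum

/-- The sum of the GNS representations of all positive functionals, with multiplicity `T`. -/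
abbrev UnivSpace (P : Type*) [CStarAlgebra P] (T : Type*) : Type _ :=
  lp (fun i : (P →ₚ[ℂ] ℂ) × T ↦ i.1.GNS) 2

/-- The action of a C*-algebra on the sum of its GNS representations. -/
def univRep (P : Type*) [CStarAlgebra P] (T : Type*) :
    P →⋆ₐ[ℂ] (UnivSpace P T →L[ℂ] UnivSpace P T) :=
  directSumRep fun i : (P →ₚ[ℂ] ℂ) × T ↦ i.1.gnsStarAlgHom

open Classical in
theorem univRep_injective (P : Type*) [CStarAlgebra P] (T : Type*) [Nonempty T] :
    Function.Injective (univRep P T) := by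
  rw [injective_iff_map_eq_zero]
  intro b hb
  by_contra hne
  obtain ⟨φ, hφ⟩ := exists_positiveLinearMap_ne_zero hne
  obtain ⟨t⟩ := ‹Nonempty T›
  have h1 : univRep P T b (lp.single 2 ((φ, t) : (P →ₚ[ℂ] ℂ) × T)
      ((φ.toPreGNS 1 : φ.PreGNS) : φ.GNS)) = 0 := by rw [hb]; rfl
  have h2 := congrArg (fun v : UnivSpace P T ↦ v (φ, t)) h1
  simp only [univRep, directSumRep_single, lp.single_apply_self] at h2
  have h3 : ((φ.toPreGNS b : φ.PreGNS) : φ.GNS) = 0 := by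
    refine Eq.trans ?_ h2
    rw [gnsStarAlgHom_apply]
    simp
  have h4 : ‖φ.toPreGNS b‖ = 0 := by
    rw [← UniformSpace.Completion.norm_coe, h3, norm_zero]
  have h5 := φ.preGNS_norm_sq (φ.toPreGNS b)
  rw [h4] at h5
  simp at h5
  exact hφ h5.symm

theorem norm_sum_sq_of_pairwise {E : Type*} [NormedAddCommGroup E] [InnerProductSpace ℂ E]
    {ι : Type*} (s : Finset ι) (v : ι → E) (h : ∀ i j, i ≠ j → ⟪v i, v j⟫_ℂ = 0) :
    ‖∑ i ∈ s, v i‖ ^ 2 = ∑ i ∈ s, ‖v i‖ ^ 2 := by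
  classical
  induction s using Finset.induction_on with
  | empty => simp
  | insert i s hi ih =>
    rw [Finset.sum_insert hi, Finset.sum_insert hi, ← ih]
    have := norm_add_sq_eq_norm_sq_add_norm_sq_of_inner_eq_zero (𝕜 := ℂ) (v i) (∑ k ∈ s, v k) (by
      rw [inner_sum]
      exact Finset.sum_eq_zero fun k hk ↦ h i k (by rintro rfl; exact hi hk))
    simpa only [sq] using this

variable {X P : Type*} [CStarAlgebra X] [CStarAlgebra P] {H : Type*} [NormedAddCommGroup H]
  [InnerProductSpace ℂ H] [CompleteSpace H]

theorem inner_rep_rep (π : X →⋆ₐ[ℂ] (H →L[ℂ] H)) (x y : X) (v v' : H) :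
    ⟪π x v, π y v'⟫_ℂ = ⟪v, π (star x * y) v'⟫_ℂ := by
  have h1 : π (star x * y) v' = adjoint (π x) (π y v') := by
    rw [map_mul, map_star]; rfl
  rw [h1, adjoint_inner_right]

theorem rep_one_apply (π : X →⋆ₐ[ℂ] (H →L[ℂ] H)) (v : H) : π 1 v = v := by
  rw [map_one]; rfl

/-- The orbit map of a vector. -/
def orbitMap (π : X →⋆ₐ[ℂ] (H →L[ℂ] H)) (v : H) : X →ₗ[ℂ] H where
  toFun x := π x v
  map_add' x y := by rw [map_add]; rfl
  map_smul' c x := by rw [map_smul]; rfl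

/-- The vector functional of a unit vector extends to a larger algebra. -/
theorem exists_extension_vectorState (j : X →⋆ₐ[ℂ] P) (hj : Function.Injective j)
    (π : X →⋆ₐ[ℂ] (H →L[ℂ] H)) (ξ : H) (hξ : ‖ξ‖ = 1) :
    ∃ φ : P →ₚ[ℂ] ℂ, ∀ x, φ (j x) = ⟪ξ, π x ξ⟫_ℂ := by
  let ω : StrongDual ℂ X := LinearMap.mkContinuous
    ((innerSL ℂ ξ : H →ₗ[ℂ] ℂ).comp (orbitMap π ξ)) 1 (fun x ↦ by
    refine (norm_inner_le_norm ξ (π x ξ)).trans ?_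
    rw [hξ, one_mul, one_mul]
    refine ((π x).le_opNorm _).trans ?_
    rw [hξ, mul_one]
    exact NonUnitalStarAlgHom.norm_apply_le π x)
  refine exists_positiveLinearMap_extension j hj ω
    (LinearMap.mkContinuous_norm_le _ zero_le_one _) ?_
  change ⟪ξ, π 1 ξ⟫_ℂ = 1
  rw [rep_one_apply, inner_self_eq_norm_sq_to_K, hξ]
  simp

/-- Vectors with orthogonal orbits and the same vector functionals determine an isometric
intertwiner. -/
theorem exists_intertwiner_of_inner_eq {K : Type*} [NormedAddCommGroup K] [InnerProductSpace ℂ K]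
    [CompleteSpace K] {ι : Type*} (π : X →⋆ₐ[ℂ] (H →L[ℂ] H)) (ρ : X →⋆ₐ[ℂ] (K →L[ℂ] K))
    (ξ : ι → H) (η : ι → K)
    (hξ : ∀ s s', s ≠ s' → ∀ x, ⟪ξ s, π x (ξ s')⟫_ℂ = 0)
    (hη : ∀ s s', s ≠ s' → ∀ x, ⟪η s, ρ x (η s')⟫_ℂ = 0)
    (hξη : ∀ s x, ⟪η s, ρ x (η s)⟫_ℂ = ⟪ξ s, π x (ξ s)⟫_ℂ)
    (htot : ∀ v, (∀ s x, ⟪π x (ξ s), v⟫_ℂ = 0) → v = 0) :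
    ∃ V : H →ₗᵢ[ℂ] K, ∀ x v, V (π x v) = ρ x (V v) := by
  classical
  let ax (s : ι) : X →ₗ[ℂ] H := orbitMap π (ξ s)
  let bx (s : ι) : X →ₗ[ℂ] K := orbitMap ρ (η s)
  have hax : ∀ s s' x y, s ≠ s' → ⟪ax s x, ax s' y⟫_ℂ = 0 := fun s s' x y h ↦
    (inner_rep_rep π x y _ _).trans (hξ s s' h _)
  have hbx : ∀ s s' x y, s ≠ s' → ⟪bx s x, bx s' y⟫_ℂ = 0 := fun s s' x y h ↦
    (inner_rep_rep ρ x y _ _).trans (hη s s' h _)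
  have hn : ∀ s x, ‖bx s x‖ ^ 2 = ‖ax s x‖ ^ 2 := fun s x ↦ by
    have h1 : ((‖bx s x‖ : ℂ) ^ 2) = ((‖ax s x‖ : ℂ) ^ 2) := by
      refine (inner_self_eq_norm_sq_to_K (𝕜 := ℂ) (bx s x)).symm.trans (Eq.trans ?_
        (inner_self_eq_norm_sq_to_K (𝕜 := ℂ) (ax s x)))
      exact (inner_rep_rep ρ x x _ _).trans ((hξη s _).trans (inner_rep_rep π x x _ _).symm)
    exact_mod_cast h1
  let a : (ι →₀ X) →ₗ[ℂ] H := Finsupp.lsum ℂ ax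
  let b : (ι →₀ X) →ₗ[ℂ] K := Finsupp.lsum ℂ bx
  have hab : ∀ g, ‖b g‖ = ‖a g‖ := fun g ↦ by
    have h1 : ‖b g‖ ^ 2 = ‖a g‖ ^ 2 := by
      rw [Finsupp.lsum_apply, Finsupp.lsum_apply, Finsupp.sum, Finsupp.sum,
        norm_sum_sq_of_pairwise _ _ fun s s' h ↦ hbx s s' _ _ h,
        norm_sum_sq_of_pairwise _ _ fun s s' h ↦ hax s s' _ _ h]
      exact Finset.sum_congr rfl fun s _ ↦ hn s _
    exact (pow_left_inj₀ (norm_nonneg _) (norm_nonneg _) two_ne_zero).1 h1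
  have ha1 : ∀ s x, a (Finsupp.single s x) = π x (ξ s) := fun s x ↦ by
    rw [Finsupp.lsum_single]; rfl
  have hb1 : ∀ s x, b (Finsupp.single s x) = ρ x (η s) := fun s x ↦ by
    rw [Finsupp.lsum_single]; rfl
  have hd : DenseRange a := by
    have h1 : (LinearMap.range a).topologicalClosure = ⊤ := by
      rw [Submodule.topologicalClosure_eq_top_iff, Submodule.eq_bot_iff]
      intro v hv
      refine htot v fun s x ↦ ?_
      rw [← ha1]
      exact hv _ ⟨_, rfl⟩
    intro v
    have : v ∈ (LinearMap.range a).topologicalClosure := h1 ▸ Submodule.mem_top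
    exact this
  obtain ⟨V, hV⟩ := exists_linearIsometry_of_norm_eq a b hab hd
  refine ⟨V, fun x v ↦ ?_⟩
  refine hd.induction_on (p := fun v ↦ V (π x v) = ρ x (V v)) v ?_ fun g ↦ ?_
  · exact isClosed_eq (V.continuous.comp (π x).continuous)
      ((ρ x).continuous.comp V.continuous)
  induction g using Finsupp.induction_linear with
  | zero => simp
  | add g g' h h' => rw [map_add, map_add, map_add, h, h', ← map_add, ← map_add, ← map_add]
  | single s y =>
    have h1 : π x (a (Finsupp.single s y)) = a (Finsupp.single s (x * y)) := by
      rw [ha1, ha1, map_mul]; rfl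
    rw [h1, hV, hV, hb1, hb1, map_mul]
    rfl

theorem inner_gns_one (φ : P →ₚ[ℂ] ℂ) (a : P) :
    ⟪((φ.toPreGNS 1 : φ.PreGNS) : φ.GNS), φ.gnsStarAlgHom a (φ.toPreGNS 1 : φ.PreGNS)⟫_ℂ =
      φ a := by
  change ⟪_, φ.gnsNonUnitalStarAlgHom a (φ.toPreGNS 1 : φ.PreGNS)⟫_ℂ = φ a
  rw [gnsNonUnitalStarAlgHom_apply_coe, UniformSpace.Completion.inner_coe, preGNS_inner_def]
  simp

open Classical in
/-- The cyclic vector of a summand of the sum of the GNS representations. -/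
def gnsVector (T : Type*) (φ : P →ₚ[ℂ] ℂ) (t : T) : UnivSpace P T :=
  lp.single 2 ((φ, t) : (P →ₚ[ℂ] ℂ) × T) ((φ.toPreGNS 1 : φ.PreGNS) : φ.GNS)

theorem inner_gnsVector {T : Type*} (φ : P →ₚ[ℂ] ℂ) (t : T) (a : P) :
    ⟪gnsVector T φ t, univRep P T a (gnsVector T φ t)⟫_ℂ = φ a := by
  classical
  have := inner_directSumRep_single_self (fun i : (P →ₚ[ℂ] ℂ) × T ↦ i.1.gnsStarAlgHom) a (φ, t)
    ((φ.toPreGNS 1 : φ.PreGNS) : φ.GNS)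
  exact this.trans (inner_gns_one φ a)

theorem inner_gnsVector_of_ne {T : Type*} {φ φ' : P →ₚ[ℂ] ℂ} {t t' : T} (h : t ≠ t') (a : P) :
    ⟪gnsVector T φ t, univRep P T a (gnsVector T φ' t')⟫_ℂ = 0 := by
  classical
  exact inner_directSumRep_single_of_ne (fun i : (P →ₚ[ℂ] ℂ) × T ↦ i.1.gnsStarAlgHom) a
    (i := (φ, t)) (k := (φ', t')) (fun h' ↦ h (congrArg Prod.snd h'))
    ((φ.toPreGNS 1 : φ.PreGNS) : φ.GNS) ((φ'.toPreGNS 1 : φ'.PreGNS) : φ'.GNS)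

/-- A representation of `X` generated by unit vectors with mutually orthogonal orbits embeds into
the sum of the GNS representations of a larger algebra `P`: the vector states extend to `P`. -/
theorem exists_intertwiner {T ι : Type*} (j : X →⋆ₐ[ℂ] P) (hj : Function.Injective j)
    (π : X →⋆ₐ[ℂ] (H →L[ℂ] H)) (ξ : ι → H) (hξ : ∀ s, ‖ξ s‖ = 1)
    (horth : ∀ s s', s ≠ s' → ∀ x, ⟪ξ s, π x (ξ s')⟫_ℂ = 0)
    (htot : ∀ v, (∀ s x, ⟪π x (ξ s), v⟫_ℂ = 0) → v = 0) (e : ι → T)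
    (he : Function.Injective e) :
    ∃ V : H →ₗᵢ[ℂ] UnivSpace P T, ∀ x v, V (π x v) = univRep P T (j x) (V v) := by
  choose φ hφ using fun s ↦ exists_extension_vectorState j hj π (ξ s) (hξ s)
  exact exists_intertwiner_of_inner_eq π ((univRep P T).comp j) ξ
    (fun s ↦ gnsVector T (φ s) (e s)) horth
    (fun s s' h x ↦ inner_gnsVector_of_ne (fun h' ↦ h (he h')) _)
    (fun s x ↦ (inner_gnsVector _ _ _).trans (hφ s x)) htot

/-- Every representation is generated by unit vectors with mutually orthogonal orbits. -/
theorem exists_orthogonal_orbits (π : X →⋆ₐ[ℂ] (H →L[ℂ] H)) :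
    ∃ S : Set H, (∀ v ∈ S, ‖v‖ = 1) ∧
      (∀ v ∈ S, ∀ v' ∈ S, v ≠ v' → ∀ x, ⟪v, π x v'⟫_ℂ = 0) ∧
      ∀ v, (∀ s ∈ S, ∀ x, ⟪π x s, v⟫_ℂ = 0) → v = 0 := by
  obtain ⟨S, hS⟩ := zorn_subset {S : Set H | (∀ v ∈ S, ‖v‖ = 1) ∧
      ∀ v ∈ S, ∀ v' ∈ S, v ≠ v' → ∀ x, ⟪v, π x v'⟫_ℂ = 0} (fun c hc hch ↦ by
    refine ⟨⋃₀ c, ⟨?_, ?_⟩, fun s hs ↦ Set.subset_sUnion_of_mem hs⟩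
    · rintro v ⟨s, hs, hv⟩
      exact (hc hs).1 v hv
    · rintro v ⟨s, hs, hv⟩ v' ⟨s', hs', hv'⟩ hne x
      rcases hch.total hs hs' with h | h
      · exact (hc hs').2 v (h hv) v' hv' hne x
      · exact (hc hs).2 v hv v' (h hv') hne x)
  refine ⟨S, hS.prop.1, hS.prop.2, fun v hv ↦ ?_⟩
  by_contra hne
  have hn : ‖v‖ ≠ 0 := norm_ne_zero_iff.2 hne
  let u : H := ((‖v‖ : ℂ)⁻¹) • v
  have hu : ‖u‖ = 1 := by
    rw [norm_smul, norm_inv, Complex.norm_real, norm_norm, inv_mul_cancel₀ hn]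
  have h1 : ∀ s ∈ S, ∀ x, ⟪π x s, u⟫_ℂ = 0 := fun s hs x ↦ by
    rw [inner_smul_right, hv s hs x, mul_zero]
  have h1' : ∀ s ∈ S, ∀ x, ⟪s, π x u⟫_ℂ = 0 := fun s hs x ↦ by
    have := h1 s hs (star x)
    have h3 := inner_rep_rep π (star x) 1 s u
    rw [rep_one_apply, star_star, mul_one] at h3
    rw [← h3, this]
  have h2 : insert u S ⊆ S := hS.le_of_ge ⟨?_, ?_⟩ (Set.subset_insert u S)
  · have := h1 u (h2 (Set.mem_insert u S)) 1
    rw [rep_one_apply, inner_self_eq_zero] at this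
    rw [this, norm_zero] at hu
    exact zero_ne_one hu
  · rintro w (rfl | hw)
    · exact hu
    · exact hS.prop.1 w hw
  · rintro w (rfl | hw) w' (rfl | hw') hww x
    · exact absurd rfl hww
    · have := h1' w' hw' (star x)
      have h3 := inner_rep_rep π 1 x u w'
      rw [rep_one_apply, star_one, one_mul] at h3
      have h4 := inner_rep_rep π (star x) 1 u w'
      have h5 := h1 w' hw' x
      rw [← inner_conj_symm, h5, map_zero]
    · exact h1' w hw x
    · exact hS.prop.2 w hw w' hw' hww x

end Representations

/-! ### Equivalence of representations that embed into each other -/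

section CantorBernstein

open scoped InnerProductSpace
open ContinuousLinearMap

variable {X : Type*} [CStarAlgebra X] {H K : Type*} [NormedAddCommGroup H]
  [InnerProductSpace ℂ H] [CompleteSpace H] [NormedAddCommGroup K]
  [InnerProductSpace ℂ K] [CompleteSpace K]

/-- A subspace is invariant under a representation. -/
def IsInvariant (π : X →⋆ₐ[ℂ] (H →L[ℂ] H)) (M : Submodule ℂ H) : Prop :=
  ∀ x, ∀ v ∈ M, π x v ∈ M

theorem IsInvariant.orthogonal {π : X →⋆ₐ[ℂ] (H →L[ℂ] H)} {M : Submodule ℂ H}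
    (hM : IsInvariant π M) : IsInvariant π Mᗮ := fun x v hv u hu ↦ by
  have h := inner_rep_rep π (star x) 1 u v
  rw [rep_one_apply, star_star, mul_one] at h
  rw [← h]
  exact hv _ (hM _ u hu)

theorem IsInvariant.map {π : X →⋆ₐ[ℂ] (H →L[ℂ] H)} {ρ : X →⋆ₐ[ℂ] (K →L[ℂ] K)}
    {M : Submodule ℂ H} (hM : IsInvariant π M) (V : H →ₗᵢ[ℂ] K)
    (hV : ∀ x v, V (π x v) = ρ x (V v)) : IsInvariant ρ (M.map V.toLinearMap) := by
  rintro x _ ⟨v, hv, rfl⟩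
  exact ⟨π x v, hM x v hv, hV x v⟩

/-- The order preserving map whose fixed points `M` satisfy `Mᗮ = W ((V M)ᗮ)`. -/
def cantorBernsteinMap (V : H →ₗᵢ[ℂ] K) (W : K →ₗᵢ[ℂ] H) : Submodule ℂ H →o Submodule ℂ H where
  toFun M := (((M.map V.toLinearMap)ᗮ).map W.toLinearMap)ᗮ
  monotone' _ _ h := Submodule.orthogonal_le (Submodule.map_mono
    (Submodule.orthogonal_le (Submodule.map_mono h)))

theorem isInvariant_lfp_cantorBernsteinMap (π : X →⋆ₐ[ℂ] (H →L[ℂ] H)) (ρ : X →⋆ₐ[ℂ] (K →L[ℂ] K))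
    (V : H →ₗᵢ[ℂ] K) (W : K →ₗᵢ[ℂ] H) (hV : ∀ x v, V (π x v) = ρ x (V v))
    (hW : ∀ x v, W (ρ x v) = π x (W v)) :
    IsInvariant π (cantorBernsteinMap V W).lfp := by
  let F := cantorBernsteinMap V W
  -- the largest invariant subspace of the fixed point is mapped into itself
  let N : Submodule ℂ H :=
    { carrier := {v | ∀ x, π x v ∈ F.lfp}
      add_mem' := fun h h' x ↦ by rw [map_add]; exact add_mem (h x) (h' x)
      zero_mem' := fun x ↦ by rw [map_zero]; exact zero_mem _
      smul_mem' := fun c v h x ↦ by rw [map_smul]; exact Submodule.smul_mem _ c (h x) }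
  have hN : IsInvariant π N := fun x v hv y ↦ by
    have : π y (π x v) = π (y * x) v := by rw [map_mul]; rfl
    rw [this]
    exact hv _
  have hNM : N ≤ F.lfp := fun v hv ↦ by
    have := hv 1
    rwa [rep_one_apply] at this
  have hFN : IsInvariant π (F N) := ((hN.map V hV).orthogonal.map W hW).orthogonal
  have hle : F N ≤ N := fun v hv x ↦ F.map_lfp ▸ F.monotone hNM (hFN x v hv)
  exact fun x v hv ↦ F.lfp_le hle hv x

/-- Two representations that embed isometrically into each other are unitarily equivalent. -/
theorem exists_unitary_intertwiner (π : X →⋆ₐ[ℂ] (H →L[ℂ] H)) (ρ : X →⋆ₐ[ℂ] (K →L[ℂ] K))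
    (V : H →ₗᵢ[ℂ] K) (W : K →ₗᵢ[ℂ] H) (hV : ∀ x v, V (π x v) = ρ x (V v))
    (hW : ∀ x v, W (ρ x v) = π x (W v)) :
    ∃ U : H ≃ₗᵢ[ℂ] K, ∀ x v, U (π x v) = ρ x (U v) := by
  let M := (cantorBernsteinMap V W).lfp
  have hMi : IsInvariant π M := isInvariant_lfp_cantorBernsteinMap π ρ V W hV hW
  let VM := M.map V.toLinearMap
  have hVMi : IsInvariant ρ VMᗮ := (hMi.map V hV).orthogonal
  have hM : M = ((VMᗮ).map W.toLinearMap)ᗮ := (cantorBernsteinMap V W).map_lfp.symm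
  have hMc : CompleteSpace M := by
    rw [hM]; infer_instance
  have hVMc : CompleteSpace VM := by
    refine (IsComplete.completeSpace_coe ?_)
    exact (V.isometry.isUniformInducing.isComplete_iff).2 (completeSpace_coe_iff_isComplete.1 hMc)
  have hWc : CompleteSpace ((VMᗮ).map W.toLinearMap) := by
    refine (IsComplete.completeSpace_coe ?_)
    exact (W.isometry.isUniformInducing.isComplete_iff).2
      (Submodule.isClosed_orthogonal VM).isComplete
  have hMo : Mᗮ = (VMᗮ).map W.toLinearMap := by
    rw [hM, Submodule.orthogonal_orthogonal]
  have hWo : ∀ k ∈ VMᗮ, W k ∈ Mᗮ := fun k hk ↦ hMo ▸ ⟨k, hk, rfl⟩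
  have hdec : ∀ v : H, ∃ m ∈ M, ∃ k ∈ VMᗮ, v = m + W k := fun v ↦ by
    obtain ⟨m, hm, n, hn, rfl⟩ := M.exists_add_mem_mem_orthogonal v
    rw [hMo] at hn
    obtain ⟨k, hk, rfl⟩ := hn
    exact ⟨m, hm, k, hk, rfl⟩
  -- `V` on `M` and the inverse of `W` on its orthogonal complement
  let U : H →L[ℂ] K := (V.toContinuousLinearMap ∘L M.starProjection) +
    (adjoint W.toContinuousLinearMap ∘L (1 - M.starProjection))
  have hU : ∀ m ∈ M, ∀ k ∈ VMᗮ, U (m + W k) = V m + k := fun m hm k hk ↦ by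
    have h1 : M.starProjection (m + W k) = m := by
      rw [map_add, Submodule.starProjection_eq_self_iff.2 hm,
        (M.starProjection_apply_eq_zero_iff).2 (hWo k hk), add_zero]
    have h2 : adjoint W.toContinuousLinearMap (W k) = k := by
      have := W.adjoint_comp_self
      exact DFunLike.congr_fun this k
    change V (M.starProjection (m + W k)) +
      adjoint W.toContinuousLinearMap ((m + W k) - M.starProjection (m + W k)) = _
    rw [h1, add_sub_cancel_left, h2]
  have hnorm : ∀ v, ‖U v‖ = ‖v‖ := fun v ↦ by
    obtain ⟨m, hm, k, hk, rfl⟩ := hdec v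
    rw [hU m hm k hk]
    have h1 := norm_add_sq_eq_norm_sq_add_norm_sq_of_inner_eq_zero (𝕜 := ℂ) (V m) k
      (hk _ ⟨m, hm, rfl⟩)
    have h2 := norm_add_sq_eq_norm_sq_add_norm_sq_of_inner_eq_zero (𝕜 := ℂ) m (W k)
      (hWo k hk m hm)
    rw [V.norm_map] at h1
    rw [W.norm_map] at h2
    exact (mul_self_inj (norm_nonneg _) (norm_nonneg _)).1 (h1.trans h2.symm)
  have hsurj : Function.Surjective U := fun k ↦ by
    obtain ⟨_, ⟨m, hm, rfl⟩, k', hk', rfl⟩ := VM.exists_add_mem_mem_orthogonal k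
    exact ⟨m + W k', hU m hm k' hk'⟩
  refine ⟨LinearIsometryEquiv.ofSurjective ⟨(U : H →ₗ[ℂ] K), hnorm⟩ hsurj, fun x v ↦ ?_⟩
  change U (π x v) = ρ x (U v)
  obtain ⟨m, hm, k, hk, rfl⟩ := hdec v
  rw [hU m hm k hk, map_add (π x), map_add (ρ x), ← hW, hU _ (hMi x m hm) _ (hVMi x k hk), hV]

end CantorBernstein

/-! ### Representations of a common subalgebra -/

section Absorption

open scoped InnerProductSpace ComplexOrder ENNReal
open ContinuousLinearMap PositiveLinearMap

attribute [local instance] CStarAlgebra.spectralOrder CStarAlgebra.spectralOrderedRing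

variable {X P Q : Type*} [CStarAlgebra X] [CStarAlgebra P] [CStarAlgebra Q]

/-- The conjugate of a representation by a unitary map. -/
def conjRep {H K : Type*} [NormedAddCommGroup H] [InnerProductSpace ℂ H] [CompleteSpace H]
    [NormedAddCommGroup K] [InnerProductSpace ℂ K] [CompleteSpace K] (U : H ≃ₗᵢ[ℂ] K)
    (π : Q →⋆ₐ[ℂ] (K →L[ℂ] K)) : Q →⋆ₐ[ℂ] (H →L[ℂ] H) where
  toFun a := U.symm.conjStarAlgEquiv (π a)
  map_one' := by rw [map_one, map_one]
  map_zero' := by rw [map_zero, map_zero]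
  map_mul' a b := by rw [map_mul, map_mul]
  map_add' a b := by rw [map_add, map_add]
  commutes' c := by rw [AlgHomClass.commutes, AlgHomClass.commutes]
  map_star' a := by rw [map_star, map_star]

theorem conjRep_apply {H K : Type*} [NormedAddCommGroup H] [InnerProductSpace ℂ H]
    [CompleteSpace H] [NormedAddCommGroup K] [InnerProductSpace ℂ K] [CompleteSpace K]
    (U : H ≃ₗᵢ[ℂ] K) (π : Q →⋆ₐ[ℂ] (K →L[ℂ] K)) (a : Q) (v : H) :
    conjRep U π a v = U.symm (π a (U v)) := rfl

open Classical in
/-- A Hilbert sum of representations is generated by the generators of its summands. -/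
theorem exists_intertwiner_directSumRep {ι : Type*} {H : ι → Type*}
    [∀ i, NormedAddCommGroup (H i)] [∀ i, InnerProductSpace ℂ (H i)] [∀ i, CompleteSpace (H i)]
    {T : Type*} (i : X →⋆ₐ[ℂ] Q) (hi : Function.Injective i)
    (π : ∀ k, X →⋆ₐ[ℂ] (H k →L[ℂ] H k)) (e : (Σ k, H k) → T) (he : Function.Injective e) :
    ∃ V : lp H 2 →ₗᵢ[ℂ] UnivSpace Q T, ∀ x v, V (directSumRep π x v) = univRep Q T (i x) (V v) := by
  choose S hS1 hS2 hS3 using fun k ↦ exists_orthogonal_orbits (π k)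
  refine exists_intertwiner (ι := Σ k, S k) i hi (directSumRep π)
    (fun s ↦ lp.single 2 s.1 (s.2 : H s.1)) (fun s ↦ ?_) ?_ (fun v hv ↦ ?_)
    (fun s ↦ e ⟨s.1, s.2⟩) ?_
  · rw [lp.norm_single (by norm_num)]
    exact hS1 _ _ s.2.2
  · rintro ⟨k, s⟩ ⟨k', s'⟩ hne x
    by_cases hk : k = k'
    · subst hk
      have h1 : (s : H k) ≠ s' := fun h ↦ hne (by rw [Subtype.ext h])
      rw [directSumRep_single, lp.inner_single_left, lp.single_apply_self]
      exact hS2 k s s.2 s' s'.2 h1 x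
    · exact inner_directSumRep_single_of_ne π x hk _ _
  · refine lp.ext (funext fun k ↦ hS3 k _ fun s hs x ↦ ?_)
    have := hv ⟨k, s, hs⟩ x
    rwa [directSumRep_single, lp.inner_single_left] at this
  · rintro ⟨k, s⟩ ⟨k', s'⟩ h
    have h1 := he h
    rw [Sigma.mk.injEq] at h1
    obtain ⟨rfl, h2⟩ := h1
    exact congrArg (Sigma.mk k) (Subtype.ext (eq_of_heq h2))

/-- The sum of GNS representations of `P` of large multiplicity, restricted to a subalgebra `X`,
embeds into that of any other algebra `Q` containing `X`. -/
theorem exists_intertwiner_univRep {T : Type*} (j : X →⋆ₐ[ℂ] P) (i : X →⋆ₐ[ℂ] Q)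
    (hi : Function.Injective i) (e : (Σ φ : P →ₚ[ℂ] ℂ, φ.GNS) × T → T)
    (he : Function.Injective e) :
    ∃ V : UnivSpace P T →ₗᵢ[ℂ] UnivSpace Q T,
      ∀ x v, V (univRep P T (j x) v) = univRep Q T (i x) (V v) := by
  refine exists_intertwiner_directSumRep (H := fun k : (P →ₚ[ℂ] ℂ) × T ↦ k.1.GNS) i hi
    (fun k ↦ k.1.gnsStarAlgHom.comp j) (fun s ↦ e (⟨s.1.1, s.2⟩, s.1.2)) ?_
  rintro ⟨⟨φ, t⟩, v⟩ ⟨⟨φ', t'⟩, v'⟩ h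
  have h1 := he h
  simp only [Prod.mk.injEq, Sigma.mk.injEq] at h1
  obtain ⟨⟨rfl, h2⟩, rfl⟩ := h1
  rw [eq_of_heq h2]

/-- If `X` is contained in both `P` and `Q`, the action of `X` on the sum of GNS representations
of `P` of large multiplicity extends to `Q`. -/
theorem exists_extension_univRep {T : Type*} (j : X →⋆ₐ[ℂ] P) (hj : Function.Injective j)
    (i : X →⋆ₐ[ℂ] Q) (hi : Function.Injective i)
    (eP : (Σ φ : P →ₚ[ℂ] ℂ, φ.GNS) × T → T) (heP : Function.Injective eP)
    (eQ : (Σ φ : Q →ₚ[ℂ] ℂ, φ.GNS) × T → T) (heQ : Function.Injective eQ) :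
    ∃ ρ : Q →⋆ₐ[ℂ] (UnivSpace P T →L[ℂ] UnivSpace P T), ∀ x, ρ (i x) = univRep P T (j x) := by
  obtain ⟨V, hV⟩ := exists_intertwiner_univRep j i hi eP heP
  obtain ⟨W, hW⟩ := exists_intertwiner_univRep i j hj eQ heQ
  obtain ⟨U, hU⟩ := exists_unitary_intertwiner ((univRep P T).comp j) ((univRep Q T).comp i)
    V W hV hW
  refine ⟨conjRep U (univRep Q T), fun x ↦ ?_⟩
  ext1 v
  rw [conjRep_apply]
  have := hU x v
  simp only [StarAlgHom.comp_apply] at this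
  rw [← this, LinearIsometryEquiv.symm_apply_apply]

end Absorption

/-! ### The C*-algebra of a C*-seminorm -/

section Completion

/-- The completion of a normed algebra with a C*-norm is a C*-algebra. -/
@[reducible] def completionStarRing (A : Type*) [NormedRing A] [StarRing A] [CStarRing A] :
    StarRing (UniformSpace.Completion A) where
  star := UniformSpace.Completion.map star
  star_involutive a := by
    have hs : UniformContinuous (star : A → A) := starNormedAddGroupHom.uniformContinuous
    induction a using UniformSpace.Completion.induction_on with
    | hp =>
      exact isClosed_eq (UniformSpace.Completion.continuous_map.comp
        UniformSpace.Completion.continuous_map) continuous_id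
    | ih a => rw [UniformSpace.Completion.map_coe hs, UniformSpace.Completion.map_coe hs, star_star]
  star_mul a b := by
    have hs : UniformContinuous (star : A → A) := starNormedAddGroupHom.uniformContinuous
    have hc : Continuous (UniformSpace.Completion.map (star : A → A)) :=
      UniformSpace.Completion.continuous_map
    induction a, b using UniformSpace.Completion.induction_on₂ with
    | hp =>
      exact isClosed_eq (hc.comp (continuous_fst.mul continuous_snd))
        ((hc.comp continuous_snd).mul (hc.comp continuous_fst))
    | ih a b =>
      rw [← UniformSpace.Completion.coe_mul, UniformSpace.Completion.map_coe hs,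
        UniformSpace.Completion.map_coe hs, UniformSpace.Completion.map_coe hs, star_mul,
        UniformSpace.Completion.coe_mul]
  star_add a b := by
    have hs : UniformContinuous (star : A → A) := starNormedAddGroupHom.uniformContinuous
    have hc : Continuous (UniformSpace.Completion.map (star : A → A)) :=
      UniformSpace.Completion.continuous_map
    induction a, b using UniformSpace.Completion.induction_on₂ with
    | hp =>
      exact isClosed_eq (hc.comp (continuous_fst.add continuous_snd))
        ((hc.comp continuous_fst).add (hc.comp continuous_snd))
    | ih a b =>
      rw [← UniformSpace.Completion.coe_add, UniformSpace.Completion.map_coe hs,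
        UniformSpace.Completion.map_coe hs, UniformSpace.Completion.map_coe hs, star_add,
        UniformSpace.Completion.coe_add]

attribute [local instance] completionStarRing

theorem completion_star_coe {A : Type*} [NormedRing A] [StarRing A] [CStarRing A] (a : A) :
    star (a : UniformSpace.Completion A) = (star a : A) :=
  UniformSpace.Completion.map_coe starNormedAddGroupHom.uniformContinuous a

theorem continuous_completion_star (A : Type*) [NormedRing A] [StarRing A] [CStarRing A] :
    Continuous (star : UniformSpace.Completion A → UniformSpace.Completion A) :=
  UniformSpace.Completion.continuous_map

/-- The completion of a normed algebra with a C*-norm is a C*-algebra. -/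
@[reducible] def completionCStarAlgebra (A : Type*) [NormedRing A] [NormedAlgebra ℂ A] [StarRing A]
    [CStarRing A] [StarModule ℂ A] : CStarAlgebra (UniformSpace.Completion A) where
  __ : NormedRing (UniformSpace.Completion A) := inferInstance
  __ : Algebra ℂ (UniformSpace.Completion A) := inferInstance
  __ : StarRing (UniformSpace.Completion A) := completionStarRing A
  norm_smul_le := norm_smul_le
  complete := CompleteSpace.complete
  norm_mul_self_le a := by
    induction a using UniformSpace.Completion.induction_on with
    | hp =>
      exact isClosed_le (continuous_norm.mul continuous_norm)
        (((continuous_completion_star A).mul continuous_id).norm)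
    | ih a =>
      rw [completion_star_coe, ← UniformSpace.Completion.coe_mul, UniformSpace.Completion.norm_coe,
        UniformSpace.Completion.norm_coe, CStarRing.norm_star_mul_self]
  star_smul c a := by
    have hc := continuous_completion_star A
    induction a using UniformSpace.Completion.induction_on with
    | hp => exact isClosed_eq (hc.comp (continuous_const_smul c)) (hc.const_smul (star c))
    | ih a =>
      rw [completion_star_coe, ← UniformSpace.Completion.coe_smul, completion_star_coe, star_smul,
        UniformSpace.Completion.coe_smul]

/-- The embedding of a normed algebra with a C*-norm into its completion. -/
def completionEmbedding (A : Type*) [NormedRing A] [NormedAlgebra ℂ A] [StarRing A]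
    [CStarRing A] : A →⋆ₙₐ[ℂ] UniformSpace.Completion A where
  toFun := (↑)
  map_smul' c a := UniformSpace.Completion.coe_smul c a
  map_zero' := UniformSpace.Completion.coe_zero
  map_add' := UniformSpace.Completion.coe_add
  map_mul' := UniformSpace.Completion.coe_mul
  map_star' a := (completion_star_coe a).symm

variable {R : Type u} [NonUnitalRing R] [StarRing R] [Module ℂ R] [StarModule ℂ R]
  [IsScalarTower ℂ R R] [SMulCommClass ℂ R R]

/-- A C*-seminorm induces a seminormed ring structure. -/
@[reducible] def seminormedRing (p : Seminorm ℂ R) (hp : IsCStarSeminorm p) :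
    NonUnitalSeminormedRing R where
  __ := (inferInstance : NonUnitalRing R)
  norm := p
  dist x y := p (-x + y)
  dist_self x := by simp
  dist_comm x y := by rw [← map_neg_eq_map p]; congr 1; abel
  dist_triangle x y z := by
    have := map_add_le_add p (-x + y) (-y + z)
    rwa [show -x + y + (-y + z) = -x + z by abel] at this
  dist_eq x y := rfl
  norm_mul_le := hp.mul_le

section SeparationQuotient

variable {S : Type*} [NonUnitalSeminormedRing S] [StarRing S]

/-- The Hausdorff quotient of a seminormed *-ring. -/
@[reducible] def separationQuotientStarRing (hs : Continuous (star : S → S)) :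
    StarRing (SeparationQuotient S) where
  star := SeparationQuotient.lift (SeparationQuotient.mk ∘ star) fun _ _ h ↦
    SeparationQuotient.mk_eq_mk.2 (h.map hs)
  star_involutive a := by
    obtain ⟨a, rfl⟩ := SeparationQuotient.surjective_mk a
    exact congrArg SeparationQuotient.mk (star_star a)
  star_mul a b := by
    obtain ⟨a, rfl⟩ := SeparationQuotient.surjective_mk a
    obtain ⟨b, rfl⟩ := SeparationQuotient.surjective_mk b
    exact congrArg SeparationQuotient.mk (star_mul a b)
  star_add a b := by
    obtain ⟨a, rfl⟩ := SeparationQuotient.surjective_mk a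
    obtain ⟨b, rfl⟩ := SeparationQuotient.surjective_mk b
    exact congrArg SeparationQuotient.mk (star_add a b)

end SeparationQuotient

/-- Every C*-seminorm is the pullback of the norm of a C*-algebra. -/
theorem exists_cstarAlgebra_norm_eq (p : Seminorm ℂ R) (hp : IsCStarSeminorm p) :
    ∃ (P : Type u) (_ : CStarAlgebra P) (φ : R →⋆ₙₐ[ℂ] P), ∀ a, ‖φ a‖ = p a := by
  let := seminormedRing p hp
  have hn : ∀ a : R, ‖a‖ = p a := fun _ ↦ rfl
  let : NormedSpace ℂ R := ⟨fun c a ↦ (map_smul_eq_mul p c a).le⟩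
  have hs : Continuous (star : R → R) :=
    (AddMonoidHomClass.isometry_of_norm (starAddEquiv : R ≃+ R).toAddMonoidHom
      fun a ↦ hp.map_star a).continuous
  let := separationQuotientStarRing hs
  have hstar : ∀ a : R, star (SeparationQuotient.mk a) = SeparationQuotient.mk (star a) :=
    fun _ ↦ rfl
  have : CStarRing (SeparationQuotient R) := ⟨fun a ↦ by
    obtain ⟨a, rfl⟩ := SeparationQuotient.surjective_mk a
    rw [hstar, ← SeparationQuotient.mk_mul, SeparationQuotient.norm_mk,
      SeparationQuotient.norm_mk]
    exact (hp.star_mul_self a).ge⟩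
  have : StarModule ℂ (SeparationQuotient R) := ⟨fun c a ↦ by
    obtain ⟨a, rfl⟩ := SeparationQuotient.surjective_mk a
    rw [hstar, ← SeparationQuotient.mk_smul, ← SeparationQuotient.mk_smul, hstar, star_smul]⟩
  have : IsScalarTower ℂ (SeparationQuotient R) (SeparationQuotient R) := ⟨fun c a b ↦ by
    obtain ⟨a, rfl⟩ := SeparationQuotient.surjective_mk a
    obtain ⟨b, rfl⟩ := SeparationQuotient.surjective_mk b
    exact congrArg SeparationQuotient.mk (smul_mul_assoc c a b)⟩
  have : SMulCommClass ℂ (SeparationQuotient R) (SeparationQuotient R) := ⟨fun c a b ↦ by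
    obtain ⟨a, rfl⟩ := SeparationQuotient.surjective_mk a
    obtain ⟨b, rfl⟩ := SeparationQuotient.surjective_mk b
    exact congrArg SeparationQuotient.mk (mul_smul_comm c a b).symm⟩
  let := completionCStarAlgebra (Unitization ℂ (SeparationQuotient R))
  let φ : R →⋆ₙₐ[ℂ] SeparationQuotient R :=
    { toFun := SeparationQuotient.mk
      map_smul' _ _ := rfl
      map_zero' := rfl
      map_add' _ _ := rfl
      map_mul' _ _ := rfl
      map_star' _ := rfl }
  refine ⟨_, inferInstance, (completionEmbedding _).comp
    ((Unitization.inrNonUnitalStarAlgHom ℂ _).comp φ), fun a ↦ ?_⟩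
  change ‖((SeparationQuotient.mk a : Unitization ℂ (SeparationQuotient R)) :
        UniformSpace.Completion (Unitization ℂ (SeparationQuotient R)))‖ = _
  rw [UniformSpace.Completion.norm_coe, Unitization.norm_inr, SeparationQuotient.norm_mk, hn]

end Completion

/-! ### Amalgamation of C*-seminorms -/

section Amalgam

open scoped ComplexOrder

attribute [local instance] CStarAlgebra.spectralOrder CStarAlgebra.spectralOrderedRing

/-- Two *-homomorphisms inducing the same seminorm factor through a common C*-subalgebra of their
targets; it is realised as the closure of the range of the pair, with a unit adjoined. -/
theorem exists_common_subalgebra {X P Q : Type u} [NonUnitalRing X] [StarRing X] [Module ℂ X]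
    [CStarAlgebra P] [CStarAlgebra Q] (φ : X →⋆ₙₐ[ℂ] P) (ψ : X →⋆ₙₐ[ℂ] Q)
    (h : ∀ x, ‖ψ x‖ = ‖φ x‖) :
    ∃ (Z : Type u) (_ : CStarAlgebra Z) (j : Z →⋆ₐ[ℂ] Unitization ℂ P)
      (i : Z →⋆ₐ[ℂ] Unitization ℂ Q), Function.Injective j ∧ Function.Injective i ∧
        ∀ x, ∃ z, j z = (φ x : Unitization ℂ P) ∧ i z = (ψ x : Unitization ℂ Q) := by
  let S : NonUnitalStarSubalgebra ℂ (P × Q) :=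
    (NonUnitalStarAlgHom.range (φ.prod ψ)).topologicalClosure
  have hS : IsClosed (S : Set (P × Q)) :=
    NonUnitalStarSubalgebra.isClosed_topologicalClosure _
  have hxS : ∀ x, (φ x, ψ x) ∈ S := fun x ↦
    NonUnitalStarSubalgebra.le_topologicalClosure _ ⟨x, rfl⟩
  have hn : ∀ z ∈ S, ‖z.2‖ = ‖z.1‖ := by
    have : IsClosed {z : P × Q | ‖z.2‖ = ‖z.1‖} :=
      isClosed_eq continuous_snd.norm continuous_fst.norm
    intro z hz
    refine closure_minimal ?_ this hz
    rintro _ ⟨x, rfl⟩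
    exact h x
  let _ : NonUnitalCStarAlgebra S :=
    { (inferInstance : NonUnitalNormedRing S), (inferInstance : StarRing S),
      (inferInstance : NormedSpace ℂ S), (inferInstance : CStarRing S),
      (inferInstance : IsScalarTower ℂ S S), (inferInstance : SMulCommClass ℂ S S),
      (inferInstance : StarModule ℂ S) with
      complete := (completeSpace_coe_iff_isComplete.2 hS.isComplete).complete }
  let j : S →⋆ₙₐ[ℂ] P := (NonUnitalStarAlgHom.fst ℂ P Q).comp
    (NonUnitalStarSubalgebraClass.subtype S)
  let i : S →⋆ₙₐ[ℂ] Q := (NonUnitalStarAlgHom.snd ℂ P Q).comp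
    (NonUnitalStarSubalgebraClass.subtype S)
  have h0 : ∀ z : S, z.1.1 = 0 → z.1.2 = 0 → z = 0 := fun z h1 h2 ↦ Subtype.ext (Prod.ext h1 h2)
  have hj : Function.Injective j := (injective_iff_map_eq_zero j).2 fun z hz ↦
    h0 z hz (norm_eq_zero.1 ((hn z z.2).trans (norm_eq_zero.2 hz)))
  have hi : Function.Injective i := (injective_iff_map_eq_zero i).2 fun z hz ↦
    h0 z (norm_eq_zero.1 ((hn z z.2).symm.trans (norm_eq_zero.2 hz))) hz
  refine ⟨Unitization ℂ S, inferInstance, Unitization.starMap j, Unitization.starMap i,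
    Unitization.starMap_injective hj, Unitization.starMap_injective hi, fun x ↦
      ⟨((⟨_, hxS x⟩ : S) : Unitization ℂ S), ?_, ?_⟩⟩
  · exact Unitization.starMap_inr j _
  · exact Unitization.starMap_inr i _

/-- Given *-algebras `Y k` and homomorphisms `X k → Y k` and `X k → B`, and C*-seminorms on `Y k` and
`B` which agree on `X k`, there is a C*-algebra receiving `B` and all the `Y k`, compatibly on the
`X k`, whose norm restricts to the given seminorm on `B`. -/
theorem exists_amalgam {K B : Type u} {X Y : K → Type u} [NonUnitalRing B] [StarRing B]
    [Module ℂ B] [StarModule ℂ B] [IsScalarTower ℂ B B] [SMulCommClass ℂ B B]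
    [∀ k, NonUnitalRing (X k)] [∀ k, StarRing (X k)] [∀ k, Module ℂ (X k)]
    [∀ k, NonUnitalRing (Y k)] [∀ k, StarRing (Y k)] [∀ k, Module ℂ (Y k)]
    [∀ k, StarModule ℂ (Y k)] [∀ k, IsScalarTower ℂ (Y k) (Y k)]
    [∀ k, SMulCommClass ℂ (Y k) (Y k)] (p : Seminorm ℂ B) (hp : IsCStarSeminorm p)
    (q : ∀ k, Seminorm ℂ (Y k)) (hq : ∀ k, IsCStarSeminorm (q k))
    (g : ∀ k, X k →⋆ₙₐ[ℂ] B) (i : ∀ k, X k →⋆ₙₐ[ℂ] Y k) (h : ∀ k x, q k (i k x) = p (g k x)) :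
    ∃ (E : Type u) (_ : CStarAlgebra E) (β : B →⋆ₙₐ[ℂ] E) (γ : ∀ k, Y k →⋆ₙₐ[ℂ] E),
      (∀ b, ‖β b‖ = p b) ∧ (∀ k y, ‖γ k y‖ ≤ q k y) ∧ ∀ k x, γ k (i k x) = β (g k x) := by
  obtain ⟨P, _, φ, hφ⟩ := exists_cstarAlgebra_norm_eq p hp
  choose Q instQ ψ hψ using fun k ↦ exists_cstarAlgebra_norm_eq (q k) (hq k)
  choose Z instZ j i' hj hi' hZ using fun k ↦
    exists_common_subalgebra (φ.comp (g k)) ((ψ k).comp (i k)) fun x ↦ by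
      simp only [NonUnitalStarAlgHom.comp_apply, hφ, hψ, h]
  let M : Type u := (Σ f : Unitization ℂ P →ₚ[ℂ] ℂ, f.GNS) ⊕
    (Σ k, Σ f : Unitization ℂ (Q k) →ₚ[ℂ] ℂ, f.GNS)
  -- `M × (ℕ → M)` embeds into `ℕ → M`, which is the multiplicity needed for absorption.
  let cons : M × (ℕ → M) → (ℕ → M) := fun z n ↦ n.casesOn z.1 fun n ↦ z.2 n
  have hcons : Function.Injective cons := fun z z' hz ↦
    Prod.ext (congrFun hz 0) (funext fun n ↦ congrFun hz (n + 1))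
  have hr : ∀ k, Function.Injective
      (fun x : Σ f : Unitization ℂ (Q k) →ₚ[ℂ] ℂ, f.GNS ↦ (.inr ⟨k, x⟩ : M)) := fun k ↦
    Sum.inr_injective.comp sigma_mk_injective
  have : Nonempty M := ⟨.inl ⟨0, 0⟩⟩
  choose ρ hρ using fun k ↦ exists_extension_univRep (T := ℕ → M) (j k) (hj k) (i' k) (hi' k)
    (fun z ↦ cons (.inl z.1, z.2)) (fun z z' hz ↦ by
      have := hcons hz
      exact Prod.ext (Sum.inl_injective (Prod.ext_iff.1 this).1) (Prod.ext_iff.1 this).2)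
    (fun z ↦ cons (.inr ⟨k, z.1⟩, z.2)) (fun z z' hz ↦ by
      have := hcons hz
      exact Prod.ext (hr k (Prod.ext_iff.1 this).1) (Prod.ext_iff.1 this).2)
  let π := univRep (Unitization ℂ P) (ℕ → M)
  refine ⟨UnivSpace (Unitization ℂ P) (ℕ → M) →L[ℂ] UnivSpace (Unitization ℂ P) (ℕ → M),
    inferInstance, π.toNonUnitalStarAlgHom.comp
    ((Unitization.inrNonUnitalStarAlgHom ℂ P).comp φ), fun k ↦ (ρ k).toNonUnitalStarAlgHom.comp
    ((Unitization.inrNonUnitalStarAlgHom ℂ (Q k)).comp (ψ k)), fun b ↦ ?_, fun k y ↦ ?_,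
    fun k x ↦ ?_⟩
  · change ‖π (φ b : Unitization ℂ P)‖ = _
    rw [NonUnitalStarAlgHom.norm_map π (univRep_injective _ _), Unitization.norm_inr, hφ]
  · change ‖ρ k (ψ k y : Unitization ℂ (Q k))‖ ≤ _
    rw [← hψ, ← Unitization.norm_inr (𝕜 := ℂ) (ψ k y)]
    exact NonUnitalStarAlgHom.norm_apply_le (ρ k).toNonUnitalStarAlgHom _
  · change ρ k (ψ k (i k x) : Unitization ℂ (Q k)) = π (φ (g k x) : Unitization ℂ P)
    obtain ⟨z, h1, h2⟩ := hZ k x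
    have h3 := hρ k z
    simp only [NonUnitalStarAlgHom.comp_apply] at h1 h2
    rw [h1, h2] at h3
    exact h3

end Amalgam

/-! ### C*-algebras as objects, and extension of seminorms -/

section OfCStar

variable {ν : Ordinal.{u}}

/-- The pullback of a seminorm along a morphism. -/
def compHom {B D : NuAlg ν} (p : Seminorm ℂ D) (f : B ⟶ D) : Seminorm ℂ B :=
  p.comp (f.toStarHom : B →ₗ[ℂ] D)

theorem continuous_compHom {B D : NuAlg ν} {p : Seminorm ℂ D} (hp : Continuous p) (f : B ⟶ D) :
    Continuous (compHom p f) :=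
  hp.comp f.continuous

theorem IsCStarSeminorm.compHom {B D : NuAlg ν} {p : Seminorm ℂ D} (hp : IsCStarSeminorm p)
    (f : B ⟶ D) : IsCStarSeminorm (compHom p f) :=
  hp.comp (f.toStarHom : B →ₗ[ℂ] D) (map_mul f) (StarHomClass.map_star f.toStarHom)

variable (ν) in
/-- The class of the morphisms with the seminorm extension property. -/
def seminormExtensions : MorphismProperty (NuAlg ν) := fun _ _ f ↦ HasSeminormExtension f

theorem HasSeminormExtension.of_comp {B D E : NuAlg ν} (f : B ⟶ D) (g : D ⟶ E)
    (h : HasSeminormExtension (f ≫ g)) : HasSeminormExtension f := fun p hp hp' ↦ by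
  obtain ⟨q, hq, hq', e⟩ := h p hp hp'
  exact ⟨compHom q g, continuous_compHom hq g, hq'.compHom g, e⟩

theorem HasSeminormExtension.comp {B D E : NuAlg ν} {f : B ⟶ D} {g : D ⟶ E}
    (hf : HasSeminormExtension f) (hg : HasSeminormExtension g) :
    HasSeminormExtension (f ≫ g) := fun p hp hp' ↦ by
  obtain ⟨q, hq, hq', e⟩ := hf p hp hp'
  obtain ⟨r, hr, hr', e'⟩ := hg q hq hq'
  exact ⟨r, hr, hr', fun a ↦ (e' (f a)).trans (e a)⟩

theorem HasSeminormExtension.id (B : NuAlg ν) : HasSeminormExtension (𝟙 B) :=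
  fun p hp hp' ↦ ⟨p, hp, hp', fun _ ↦ rfl⟩

theorem HasSeminormExtension.of_splitMono {B D : NuAlg ν} (f : B ⟶ D) (r : D ⟶ B)
    (h : f ≫ r = 𝟙 B) : HasSeminormExtension f :=
  .of_comp f r (h ▸ .id B)

instance : (seminormExtensions ν).IsMultiplicative where
  id_mem := .id
  comp_mem _ _ := .comp

theorem HasSeminormExtension.of_isIso {B D : NuAlg ν} (f : B ⟶ D) [IsIso f] :
    HasSeminormExtension f :=
  .of_splitMono f (inv f) (by simp)

instance : (seminormExtensions ν).RespectsIso :=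
  MorphismProperty.respectsIso_of_isStableUnderComposition
    fun _ _ f (_ : IsIso f) ↦ HasSeminormExtension.of_isIso f

variable [Fact (Cardinal.aleph0 ≤ ν.card)]

theorem isCStarSeminorm_norm (E : Type*) [CStarAlgebra E] : IsCStarSeminorm (normSeminorm ℂ E) where
  mul_le := norm_mul_le
  star_mul_self a := show ‖star a * a‖ = ‖a‖ * ‖a‖ from CStarRing.norm_star_mul_self

/-- A C*-algebra with its norm topology, as an object. -/
@[reducible] def NuAlg.ofCStar (ν : Ordinal.{u}) [Fact (Cardinal.aleph0 ≤ ν.card)] (E : Type u)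
    [CStarAlgebra E] : NuAlg ν where
  carrier := E
  isLMCCStar := IsLMCCStar.of_withSeminorms _ (fun _ ↦
    isCStarSeminorm_norm E) (norm_withSeminorms ℂ E)
  isNuComplete x hx := by
    have := nonempty_toType ν
    have : CauchySeq x := Metric.cauchySeq_iff.2 fun ε hε ↦ by
      obtain ⟨γ, hγ⟩ := hx _ (Metric.ball_mem_nhds 0 hε)
      refine ⟨γ, fun α hα β hβ ↦ ?_⟩
      simpa [dist_eq_norm] using hγ α β hα hβ
    exact cauchySeq_tendsto_of_complete this

/-- A *-homomorphism to a C*-algebra, bounded by a continuous seminorm, as a morphism. -/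
def NuAlg.ofBound {B : NuAlg ν} {E : Type u} [CStarAlgebra E] (f : B →⋆ₙₐ[ℂ] E)
    (p : Seminorm ℂ B) (hp : Continuous p) (h : ∀ b, ‖f b‖ ≤ p b) : B ⟶ NuAlg.ofCStar ν E where
  toStarHom := f
  continuous := by
    refine continuous_of_continuousAt_zero (f : B →+ E) ?_
    change Tendsto f (𝓝 0) (𝓝 (f 0))
    rw [map_zero]
    refine squeeze_zero_norm h ?_
    have := hp.tendsto 0
    rwa [map_zero] at this

/-- The C*-seminorm induced by a morphism to a C*-algebra. -/
theorem exists_seminorm_eq_norm {B : NuAlg ν} {E : Type u} [CStarAlgebra E]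
    (f : B ⟶ NuAlg.ofCStar ν E) :
    ∃ q : Seminorm ℂ B, Continuous q ∧ IsCStarSeminorm q ∧ ∀ b, q b = ‖(f b : E)‖ := by
  exact ⟨(normSeminorm ℂ E).comp (f.toStarHom : B →ₗ[ℂ] E), continuous_norm.comp f.continuous,
    (isCStarSeminorm_norm E).comp (f.toStarHom : B →ₗ[ℂ] E) (map_mul f) (map_star f.toStarHom),
    fun _ ↦ rfl⟩

/-- Pushouts of coproducts of morphisms with the seminorm extension property have the seminorm
extension property: the extensions of a seminorm to the pieces are amalgamated. -/
theorem pushouts_coproducts_le_seminormExtensions {W : MorphismProperty (NuAlg ν)}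
    (hW : W ≤ seminormExtensions ν) :
    (MorphismProperty.coproducts.{u} W).pushouts ≤ seminormExtensions ν := by
  rintro B D f ⟨X', Y', i, g, k, hi, sq⟩ p hp hp'
  rw [MorphismProperty.coproducts_iff] at hi
  obtain ⟨J, hi⟩ := hi
  cases hi with
  | mk X Y c c' hc hc' φ hφ =>
  choose q hq hq' e using fun j : J ↦ hW _ (hφ ⟨j⟩) (compHom p (c.ι.app ⟨j⟩ ≫ g))
    (continuous_compHom hp _) (hp'.compHom _)
  obtain ⟨E, _, β, γ, hβ, hγ, h⟩ := exists_amalgam p hp' q hq'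
    (fun j ↦ (c.ι.app ⟨j⟩ ≫ g).toStarHom) (fun j ↦ (φ.app ⟨j⟩).toStarHom) e
  let β' := NuAlg.ofBound β p hp (fun b ↦ (hβ b).le)
  let s : Cocone Y := ⟨NuAlg.ofCStar ν E, Discrete.natTrans fun j ↦
    NuAlg.ofBound (γ j.as) (q j.as) (hq j.as) (hγ j.as)⟩
  obtain ⟨r, hr, hr', e'⟩ := exists_seminorm_eq_norm (sq.desc β' (hc'.desc s) (by
    refine hc.hom_ext fun j ↦ ?_
    rw [hc.fac_assoc]
    refine (NuAlg.hom_ext fun x ↦ ?_)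
    have h1 := hc'.fac s j
    change β (g (c.ι.app j x)) = (c'.ι.app j ≫ hc'.desc s) (φ.app j x)
    rw [h1]
    exact (h j.as x).symm))
  refine ⟨r, hr, hr', fun b ↦ ?_⟩
  rw [e', ← hβ]
  congr 1
  exact DFunLike.congr_fun (sq.inl_desc β' (hc'.desc s) _) b

end OfCStar

section Limit

variable {ν : Ordinal.{u}} {J : Type u} [LinearOrder J] (F : J ⥤ NuAlg ν)

/-- A family of elements of the algebras of a direct system is coherent from `i` on if its members
from there on are the images of the one at `i`. -/
def IsCoherentFrom (x : ∀ j, F.obj j) (i : J) : Prop :=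
  ∀ j (h : i ≤ j), x j = F.map (homOfLE h) (x i)

variable {F}

theorem map_homOfLE_apply {i j k : J} (h : i ≤ j) (h' : j ≤ k) (a : F.obj i) :
    F.map (homOfLE h') (F.map (homOfLE h) a) = F.map (homOfLE (h.trans h')) a := by
  rw [← NuAlg.comp_apply, ← F.map_comp]
  rfl

theorem IsCoherentFrom.mono {x : ∀ j, F.obj j} {i i' : J} (hx : IsCoherentFrom F x i)
    (h : i ≤ i') : IsCoherentFrom F x i' := fun j hj ↦ by
  rw [hx j (h.trans hj), hx i' h, map_homOfLE_apply]

open Classical in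
/-- The images of an element of one algebra of a direct system in the later ones. -/
def laterImages (i : J) (a : F.obj i) : ∀ j, F.obj j := fun j ↦
  if h : i ≤ j then F.map (homOfLE h) a else 0

theorem laterImages_of_le {i j : J} (h : i ≤ j) (a : F.obj i) :
    laterImages i a j = F.map (homOfLE h) a :=
  dif_pos h

theorem laterImages_of_not_le {i j : J} (h : ¬ i ≤ j) (a : F.obj i) : laterImages i a j = 0 :=
  dif_neg h

variable (F) [Nonempty J]

/-- The eventually coherent families of elements of the algebras of a direct system. -/
def coherentFamilies : NonUnitalStarSubalgebra ℂ (∀ j, F.obj j) where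
  carrier := {x | ∃ i, IsCoherentFrom F x i}
  zero_mem' := ⟨Classical.arbitrary J, fun j h ↦ (map_zero _).symm⟩
  add_mem' := by
    rintro x y ⟨i, hi⟩ ⟨k, hk⟩
    refine ⟨i ⊔ k, fun j h ↦ ?_⟩
    rw [Pi.add_apply, Pi.add_apply, map_add, (hi.mono le_sup_left) j h,
      (hk.mono le_sup_right) j h]
  mul_mem' := by
    rintro x y ⟨i, hi⟩ ⟨k, hk⟩
    refine ⟨i ⊔ k, fun j h ↦ ?_⟩
    rw [Pi.mul_apply, Pi.mul_apply, map_mul, (hi.mono le_sup_left) j h,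
      (hk.mono le_sup_right) j h]
  smul_mem' := by
    rintro c x ⟨i, hi⟩
    refine ⟨i, fun j h ↦ ?_⟩
    rw [Pi.smul_apply, Pi.smul_apply, map_smul, hi j h]
  star_mem' := by
    rintro x ⟨i, hi⟩
    refine ⟨i, fun j h ↦ ?_⟩
    rw [Pi.star_apply, Pi.star_apply, map_star, hi j h]

variable {F}

/-- An index from which on a family is coherent. -/
def coherenceIndex (x : coherentFamilies F) : J := x.2.choose

theorem isCoherentFrom_coherenceIndex (x : coherentFamilies F) :
    IsCoherentFrom F x.1 (coherenceIndex x) := x.2.choose_spec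

theorem seminorm_eq_of_isCoherentFrom {r : ∀ j, Seminorm ℂ (F.obj j)}
    (hr : ∀ i j (h : i ≤ j) a, r j (F.map (homOfLE h) a) = r i a)
    (x : coherentFamilies F) {i : J} (hi : IsCoherentFrom F x.1 i) :
    r (coherenceIndex x) (x.1 (coherenceIndex x)) = r i (x.1 i) := by
  have h := isCoherentFrom_coherenceIndex x
  rw [← hr _ (coherenceIndex x ⊔ i) le_sup_left, ← h, ← hr i (coherenceIndex x ⊔ i) le_sup_right,
    ← hi]

/-- The eventual value of a compatible family of seminorms along a coherent family. -/
def eventualSeminorm (r : ∀ j, Seminorm ℂ (F.obj j))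
    (hr : ∀ i j (h : i ≤ j) a, r j (F.map (homOfLE h) a) = r i a) :
    Seminorm ℂ (coherentFamilies F) :=
  Seminorm.of (fun x ↦ r (coherenceIndex x) (x.1 (coherenceIndex x)))
    (fun x y ↦ by
      have hx := (isCoherentFrom_coherenceIndex x).mono (le_sup_left (b := coherenceIndex y))
      have hy := (isCoherentFrom_coherenceIndex y).mono (le_sup_right (a := coherenceIndex x))
      have hxy : IsCoherentFrom F (x + y).1 (coherenceIndex x ⊔ coherenceIndex y) := fun j h ↦ by
        change x.1 j + y.1 j = F.map (homOfLE h) (x.1 _ + y.1 _)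
        rw [map_add, hx j h, hy j h]
      rw [seminorm_eq_of_isCoherentFrom hr _ hx, seminorm_eq_of_isCoherentFrom hr _ hy,
        seminorm_eq_of_isCoherentFrom hr _ hxy]
      exact map_add_le_add _ _ _)
    (fun c x ↦ by
      have hx := isCoherentFrom_coherenceIndex x
      have hcx : IsCoherentFrom F (c • x).1 (coherenceIndex x) := fun j h ↦ by
        change c • x.1 j = F.map (homOfLE h) (c • x.1 _)
        rw [map_smul, hx j h]
      rw [seminorm_eq_of_isCoherentFrom hr _ hcx]
      exact map_smul_eq_mul _ _ _)

theorem eventualSeminorm_eq (r : ∀ j, Seminorm ℂ (F.obj j))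
    (hr : ∀ i j (h : i ≤ j) a, r j (F.map (homOfLE h) a) = r i a)
    (x : coherentFamilies F) {i : J} (hi : IsCoherentFrom F x.1 i) :
    eventualSeminorm r hr x = r i (x.1 i) :=
  seminorm_eq_of_isCoherentFrom hr x hi

theorem isCStarSeminorm_eventualSeminorm (r : ∀ j, Seminorm ℂ (F.obj j))
    (hr : ∀ i j (h : i ≤ j) a, r j (F.map (homOfLE h) a) = r i a)
    (hr' : ∀ j, IsCStarSeminorm (r j)) : IsCStarSeminorm (eventualSeminorm r hr) where
  mul_le x y := by
    have hx := (isCoherentFrom_coherenceIndex x).mono (le_sup_left (b := coherenceIndex y))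
    have hy := (isCoherentFrom_coherenceIndex y).mono (le_sup_right (a := coherenceIndex x))
    have hxy : IsCoherentFrom F (x * y).1 (coherenceIndex x ⊔ coherenceIndex y) := fun j h ↦ by
      change x.1 j * y.1 j = F.map (homOfLE h) (x.1 _ * y.1 _)
      rw [map_mul, hx j h, hy j h]
    rw [eventualSeminorm_eq r hr _ hx, eventualSeminorm_eq r hr _ hy,
      eventualSeminorm_eq r hr _ hxy]
    exact (hr' _).mul_le _ _
  star_mul_self x := by
    have hx := isCoherentFrom_coherenceIndex x
    have hxx : IsCoherentFrom F (star x * x).1 (coherenceIndex x) := fun j h ↦ by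
      change star (x.1 j) * x.1 j = F.map (homOfLE h) (star (x.1 _) * x.1 _)
      rw [map_mul, map_star, hx j h]
    rw [eventualSeminorm_eq r hr _ hx, eventualSeminorm_eq r hr _ hxx]
    exact (hr' _).star_mul_self _

/-- An element of one algebra of a direct system, as an eventually coherent family. -/
def toCoherent (i : J) : F.obj i →⋆ₙₐ[ℂ] coherentFamilies F where
  toFun a := ⟨laterImages i a, i, fun j h ↦ by
    rw [laterImages_of_le h, laterImages_of_le le_rfl, map_homOfLE_apply]⟩
  map_smul' c a := Subtype.ext (funext fun j ↦ by
    change laterImages i (c • a) j = c • laterImages i a j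
    by_cases h : i ≤ j
    · simp only [laterImages_of_le h, map_smul]
    · simp only [laterImages_of_not_le h, smul_zero])
  map_zero' := Subtype.ext (funext fun j ↦ by
    change laterImages i 0 j = 0
    by_cases h : i ≤ j
    · simp only [laterImages_of_le h, map_zero]
    · simp only [laterImages_of_not_le h])
  map_add' a b := Subtype.ext (funext fun j ↦ by
    change laterImages i (a + b) j = laterImages i a j + laterImages i b j
    by_cases h : i ≤ j
    · simp only [laterImages_of_le h, map_add]
    · simp only [laterImages_of_not_le h, add_zero])
  map_mul' a b := Subtype.ext (funext fun j ↦ by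
    change laterImages i (a * b) j = laterImages i a j * laterImages i b j
    by_cases h : i ≤ j
    · simp only [laterImages_of_le h, map_mul]
    · simp only [laterImages_of_not_le h, mul_zero])
  map_star' a := Subtype.ext (funext fun j ↦ by
    change laterImages i (star a) j = star (laterImages i a j)
    by_cases h : i ≤ j
    · simp only [laterImages_of_le h, map_star]
    · simp only [laterImages_of_not_le h, star_zero])

theorem toCoherent_apply_of_le {i j : J} (h : i ≤ j) (a : F.obj i) :
    (toCoherent i a).1 j = F.map (homOfLE h) a :=
  laterImages_of_le h a

theorem isCoherentFrom_toCoherent {i j : J} (h : i ≤ j) (a : F.obj i) :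
    IsCoherentFrom F (toCoherent i a).1 j := fun k hk ↦ by
  rw [toCoherent_apply_of_le h, toCoherent_apply_of_le (h.trans hk), map_homOfLE_apply]

variable [Fact (Cardinal.aleph0 ≤ ν.card)]

/-- A compatible family of C*-seminorms on a direct system extends to the colimit. -/
theorem exists_seminorm_colimit {c : Cocone F} (hc : IsColimit c) (r : ∀ j, Seminorm ℂ (F.obj j))
    (hr : ∀ i j (h : i ≤ j) a, r j (F.map (homOfLE h) a) = r i a)
    (hrc : ∀ j, Continuous (r j)) (hr' : ∀ j, IsCStarSeminorm (r j)) :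
    ∃ q : Seminorm ℂ c.pt, Continuous q ∧ IsCStarSeminorm q ∧ ∀ j a, q (c.ι.app j a) = r j a := by
  obtain ⟨E, _, φ, hφ⟩ := exists_cstarAlgebra_norm_eq _ (isCStarSeminorm_eventualSeminorm r hr hr')
  have hn : ∀ j a, ‖φ (toCoherent j a)‖ = r j a := fun j a ↦ by
    rw [hφ, eventualSeminorm_eq r hr _ (isCoherentFrom_toCoherent le_rfl a),
      toCoherent_apply_of_le le_rfl, hr]
  let s : Cocone F :=
    { pt := NuAlg.ofCStar ν E
      ι :=
        { app j := NuAlg.ofBound (φ.comp (toCoherent j)) (r j) (hrc j) fun a ↦ (hn j a).le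
          naturality i j f := by
            refine NuAlg.hom_ext fun a ↦ ?_
            change φ (toCoherent j (F.map f a)) = φ (toCoherent i a)
            have h := leOfHom f
            obtain rfl : f = homOfLE h := rfl
            -- The difference of the two families vanishes from `j` on, so it has seminorm zero.
            rw [← sub_eq_zero, ← map_sub, ← norm_eq_zero, hφ]
            have h0 : ∀ k, j ≤ k → (toCoherent j (F.map (homOfLE h) a) - toCoherent i a).1 k = 0 :=
              fun k hk ↦ by
                change (toCoherent j (F.map (homOfLE h) a)).1 k - (toCoherent i a).1 k = 0
                rw [toCoherent_apply_of_le hk, toCoherent_apply_of_le (h.trans hk),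
                  map_homOfLE_apply, sub_self]
            rw [eventualSeminorm_eq r hr (i := j) _ fun k hk ↦ by
              rw [h0 k hk, h0 j le_rfl, map_zero], h0 j le_rfl, map_zero] } }
  obtain ⟨q, hq, hq', e⟩ := exists_seminorm_eq_norm (hc.desc s)
  refine ⟨q, hq, hq', fun j a ↦ ?_⟩
  rw [e, ← hn]
  exact congrArg norm (DFunLike.congr_fun (hc.fac s j) a)

end Limit

/-- The continuous C*-seminorms on the algebras of a direct system. -/
def seminormFunctor {ν : Ordinal.{u}} {J : Type u} [LinearOrder J] (F : J ⥤ NuAlg ν) :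
    Jᵒᵖ ⥤ Type u where
  obj j := {p : Seminorm ℂ (F.obj j.unop) // Continuous p ∧ IsCStarSeminorm p}
  map φ := ↾fun p ↦ ⟨compHom p.1 (F.map φ.unop), continuous_compHom p.2.1 _, p.2.2.compHom _⟩
  map_id j := by
    refine ConcreteCategory.hom_ext _ _ fun p ↦ Subtype.ext (Seminorm.ext fun a ↦ ?_)
    change p.1 (F.map (𝟙 _) a) = p.1 a
    rw [F.map_id, NuAlg.id_apply]
  map_comp φ ψ := by
    refine ConcreteCategory.hom_ext _ _ fun p ↦ Subtype.ext (Seminorm.ext fun a ↦ ?_)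
    change p.1 (F.map (ψ.unop ≫ φ.unop) a) = p.1 (F.map φ.unop (F.map ψ.unop a))
    rw [F.map_comp, NuAlg.comp_apply]

/-- The seminorm extension property is preserved by transfinite compositions. -/
instance {ν : Ordinal.{u}} [Fact (Cardinal.aleph0 ≤ ν.card)] (J : Type u) [LinearOrder J]
    [SuccOrder J] [OrderBot J] [WellFoundedLT J] :
    (seminormExtensions ν).IsStableUnderTransfiniteCompositionOfShape J := by
  refine ⟨?_⟩
  rintro B D f ⟨h⟩
  have key : HasSeminormExtension (h.incl.app ⊥) := by
    intro p hp hp'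
    have d : (seminormFunctor h.F).WellOrderInductionData := .ofExists
      (fun j hj p ↦ by
        obtain ⟨q, hq, hq', e⟩ := h.map_mem j hj p.1 p.2.1 p.2.2
        exact ⟨⟨q, hq, hq'⟩, Subtype.ext (Seminorm.ext e)⟩)
      (fun j hj x ↦ by
        have : Nonempty (Set.Iio j) := ⟨⟨⊥, hj.bot_lt⟩⟩
        obtain ⟨q, hq, hq', e⟩ := exists_seminorm_colimit
          (h.F.isColimitOfIsWellOrderContinuous j hj) (fun i ↦ (x.1 ⟨i⟩).1)
          (fun i k hik a ↦ by
            have := congrArg Subtype.val (x.2 (homOfLE hik).op)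
            exact DFunLike.congr_fun this a) (fun i ↦ (x.1 ⟨i⟩).2.1) (fun i ↦ (x.1 ⟨i⟩).2.2)
        exact ⟨⟨q, hq, hq'⟩, fun i hi ↦ Subtype.ext (Seminorm.ext fun a ↦ e ⟨i, hi⟩ a)⟩)
    obtain ⟨s, hs⟩ := d.surjective ⟨p, hp, hp'⟩
    obtain ⟨q, hq, hq', e⟩ := exists_seminorm_colimit h.isColimit (fun j ↦ (s.1 ⟨j⟩).1)
      (fun i k hik a ↦ DFunLike.congr_fun (congrArg Subtype.val (s.2 (homOfLE hik).op)) a)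
      (fun j ↦ (s.1 ⟨j⟩).2.1) (fun j ↦ (s.1 ⟨j⟩).2.2)
    refine ⟨q, hq, hq', fun a ↦ (e ⊥ a).trans ?_⟩
    exact DFunLike.congr_fun (congrArg Subtype.val hs) a
  exact ((seminormExtensions ν).arrow_mk_iso_iff
    (Arrow.isoMk h.isoBot.symm (Iso.refl _))).2 key

instance {ν : Ordinal.{u}} [Fact (Cardinal.aleph0 ≤ ν.card)] :
    MorphismProperty.IsStableUnderTransfiniteComposition.{u} (seminormExtensions ν) where

theorem relativeCells_le_seminormExtensions {ν : Ordinal.{u}} [Fact (Cardinal.aleph0 ≤ ν.card)]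
    {W : MorphismProperty (NuAlg ν)} (hW : W ≤ seminormExtensions ν) :
    relativeCells W ≤ seminormExtensions ν :=
  (MorphismProperty.transfiniteCompositions_le_iff.2
    (pushouts_coproducts_le_seminormExtensions hW))

/-! ### Smallness -/

section Smallness

variable {ν : Ordinal.{u}}

theorem HasSeminormExtension.isInducing {B D : NuAlg ν} {f : B ⟶ D}
    (hf : HasSeminormExtension f) : IsInducing f := by
  have h0 : 𝓝 (0 : B) = comap f (𝓝 0) := by
    refine le_antisymm ?_ ?_
    · have := f.continuous.tendsto 0
      rw [map_zero] at this
      exact this.le_comap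
    · obtain ⟨S, hS, h⟩ := B.isLMCCStar.exists_seminorms
      rw [(SeminormFamily.withSeminorms_iff_nhds_eq_iInf _).1 h]
      refine le_iInf fun p ↦ ?_
      obtain ⟨q, hq, -, e⟩ := hf p (h.continuous_seminorm p) (hS p p.2)
      have h1 : Tendsto q (𝓝 0) (𝓝 0) := by
        have := hq.tendsto 0
        rwa [map_zero] at this
      rw [← tendsto_iff_comap]
      exact (h1.comp tendsto_comap).congr e
  refine ⟨?_⟩
  have := topologicalAddGroup_induced (f : B →+ D)
  exact IsTopologicalAddGroup.ext inferInstance this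
    (h0.trans (by rw [nhds_induced]; exact congrArg (comap f ∘ 𝓝) (map_zero f).symm))

theorem HasSeminormExtension.injective {B D : NuAlg ν} {f : B ⟶ D}
    (hf : HasSeminormExtension f) : Function.Injective f :=
  hf.isInducing.injective

theorem HasSeminormExtension.isNuClosed_range {B D : NuAlg ν} {f : B ⟶ D}
    (hf : HasSeminormExtension f) [Nonempty ν.ToType] : IsNuClosed ν (Set.range f) := by
  intro x hx a ha
  choose y hy using hx
  obtain ⟨b, hb⟩ := B.isNuComplete y fun U hU ↦ by
    rw [hf.isInducing.nhds_eq_comap, map_zero] at hU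
    obtain ⟨V, hV, hVU⟩ := hU
    have h1 : Tendsto (fun z : ν.ToType × ν.ToType ↦ x z.1 - x z.2) (atTop ×ˢ atTop) (𝓝 0) := by
      have := (ha.comp tendsto_fst).sub (ha.comp (tendsto_snd (f := (atTop : Filter ν.ToType))))
      rwa [sub_self] at this
    have h2 := h1 hV
    rw [mem_map, prod_atTop_atTop_eq, mem_atTop_sets] at h2
    obtain ⟨⟨γ, δ⟩, h⟩ := h2
    refine ⟨γ ⊔ δ, fun α β hα hβ ↦ hVU ?_⟩
    have := h (α, β) ⟨le_sup_left.trans hα, le_sup_right.trans hβ⟩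
    simpa only [Set.mem_preimage, map_sub, hy] using this
  refine ⟨b, tendsto_nhds_unique ((f.continuous.tendsto b).comp hb) ?_⟩
  exact ha.congr fun α ↦ (hy α).symm

/-- A `ν`-closed *-subalgebra, as an object. -/
@[reducible] def NuAlg.ofSubalgebra {B : NuAlg ν} (S : NonUnitalStarSubalgebra ℂ B)
    (hS : IsNuClosed ν (S : Set B)) : NuAlg ν where
  carrier := S
  isNuComplete := NuAlg.isNuComplete_subalgebra B.isNuComplete S hS

/-- The inclusion of a `ν`-closed *-subalgebra. -/
def NuAlg.subalgebraIncl {B : NuAlg ν} (S : NonUnitalStarSubalgebra ℂ B)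
    (hS : IsNuClosed ν (S : Set B)) : NuAlg.ofSubalgebra S hS ⟶ B where
  toStarHom := NonUnitalStarSubalgebraClass.subtype S
  continuous := continuous_subtype_val

/-- A morphism with values in a `ν`-closed *-subalgebra factors through it. -/
def NuAlg.subalgebraLift {B D : NuAlg ν} (S : NonUnitalStarSubalgebra ℂ B)
    (hS : IsNuClosed ν (S : Set B)) (f : D ⟶ B) (h : ∀ d, f d ∈ S) :
    D ⟶ NuAlg.ofSubalgebra S hS where
  toStarHom := NonUnitalStarAlgHom.codRestrict f.toStarHom S h
  continuous := f.continuous.subtype_mk h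

theorem mem_of_isColimit {J : Type*} [Category* J] {F : J ⥤ NuAlg ν} {c : Cocone F}
    (hc : IsColimit c) (S : NonUnitalStarSubalgebra ℂ c.pt) (hS : IsNuClosed ν (S : Set c.pt))
    (h : ∀ j a, c.ι.app j a ∈ S) (x : c.pt) : x ∈ S := by
  let s : Cocone F :=
    { pt := NuAlg.ofSubalgebra S hS
      ι :=
        { app j := NuAlg.subalgebraLift S hS (c.ι.app j) (h j)
          naturality i j f := NuAlg.hom_ext fun a ↦ Subtype.ext
            (DFunLike.congr_fun (c.ι.naturality f) a) } }
  have h1 : hc.desc s ≫ NuAlg.subalgebraIncl S hS = 𝟙 _ := hc.hom_ext fun j ↦ by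
    rw [hc.fac_assoc, Category.comp_id]
    rfl
  have h2 := DFunLike.congr_fun h1 x
  rw [NuAlg.comp_apply, NuAlg.id_apply] at h2
  rw [← h2]
  exact (hc.desc s x : S).2

/-- The union of the images of the algebras of a direct system in the vertex of a cocone. -/
def unionOfRanges {J : Type u} [LinearOrder J] [Nonempty J] {F : J ⥤ NuAlg ν} (c : Cocone F) :
    NonUnitalStarSubalgebra ℂ c.pt :=
  have key : ∀ {i j : J} (h : i ≤ j) (a : F.obj i),
      c.ι.app j (F.map (homOfLE h) a) = c.ι.app i a := fun h a ↦
    DFunLike.congr_fun (c.w (homOfLE h)) a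
  { carrier := {x | ∃ j a, c.ι.app j a = x}
    zero_mem' := ⟨Classical.arbitrary J, 0, map_zero _⟩
    add_mem' := by
      rintro _ _ ⟨i, a, rfl⟩ ⟨j, b, rfl⟩
      refine ⟨i ⊔ j, F.map (homOfLE le_sup_left) a + F.map (homOfLE le_sup_right) b, ?_⟩
      rw [map_add, key, key]
    mul_mem' := by
      rintro _ _ ⟨i, a, rfl⟩ ⟨j, b, rfl⟩
      refine ⟨i ⊔ j, F.map (homOfLE le_sup_left) a * F.map (homOfLE le_sup_right) b, ?_⟩
      rw [map_mul, key, key]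
    smul_mem' := by
      rintro k _ ⟨i, a, rfl⟩
      exact ⟨i, k • a, map_smul _ _ _⟩
    star_mem' := by
      rintro _ ⟨i, a, rfl⟩
      exact ⟨i, star a, map_star _ _⟩ }

variable {J : Type u} [LinearOrder J] [Nonempty J] {F : J ⥤ NuAlg ν}

theorem exists_range_of_bddAbove {c : Cocone F} {K : Type*}
    (hK : ∀ k : K → J, BddAbove (Set.range k))
    {x : K → c.pt} (hx : ∀ k, x k ∈ unionOfRanges c) : ∃ j, ∀ k, x k ∈ Set.range (c.ι.app j) := by
  choose i a hi using hx
  obtain ⟨j, hj⟩ := hK i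
  refine ⟨j, fun k ↦ ⟨F.map (homOfLE (hj ⟨k, rfl⟩)) (a k), ?_⟩⟩
  rw [← NuAlg.comp_apply, c.w, hi]

/-- If the morphisms to the colimit of a sufficiently long sequence have the seminorm extension
property then the colimit is the union of the algebras of the sequence: the union is `ν`-closed. -/
theorem mem_unionOfRanges {c : Cocone F} (hc : IsColimit c) [Nonempty ν.ToType]
    (hs : ∀ j, HasSeminormExtension (c.ι.app j))
    (hν : ∀ k : ν.ToType → J, BddAbove (Set.range k)) (x : c.pt) : x ∈ unionOfRanges c := by
  refine mem_of_isColimit hc _ (fun y hy a ha ↦ ?_) (fun j a ↦ ?_) x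
  · obtain ⟨j, hj⟩ := exists_range_of_bddAbove hν hy
    obtain ⟨b, hb⟩ := (hs j).isNuClosed_range y hj a ha
    exact ⟨j, b, hb⟩
  · exact (⟨j, a, rfl⟩ : ∃ i b, c.ι.app i b = c.ι.app j a)

/-- Every object is small relative to sufficiently long sequences of morphisms with the seminorm
extension property. -/
theorem preservesColimit_coyoneda {c : Cocone F} (hc : IsColimit c) [Nonempty ν.ToType]
    (hs : ∀ j, HasSeminormExtension (c.ι.app j)) (A : NuAlg ν)
    (hν : ∀ k : ν.ToType → J, BddAbove (Set.range k))
    (hA : ∀ k : A → J, BddAbove (Set.range k)) :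
    PreservesColimit F (coyoneda.obj (Opposite.op A)) := by
  have : IsFiltered J := isFiltered_of_directed_le_nonempty J
  refine preservesColimit_of_preserves_colimit_cocone hc
    (Types.FilteredColimit.isColimitOf' _ _ (fun f ↦ ?_) (fun j f g h ↦ ⟨j, 𝟙 j, ?_⟩))
  · change A ⟶ c.pt at f
    obtain ⟨j, hj⟩ := exists_range_of_bddAbove hA fun a ↦ mem_unionOfRanges hc hs hν (f a)
    choose g hg using hj
    have hi := (hs j).injective
    refine ⟨j, (⟨⟨⟨⟨⟨g, fun k a ↦ hi ?_⟩, hi ?_, fun a b ↦ hi ?_⟩, fun a b ↦ hi ?_⟩, fun a ↦ hi ?_⟩,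
      (hs j).isInducing.continuous_iff.2 ?_⟩ : A ⟶ F.obj j), ?_⟩
    · simp [hg]
    · simp [hg]
    · simp [hg]
    · simp [hg]
    · exact (hg _).trans (((map_star f a).trans (congrArg star (hg a).symm)).trans
        (map_star (c.ι.app j) (g a)).symm)
    · exact f.continuous.congr fun a ↦ (hg a).symm
    · exact NuAlg.hom_ext fun a ↦ (hg a).symm
  · change A ⟶ F.obj j at f g
    have : f = g := NuAlg.hom_ext fun a ↦ (hs j).injective (DFunLike.congr_fun (F := A ⟶ c.pt) h a)
    rw [this]

theorem bddAbove_range_of_lt_cof {o : Ordinal.{u}} {K : Type u} (h : Cardinal.mk K < o.cof)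
    (k : K → o.ToType) : BddAbove (Set.range k) := by
  by_contra hb
  have hc : IsCofinal (Set.range k) := fun a ↦ by
    by_contra! h'
    refine hb ⟨a, ?_⟩
    rintro _ ⟨x, rfl⟩
    exact (h' _ ⟨x, rfl⟩).le
  have h1 := (Order.cof_le hc).trans Cardinal.mk_range_le
  rw [Ordinal.cof_toType] at h1
  exact h1.not_gt h

theorem isSmallRelativeTo_of_le_seminormExtensions [Fact (Cardinal.aleph0 ≤ ν.card)]
    {W : MorphismProperty (NuAlg ν)} (hW : W ≤ seminormExtensions ν) (A : NuAlg ν) :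
    IsSmallRelativeTo A W := by
  have := nonempty_toType ν
  refine ⟨max (Cardinal.mk ν.ToType) (Cardinal.mk A), fun o ho hκ F hF hF' ↦ ?_⟩
  have : Nonempty o.ToType := Ordinal.nonempty_toType_iff.2 ho.ne_bot
  let _ : OrderBot o.ToType := WellFoundedLT.toOrderBot _
  refine ⟨fun {c} hc ↦ ?_⟩
  let h : (seminormExtensions ν).TransfiniteCompositionOfShape o.ToType (c.ι.app ⊥) :=
    { F := F
      isoBot := Iso.refl _
      incl := c.ι
      isColimit := hc
      map_mem j _ := hW _ (hF' j) }
  have := preservesColimit_coyoneda hc h.mem_incl_app A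
    (bddAbove_range_of_lt_cof ((le_max_left _ _).trans_lt hκ))
    (bddAbove_range_of_lt_cof ((le_max_right _ _).trans_lt hκ))
  exact this.preserves hc

theorem hasSmallObjectArgument_of_le_seminormExtensions
    [Fact (Cardinal.aleph0 ≤ ν.card)] [HasColimitsOfSize.{u, u} (NuAlg ν)]
    {W : MorphismProperty (NuAlg ν)} [hWs : MorphismProperty.IsSmall.{u} W]
    (hW : W ≤ seminormExtensions ν) : MorphismProperty.HasSmallObjectArgument.{u} W := by
  have := nonempty_toType ν
  obtain ⟨K, A, B, φ, rfl⟩ := (MorphismProperty.isSmall_iff_eq_ofHoms W).1 hWs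
  let μ : Cardinal.{u} := max Cardinal.aleph0
    (max (Cardinal.mk ν.ToType) (Cardinal.mk (Σ k, A k)))
  have hμ : (Order.succ μ).IsRegular := Cardinal.isRegular_succ (le_max_left _ _)
  have hlt : μ < (Order.succ μ).ord.cof := by
    rw [hμ.cof_ord]
    exact Order.lt_succ μ
  have : Nonempty (Order.succ μ).ord.ToType := by
    rw [Ordinal.nonempty_toType_iff, ne_eq, Cardinal.ord_eq_zero]
    exact hμ.pos.ne'
  let o : OrderBot (Order.succ μ).ord.ToType := WellFoundedLT.toOrderBot _
  refine ⟨Order.succ μ, ⟨hμ⟩, o, ?_⟩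
  have : Fact (Order.succ μ).IsRegular := ⟨hμ⟩
  refine { preservesColimit := ?_ }
  rintro _ _ X Y _ ⟨k⟩ f h
  let h' : (seminormExtensions ν).TransfiniteCompositionOfShape _ f :=
    { h.toTransfiniteCompositionOfShape with
      map_mem j hj := pushouts_coproducts_le_seminormExtensions hW _ (by
        have := (h.attachCells j hj).pushouts_coproducts
        rwa [MorphismProperty.ofHoms_homFamily] at this) }
  refine preservesColimit_coyoneda h.isColimit h'.mem_incl_app (A k)
    (bddAbove_range_of_lt_cof (lt_of_le_of_lt ?_ hlt))
    (bddAbove_range_of_lt_cof (lt_of_le_of_lt ?_ hlt))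
  · exact (le_max_left _ _).trans (le_max_right _ _)
  · refine le_trans ?_ ((le_max_right _ _).trans (le_max_right _ _))
    exact Cardinal.mk_le_of_injective (f := fun a ↦ (⟨k, a⟩ : Σ k, A k))
      fun a b h ↦ eq_of_heq (Sigma.mk.inj h).2

end Smallness

/-! ### The generating cells -/

section Cells

variable {ν : Ordinal.{u}}

theorem NuAlg.zero_comp_eq {B D E : NuAlg ν} (f : D ⟶ E) : (0 : B ⟶ D) ≫ f = 0 :=
  NuAlg.hom_ext fun _ ↦ map_zero f

/-- A representation of `A ∧ S₊` extends radially to the cone on `S`, with values in the cylinder. Here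
`D` is a cone on `S` in the sense that there is a continuous surjection `S × I → D` which is
injective away from the zero section `S × 0`. -/
theorem exists_smashRep_cone {S D : Type u} [TopologicalSpace S] [CompactSpace S] [T2Space S]
    [TopologicalSpace D] [CompactSpace D] [T2Space D] {A Z W : NuAlg ν}
    (j : SmashRep A (PtCpt.plus S) Z) (k : SmashRep Z PtCpt.interval.{u} W)
    (κ : C(S × unitInterval, D)) (hκ : Function.Surjective κ)
    (hinj : ∀ s s' t t', κ (s, t) = κ (s', t') → t = t' ∧ (t = 0 ∨ s = s')) :
    ∃ φ : SmashRep A (PtCpt.plus D) W,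
      ∀ s t, φ.hom (Sum.inl (κ (s, t))) = j.hom (Sum.inl s) ≫ k.hom (ULift.up t) := by
  let r : S × unitInterval → (A ⟶ W) := fun z ↦ j.hom (Sum.inl z.1) ≫ k.hom (ULift.up z.2)
  have hr : ∀ z z', κ z = κ z' → r z = r z' := by
    rintro ⟨s, t⟩ ⟨s', t'⟩ h
    obtain ⟨rfl, rfl | rfl⟩ := hinj s s' t t' h
    · have : k.hom (ULift.up 0) = 0 := k.hom_pt
      exact NuAlg.hom_ext fun a ↦ by simp [r, this]
    · rfl
  let e : D → S × unitInterval := Function.surjInv hκ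
  have he : ∀ d, κ (e d) = d := Function.surjInv_eq hκ
  have hq : IsQuotientMap (Prod.map id κ : A × (S × unitInterval) → A × D) :=
    ((isProperMap_id.prodMap κ.continuous.isProperMap).isClosedMap).isQuotientMap
      (continuous_id.prodMap κ.continuous) (Function.surjective_id.prodMap hκ)
  have hc : Continuous fun z : A × D ↦ r (e z.2) z.1 := by
    rw [hq.continuous_iff]
    have h2 : Continuous fun z : A × (S × unitInterval) ↦
        k.hom (ULift.up z.2.2) (j.hom (Sum.inl z.2.1) z.1) :=
      k.continuous_uncurry.comp ((j.continuous_uncurry.comp (continuous_fst.prodMk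
        (continuous_inl.comp (continuous_fst.comp continuous_snd)))).prodMk
          (continuous_uliftUp.comp (continuous_snd.comp continuous_snd)))
    refine h2.congr fun z ↦ ?_
    exact DFunLike.congr_fun (hr z.2 (e (κ z.2)) (he _).symm) z.1
  refine ⟨{
    hom x := Sum.elim (fun d ↦ r (e d)) (fun _ ↦ 0) x
    hom_pt := rfl
    continuous_uncurry := ?_ }, fun s t ↦ hr _ _ (he _)⟩
  have h3 : Continuous ((fun z : A × (D ⊕ PUnit.{u + 1}) ↦
      (Sum.elim (fun d ↦ r (e d)) (fun _ ↦ 0) z.2 : A ⟶ W) z.1) ∘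
        (Homeomorph.prodSumDistrib (X := A) (Y := D) (Z := PUnit.{u + 1})).symm) := by
    rw [continuous_sum_dom]
    exact ⟨hc, continuous_const⟩
  exact (Homeomorph.comp_continuous_iff' _).1 h3

variable [Fact (Cardinal.aleph0 ≤ ν.card)] {A : NuAlg ν}

/-- The universal representation of `A ∧ X`. -/
def smashIncl (A : NuAlg ν) (X : PtCpt.{u}) : SmashRep A X ((hatSmash A).obj X) :=
  hatSmashIncl A X

/-- The morphism on `A ∧̂ X` induced by a representation. -/
def smashLift {X : PtCpt.{u}} {B : NuAlg ν} (φ : SmashRep A X B) : (hatSmash A).obj X ⟶ B :=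
  hatSmashLift φ

theorem smashIncl_lift {X : PtCpt.{u}} {B : NuAlg ν} (φ : SmashRep A X B) (x : X) :
    (smashIncl A X).hom x ≫ smashLift φ = φ.hom x :=
  hatSmashIncl_lift φ x

theorem smash_hom_ext {X : PtCpt.{u}} {B : NuAlg ν} {f g : (hatSmash A).obj X ⟶ B}
    (h : ∀ x, (smashIncl A X).hom x ≫ f = (smashIncl A X).hom x ≫ g) : f = g :=
  hatSmash_hom_ext h

theorem smashIncl_map {X Y : PtCpt.{u}} (h : X ⟶ Y) (x : X) :
    (smashIncl A X).hom x ≫ (hatSmash A).map h = (smashIncl A Y).hom (h x) :=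
  hatSmashIncl_lift _ x

/-- By the strong cylinder seminorm extension property, seminorms extend from `A ∧̂ S₊` to its cone,
and `A ∧̂ D₊` maps to it, when `D` is a cone on `S`. -/
theorem hasSeminormExtension_map_of_cone (h₃ : StrongCylinderSeminormExtension A) {S D : Type u}
    [TopologicalSpace S] [CompactSpace S] [T2Space S] [TopologicalSpace D] [CompactSpace D]
    [T2Space D] (i : C(S, D)) (κ : C(S × unitInterval, D)) (hκ : Function.Surjective κ)
    (h1 : ∀ s, κ (s, 1) = i s)
    (hinj : ∀ s s' t t', κ (s, t) = κ (s', t') → t = t' ∧ (t = 0 ∨ s = s')) :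
    HasSeminormExtension ((hatSmash A).map (PtCpt.plusMap i)) := by
  obtain ⟨φ, hφ⟩ := exists_smashRep_cone (smashIncl A (PtCpt.plus S))
    (smashIncl ((hatSmash A).obj (PtCpt.plus S)) PtCpt.interval.{u}) κ hκ hinj
  refine .of_comp _ (smashLift φ) ?_
  have key : (hatSmash A).map (PtCpt.plusMap i) ≫ smashLift φ =
      (smashIncl ((hatSmash A).obj (PtCpt.plus S)) PtCpt.interval.{u}).hom (ULift.up 1) := by
    refine smash_hom_ext fun x ↦ ?_
    rw [← Category.assoc, smashIncl_map, smashIncl_lift]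
    rcases x with s | x
    · refine Eq.trans ?_ (hφ s 1)
      rw [h1]
      rfl
    · refine φ.hom_pt.trans ?_
      change 0 = (smashIncl A (PtCpt.plus S)).hom (PtCpt.plus S).pt ≫ _
      rw [(smashIncl A (PtCpt.plus S)).hom_pt, NuAlg.zero_comp_eq]
  rw [key]
  exact h₃ (PtCpt.plus S)

theorem hasSeminormExtension_map_of_isEmpty {S D : Type u} [IsEmpty S]
    [TopologicalSpace S] [CompactSpace S] [T2Space S] [TopologicalSpace D] [CompactSpace D]
    [T2Space D] (i : C(S, D)) : HasSeminormExtension ((hatSmash A).map (PtCpt.plusMap i)) := by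
  refine .of_splitMono _ 0 (smash_hom_ext fun x ↦ ?_)
  rcases x with s | x
  · exact isEmptyElim s
  · change (smashIncl A (PtCpt.plus S)).hom (PtCpt.plus S).pt ≫ _ =
      (smashIncl A (PtCpt.plus S)).hom (PtCpt.plus S).pt ≫ _
    rw [(smashIncl A (PtCpt.plus S)).hom_pt, NuAlg.zero_comp_eq, NuAlg.zero_comp_eq]

theorem generatingCells_le_seminormExtensions (h₃ : StrongCylinderSeminormExtension A) :
    generatingCells A ≤ seminormExtensions ν := by
  rintro _ _ _ ⟨n⟩
  rcases n with - | n
  · have : IsEmpty (TopCat.diskBoundary.{u} 0) := ⟨fun x ↦ by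
      have h1 := mem_sphere_zero_iff_norm.1 x.down.2
      rw [Subsingleton.elim x.down.1 0, norm_zero] at h1
      exact zero_ne_one h1⟩
    exact hasSeminormExtension_map_of_isEmpty _
  · have hn (s : TopCat.diskBoundary.{u} (n + 1)) : ‖s.down.1‖ = 1 :=
      mem_sphere_zero_iff_norm.1 s.down.2
    have hnt (s : TopCat.diskBoundary.{u} (n + 1)) (t : unitInterval) :
        ‖(t : ℝ) • s.down.1‖ = t := by
      rw [norm_smul, hn, mul_one, Real.norm_of_nonneg t.2.1]
    let κ : C(TopCat.diskBoundary.{u} (n + 1) × unitInterval, TopCat.disk.{u} (n + 1)) :=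
      ⟨fun z ↦ ⟨⟨(z.2 : ℝ) • z.1.down.1, by
        rw [mem_closedBall_zero_iff, hnt]
        exact z.2.2.2⟩⟩, by
        refine continuous_uliftUp.comp (Continuous.subtype_mk ?_ _)
        exact (continuous_subtype_val.comp continuous_snd).smul
          (continuous_subtype_val.comp (continuous_uliftDown.comp continuous_fst))⟩
    refine hasSeminormExtension_map_of_cone h₃ _ κ (fun d ↦ ?_) (fun s ↦ ?_)
      fun s s' t t' h ↦ ?_
    · have hd := mem_closedBall_zero_iff.1 d.down.2
      by_cases h0 : d.down.1 = 0
      · let v : EuclideanSpace ℝ (Fin (n + 1)) := EuclideanSpace.single 0 1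
        refine ⟨(⟨v, by simp [v]⟩, 0), ULift.ext _ _ (Subtype.ext ?_)⟩
        exact (zero_smul ℝ v).trans h0.symm
      · have h0' := norm_ne_zero_iff.2 h0
        refine ⟨(⟨‖d.down.1‖⁻¹ • d.down.1, ?_⟩, ⟨‖d.down.1‖, norm_nonneg _, hd⟩),
          ULift.ext _ _ (Subtype.ext ?_)⟩
        · rw [mem_sphere_zero_iff_norm, norm_smul, norm_inv, norm_norm, inv_mul_cancel₀ h0']
        · exact smul_inv_smul₀ h0' _
    · exact ULift.ext _ _ (Subtype.ext (one_smul ℝ s.down.1))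
    · have h' : (t : ℝ) • s.down.1 = (t' : ℝ) • s'.down.1 :=
        congrArg (fun d : TopCat.disk.{u} (n + 1) ↦ d.down.1) h
      have ht : t = t' := Subtype.ext (by rw [← hnt s t, h', hnt])
      subst ht
      refine ⟨rfl, or_iff_not_imp_left.2 fun h0 ↦ ?_⟩
      have h0' : (t : ℝ) ≠ 0 := fun h ↦ h0 (Subtype.ext h)
      exact ULift.ext _ _ (Subtype.ext (smul_right_injective _ h0' h'))

end Cells

/-! ### Limits and colimits -/

section LimitsColimits

variable {ν : Ordinal.{u}}

/-- The product of a family of objects. -/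
@[reducible] def NuAlg.pi {ι : Type u} (B : ι → NuAlg ν) : NuAlg ν where
  carrier := ∀ i, B i
  isNuComplete := isNuComplete_pi fun i ↦ (B i).isNuComplete

/-- The projections of a product. -/
def NuAlg.piProj {ι : Type u} (B : ι → NuAlg ν) (i : ι) : NuAlg.pi B ⟶ B i where
  toStarHom :=
    { toFun x := x i
      map_smul' _ _ := rfl
      map_zero' := rfl
      map_add' _ _ := rfl
      map_mul' _ _ := rfl
      map_star' _ := rfl }
  continuous := continuous_apply i

/-- The morphism to a product given by its components. -/
def NuAlg.piLift {ι : Type u} {B : ι → NuAlg ν} {D : NuAlg ν} (f : ∀ i, D ⟶ B i) :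
    D ⟶ NuAlg.pi B where
  toStarHom :=
    { toFun x i := f i x
      map_smul' _ _ := funext fun _ ↦ map_smul _ _ _
      map_zero' := funext fun _ ↦ map_zero _
      map_add' _ _ := funext fun _ ↦ map_add _ _ _
      map_mul' _ _ := funext fun _ ↦ map_mul _ _ _
      map_star' _ := funext fun _ ↦ map_star _ _ }
  continuous := continuous_pi fun i ↦ (f i).continuous

theorem NuAlg.hasProducts : HasProducts.{u} (NuAlg ν) :=
  hasProducts_of_limit_fans (fun B ↦ Fan.mk (NuAlg.pi B) (NuAlg.piProj B)) fun _ ↦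
    Fan.IsLimit.mk _ (fun s ↦ NuAlg.piLift s.proj) (fun _ _ ↦ rfl)
      fun _ _ h ↦ NuAlg.hom_ext fun x ↦ funext fun i ↦ DFunLike.congr_fun (h i) x

/-- The equalizer of two morphisms, as a *-subalgebra. -/
def NuAlg.equalizer {B D : NuAlg ν} (f g : B ⟶ D) : NonUnitalStarSubalgebra ℂ B where
  carrier := {x | f x = g x}
  zero_mem' := (map_zero f).trans (map_zero g).symm
  add_mem' {x y} hx hy := by simp_all
  mul_mem' {x y} hx hy := by simp_all
  smul_mem' c x hx := by simp_all
  star_mem' {x} hx := (map_star f x).trans ((congrArg star hx).trans (map_star g x).symm)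

theorem IsClosed.isNuClosed [Nonempty ν.ToType] {E : Type*} [TopologicalSpace E] {S : Set E}
    (hS : IsClosed S) : IsNuClosed ν S := fun _ hx _ ha ↦
  hS.mem_of_tendsto ha (Eventually.of_forall hx)

theorem NuAlg.isClosed_equalizer {B D : NuAlg ν} (f g : B ⟶ D) :
    IsClosed (NuAlg.equalizer f g : Set B) :=
  isClosed_eq f.continuous g.continuous

theorem NuAlg.hasEqualizers [Fact (Cardinal.aleph0 ≤ ν.card)] : HasEqualizers (NuAlg ν) := by
  have := nonempty_toType ν
  refine @hasEqualizers_of_hasLimit_parallelPair _ _ fun {B D f g} ↦ ?_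
  have h := IsClosed.isNuClosed (ν := ν) (NuAlg.isClosed_equalizer f g)
  refine ⟨⟨⟨Fork.ofι (NuAlg.subalgebraIncl _ h) (NuAlg.hom_ext fun x ↦ x.2),
    Fork.IsLimit.mk' _ fun s ↦ ⟨NuAlg.subalgebraLift _ h s.ι fun x ↦
      DFunLike.congr_fun s.condition x, rfl, fun {m} hm ↦ ?_⟩⟩⟩⟩
  exact NuAlg.hom_ext fun x ↦ Subtype.ext (DFunLike.congr_fun hm x)

theorem NuAlg.hasLimitsOfSize [Fact (Cardinal.aleph0 ≤ ν.card)] :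
    HasLimitsOfSize.{u, u} (NuAlg ν) :=
  have := NuAlg.hasProducts (ν := ν)
  have := NuAlg.hasEqualizers (ν := ν)
  has_limits_of_hasEqualizers_and_products

section Colimit

variable {J : Type u} [Category.{u} J] (F : J ⥤ NuAlg ν)

/-- The product of the vertices of all cocones. -/
abbrev CoconeProduct : Type (u + 1) := ∀ c : Cocone F, c.pt

variable {F} in
/-- The image of an element of one of the algebras of a diagram in the product of the vertices of
all cocones. -/
def coconeValue (j : J) (a : F.obj j) : CoconeProduct F := fun c ↦ c.ι.app j a

/-- The `ν`-closed *-subalgebra of the product of the vertices of all cocones generated by the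
diagram. -/
def colimitSubalgebra : NonUnitalStarSubalgebra ℂ (CoconeProduct F) :=
  sInf {S | IsNuClosed ν (S : Set (CoconeProduct F)) ∧ ∀ j a, coconeValue j a ∈ S}

theorem isNuClosed_colimitSubalgebra :
    IsNuClosed ν (colimitSubalgebra F : Set (CoconeProduct F)) := by
  intro x hx a ha
  simp only [colimitSubalgebra, SetLike.mem_coe, NonUnitalStarAlgebra.mem_sInf] at hx ⊢
  exact fun S hS ↦ hS.1 x (fun α ↦ hx α S hS) a ha

theorem coconeValue_mem (j : J) (a : F.obj j) : coconeValue j a ∈ colimitSubalgebra F :=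
  NonUnitalStarAlgebra.mem_sInf.2 fun _ hS ↦ hS.2 j a

theorem isNuComplete_colimitSubalgebra : IsNuComplete (colimitSubalgebra F) ν :=
  NuAlg.isNuComplete_subalgebra (isNuComplete_pi fun c ↦ c.pt.isNuComplete) _
    (isNuClosed_colimitSubalgebra F)

instance [Fact (Cardinal.aleph0 ≤ ν.card)] : Small.{u} (colimitSubalgebra F) := by
  have := nonempty_toType ν
  let v : (Σ j, F.obj j) → CoconeProduct F := fun z ↦ coconeValue z.1 z.2
  have h1 : colimitSubalgebra F ≤ (Term.range v).topologicalClosure :=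
    sInf_le ⟨IsClosed.isNuClosed (NonUnitalStarSubalgebra.isClosed_topologicalClosure _),
      fun j a ↦ NonUnitalStarSubalgebra.le_topologicalClosure _ ⟨.gen ⟨j, a⟩, rfl⟩⟩
  have := small_closure_range (Term.eval v)
  exact small_subset (s := closure (Set.range (Term.eval v))) h1

variable [Fact (Cardinal.aleph0 ≤ ν.card)]

/-- The colimit cocone of a diagram. -/
def nuColimitCocone : Cocone F where
  pt := NuAlg.ofSmall (colimitSubalgebra F) (isNuComplete_colimitSubalgebra F)
  ι :=
    { app j :=
        { toStarHom := (NuAlg.toSmall _ (isNuComplete_colimitSubalgebra F)).comp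
            { toFun a := ⟨coconeValue j a, coconeValue_mem F j a⟩
              map_smul' _ _ := Subtype.ext (funext fun c ↦ map_smul (c.ι.app j) _ _)
              map_zero' := Subtype.ext (funext fun c ↦ map_zero (c.ι.app j))
              map_add' _ _ := Subtype.ext (funext fun c ↦ map_add (c.ι.app j) _ _)
              map_mul' _ _ := Subtype.ext (funext fun c ↦ map_mul (c.ι.app j) _ _)
              map_star' _ := Subtype.ext (funext fun c ↦ map_star (c.ι.app j) _) }
          continuous := (NuAlg.continuous_toSmall _ (isNuComplete_colimitSubalgebra F)).comp
            (Continuous.subtype_mk (continuous_pi fun c ↦ (c.ι.app j).continuous) _) }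
      naturality _ _ f := NuAlg.hom_ext fun a ↦
        congrArg (NuAlg.toSmall _ (isNuComplete_colimitSubalgebra F))
          (Subtype.ext (funext fun c ↦ DFunLike.congr_fun (c.w f) a)) }

/-- The morphism from the colimit to the vertex of a cocone. -/
def nuColimitDesc (c : Cocone F) : (nuColimitCocone F).pt ⟶ c.pt where
  toStarHom := NonUnitalStarAlgHom.comp
    { toFun (t : colimitSubalgebra F) := t.1 c
      map_smul' _ _ := rfl
      map_zero' := rfl
      map_add' _ _ := rfl
      map_mul' _ _ := rfl
      map_star' _ := rfl } (NuAlg.fromSmall _ (isNuComplete_colimitSubalgebra F))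
  continuous := (continuous_apply (A := fun c : Cocone F ↦ c.pt.carrier) c).comp
    (continuous_subtype_val.comp
      (NuAlg.continuous_fromSmall _ (isNuComplete_colimitSubalgebra F)))

/-- Two morphisms on the colimit agreeing on the diagram are equal, since their equalizer is
`ν`-closed. -/
theorem nuColimit_hom_ext {D : NuAlg ν} {f g : (nuColimitCocone F).pt ⟶ D}
    (h : ∀ j, (nuColimitCocone F).ι.app j ≫ f = (nuColimitCocone F).ι.app j ≫ g) : f = g := by
  have := nonempty_toType ν
  let k := NuAlg.toSmall _ (isNuComplete_colimitSubalgebra F)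
  have hk := NuAlg.continuous_toSmall _ (isNuComplete_colimitSubalgebra F)
  let T : NonUnitalStarSubalgebra ℂ (CoconeProduct F) :=
    ((NuAlg.equalizer f g).comap k).map
      (NonUnitalStarSubalgebraClass.subtype (colimitSubalgebra F))
  have hT : colimitSubalgebra F ≤ T := by
    refine sInf_le ⟨fun x hx a ha ↦ ?_, fun j a ↦ ?_⟩
    · choose y hy hyx using hx
      have haG : a ∈ colimitSubalgebra F :=
        isNuClosed_colimitSubalgebra F x (fun α ↦ hyx α ▸ (y α).2) a ha
      have hya : Tendsto y atTop (𝓝 ⟨a, haG⟩) := by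
        refine tendsto_subtype_rng.2 ?_
        convert ha using 2 with α
        exact hyx α
      refine ⟨⟨a, haG⟩, ?_, rfl⟩
      exact ((NuAlg.isClosed_equalizer f g).preimage hk).mem_of_tendsto hya
        (Eventually.of_forall hy)
    · exact ⟨⟨_, coconeValue_mem F j a⟩, DFunLike.congr_fun (h j) a, rfl⟩
  refine NuAlg.hom_ext fun t ↦ ?_
  obtain ⟨s, rfl⟩ : ∃ s, k s = t := ⟨_, NuAlg.toSmall_fromSmall _ _ t⟩
  obtain ⟨s', hs', hss⟩ := hT s.2
  obtain rfl : s' = s := Subtype.ext hss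
  exact hs'

theorem NuAlg.hasColimit : HasColimit F := by
  have h : ∀ (c : Cocone F) (j : J), (nuColimitCocone F).ι.app j ≫ nuColimitDesc F c =
      c.ι.app j := by
    intro c j
    refine NuAlg.hom_ext fun a ↦ ?_
    change (NuAlg.fromSmall _ (isNuComplete_colimitSubalgebra F)
      (NuAlg.toSmall _ (isNuComplete_colimitSubalgebra F)
        ⟨coconeValue j a, coconeValue_mem F j a⟩)).1 c = _
    rw [NuAlg.fromSmall_toSmall]
    rfl
  exact ⟨⟨⟨nuColimitCocone F, ⟨nuColimitDesc F, h, fun c m hm ↦ nuColimit_hom_ext F fun j ↦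
    (hm j).trans (h c j).symm⟩⟩⟩⟩

end Colimit

theorem NuAlg.hasColimitsOfSize [Fact (Cardinal.aleph0 ≤ ν.card)] :
    HasColimitsOfSize.{u, u} (NuAlg ν) :=
  ⟨fun _ _ ↦ ⟨fun F ↦ NuAlg.hasColimit F⟩⟩

end LimitsColimits

/-! ### Box filling in cubes -/

section Cubes

open unitInterval

/-- The cube `[0,1]^n`. -/
abbrev Cb (n : ℕ) : Type := Fin n → I

namespace Cb

variable {n : ℕ}

/-- The boundary of the cube. -/
abbrev bd (n : ℕ) : Set (Cb n) := Cube.boundary (Fin n)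

/-- The point of the cube with first coordinate `t` and remaining coordinates `x`. -/
def cons (t : I) (x : Cb n) : Cb (n + 1) := Fin.cons (α := fun _ ↦ I) t x

/-- All coordinates but the first. -/
def tail (z : Cb (n + 1)) : Cb n := fun i ↦ z i.succ

@[simp] theorem cons_zero (t : I) (x : Cb n) : cons t x 0 = t := rfl

@[simp] theorem cons_tail (z : Cb (n + 1)) : cons (z 0) (tail z) = z := Fin.cons_self_tail z

@[fun_prop]
theorem continuous_tail : Continuous (tail : Cb (n + 1) → Cb n) :=
  continuous_pi fun i ↦ continuous_apply i.succ

@[fun_prop]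
theorem _root_.Continuous.cbCons {Z : Type*} [TopologicalSpace Z] {f : Z → I} {g : Z → Cb n}
    (hf : Continuous f) (hg : Continuous g) : Continuous fun z ↦ cons (f z) (g z) :=
  hf.finCons hg

theorem mem_bd_iff (z : Cb (n + 1)) : z ∈ bd (n + 1) ↔ z 0 = 0 ∨ z 0 = 1 ∨ tail z ∈ bd n := by
  constructor
  · rintro ⟨i, hi⟩
    induction i using Fin.cases with
    | zero => exact hi.imp id Or.inl
    | succ i => exact Or.inr (Or.inr ⟨i, hi⟩)
  · rintro (h | h | ⟨i, hi⟩)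
    · exact ⟨0, Or.inl h⟩
    · exact ⟨0, Or.inr h⟩
    · exact ⟨i.succ, hi⟩

theorem isClosed_bd (n : ℕ) : IsClosed (bd n) := by
  have : bd n = ⋃ i : Fin n, {y : Cb n | y i = 0} ∪ {y : Cb n | y i = 1} := by
    ext y; simp [Cube.boundary]
  rw [this]
  exact isClosed_iUnion_of_finite fun i ↦
    (isClosed_eq (continuous_apply i) continuous_const).union
      (isClosed_eq (continuous_apply i) continuous_const)

theorem bd_zero (x : Cb 0) : x ∉ bd 0 := fun ⟨i, _⟩ ↦ i.elim0

/-- The box in the cube `[0,1]^(n+1)`: the bottom face `z 0 = 0` and the side faces. -/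
def horn (n : ℕ) : Set (Cb (n + 1)) := {z | z 0 = 0 ∨ tail z ∈ bd n}

theorem horn_subset_bd : horn n ⊆ bd (n + 1) := fun z hz ↦
  (mem_bd_iff z).2 (hz.imp id Or.inr)

/-- The number `μ ∈ [1/2, 1]` for which the projection of `z` from the point `(2, 1/2, …, 1/2)`
to the box is dilation by `1/μ`. -/
def hornScale (z : Cb (n + 1)) : ℝ :=
  max ((2 - (z 0 : ℝ)) / 2) ‖fun i : Fin n ↦ 2 * (tail z i : ℝ) - 1‖

theorem continuous_hornScale : Continuous (hornScale : Cb (n + 1) → ℝ) := by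
  unfold hornScale
  refine Continuous.max (by fun_prop) (continuous_norm.comp (continuous_pi fun i ↦ ?_))
  have : Continuous fun z : Cb (n + 1) ↦ tail z i := (continuous_apply i).comp continuous_tail
  fun_prop

theorem half_le_hornScale (z : Cb (n + 1)) : 1 / 2 ≤ hornScale z :=
  le_max_of_le_left (by have := (z 0).2.2; linarith)

theorem abs_two_mul_sub_one_le (t : I) : |2 * (t : ℝ) - 1| ≤ 1 :=
  abs_le.2 ⟨by linarith [t.2.1], by linarith [t.2.2]⟩

theorem hornScale_le_one (z : Cb (n + 1)) : hornScale z ≤ 1 :=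
  max_le (by have := (z 0).2.1; linarith)
    ((pi_norm_le_iff_of_nonneg zero_le_one).2 fun i ↦ abs_two_mul_sub_one_le _)

theorem hornScale_of_mem {z : Cb (n + 1)} (hz : z ∈ horn n) : hornScale z = 1 := by
  refine le_antisymm (hornScale_le_one z) ?_
  rcases hz with h | ⟨i, hi⟩
  · exact le_max_of_le_left (by rw [h]; norm_num)
  · refine le_max_of_le_right (le_trans ?_
      (norm_le_pi_norm (fun i : Fin n ↦ 2 * (tail z i : ℝ) - 1) i))
    rcases hi with hi | hi <;> rw [hi] <;> norm_num

/-- The point of the segment through `z` and `(2, 1/2, …, 1/2)` at the time `t`, clipped to the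
cube. At time `0` it is on the box, at time `1 - μ` it is `z`. -/
def hornFlow (w : Cb (n + 1) × I) : Cb (n + 1) :=
  cons (Set.projIcc 0 1 zero_le_one (2 - (1 - (w.2 : ℝ)) / hornScale w.1 * (2 - (w.1 0 : ℝ))))
    fun i ↦ Set.projIcc 0 1 zero_le_one
      (1 / 2 + (1 - (w.2 : ℝ)) / hornScale w.1 * ((tail w.1 i : ℝ) - 1 / 2))

theorem continuous_hornFlow : Continuous (hornFlow : Cb (n + 1) × I → Cb (n + 1)) := by
  have h1 : Continuous fun w : Cb (n + 1) × I ↦ (1 - (w.2 : ℝ)) / hornScale w.1 :=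
    Continuous.div (by fun_prop) (continuous_hornScale.comp continuous_fst)
      fun w ↦ by have := half_le_hornScale w.1; linarith
  refine Continuous.cbCons (continuous_projIcc.comp (by fun_prop))
    (continuous_pi fun i ↦ continuous_projIcc.comp ?_)
  have : Continuous fun z : Cb (n + 1) ↦ tail z i := (continuous_apply i).comp continuous_tail
  fun_prop

theorem hornFlow_zero_mem (z : Cb (n + 1)) : hornFlow (z, 0) ∈ horn n := by
  have hμ := half_le_hornScale z
  have hμ' : hornScale z ≠ 0 := by linarith
  by_cases h : hornScale z = (2 - (z 0 : ℝ)) / 2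
  · left
    change Set.projIcc 0 1 zero_le_one _ = _
    refine Set.projIcc_of_le_left _ ?_
    have h2 : (2 - (z 0 : ℝ)) = 2 * hornScale z := by rw [h]; ring
    change 2 - (1 - ((0 : I) : ℝ)) / hornScale z * (2 - (z 0 : ℝ)) ≤ 0
    rw [h2]
    have : (1 - ((0 : I) : ℝ)) / hornScale z * (2 * hornScale z) = 2 := by
      push_cast; field_simp; norm_num
    linarith
  · right
    have h2 : hornScale z = ‖fun i : Fin n ↦ 2 * (tail z i : ℝ) - 1‖ := by
      rcases max_choice ((2 - (z 0 : ℝ)) / 2) ‖fun i : Fin n ↦ 2 * (tail z i : ℝ) - 1‖ with h3 | h3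
      · exact absurd h3 h
      · exact h3
    -- the supremum norm is attained at some coordinate
    obtain ⟨i, hi⟩ : ∃ i : Fin n, hornScale z ≤ |2 * (tail z i : ℝ) - 1| := by
      by_contra! hcon
      have hlt := (pi_norm_lt_iff (x := fun i : Fin n ↦ 2 * (tail z i : ℝ) - 1)
        (by linarith : 0 < hornScale z)).2 hcon
      linarith
    refine ⟨i, ?_⟩
    change Set.projIcc 0 1 zero_le_one (1 / 2 + (1 - ((0 : I) : ℝ)) / hornScale z *
      ((tail z i : ℝ) - 1 / 2)) = 0 ∨ Set.projIcc 0 1 zero_le_one (1 / 2 + (1 - ((0 : I) : ℝ)) /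
        hornScale z * ((tail z i : ℝ) - 1 / 2)) = 1
    have h3 : 1 / 2 + (1 - ((0 : I) : ℝ)) / hornScale z * ((tail z i : ℝ) - 1 / 2) =
        (1 + (2 * (tail z i : ℝ) - 1) / hornScale z) / 2 := by
      push_cast; field_simp; ring
    rw [h3]
    rcases le_abs.1 hi with h4 | h4
    · right
      refine Set.projIcc_of_right_le _ ?_
      have : 1 ≤ (2 * (tail z i : ℝ) - 1) / hornScale z := (one_le_div (by linarith)).2 h4
      linarith
    · left
      refine Set.projIcc_of_le_left _ ?_
      have : (2 * (tail z i : ℝ) - 1) / hornScale z ≤ -1 := by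
        rw [div_le_iff₀ (by linarith)]; linarith
      linarith

/-- The time at which `hornFlow` passes through `z`. -/
def hornTime (z : Cb (n + 1)) : I :=
  ⟨1 - hornScale z, by linarith [hornScale_le_one z], by linarith [half_le_hornScale z]⟩

theorem continuous_hornTime : Continuous (hornTime : Cb (n + 1) → I) :=
  Continuous.subtype_mk (continuous_const.sub continuous_hornScale) _

theorem hornTime_of_mem {z : Cb (n + 1)} (hz : z ∈ horn n) : hornTime z = 0 :=
  Subtype.ext (by simp [hornTime, hornScale_of_mem hz])

theorem hornFlow_hornTime (z : Cb (n + 1)) : hornFlow (z, hornTime z) = z := by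
  have hμ := half_le_hornScale z
  have h1 : (1 - (hornTime z : ℝ)) / hornScale z = 1 := by
    simp only [hornTime, sub_sub_cancel]
    exact div_self (by linarith)
  simp only [hornFlow, h1, one_mul, sub_sub_cancel, add_sub_cancel, Set.projIcc_val]
  exact cons_tail z

theorem isClosed_horn (n : ℕ) : IsClosed (horn n) :=
  (isClosed_eq (continuous_apply 0) continuous_const).union
    ((isClosed_bd n).preimage continuous_tail)

end Cb

open Cb

/-- Gluing of two maps on closed sets that agree on the intersection. -/
theorem exists_continuousOn_union {Z W : Type*} [TopologicalSpace Z] [TopologicalSpace W]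
    {S T : Set Z} (hS : IsClosed S) (hT : IsClosed T) {f g : Z → W}
    (hf : ContinuousOn f S) (hg : ContinuousOn g T) (h : ∀ z ∈ S, z ∈ T → f z = g z) :
    ∃ k : Z → W, ContinuousOn k (S ∪ T) ∧ (∀ z ∈ S, k z = f z) ∧ ∀ z ∈ T, k z = g z := by
  classical
  have hS' : ∀ z ∈ S, (if z ∈ S then f z else g z) = f z := fun z hz ↦ if_pos hz
  have hT' : ∀ z ∈ T, (if z ∈ S then f z else g z) = g z := fun z hz ↦ by
    by_cases hz' : z ∈ S
    · rw [if_pos hz', h z hz' hz]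
    · rw [if_neg hz']
  exact ⟨_, (hf.congr hS').union_of_isClosed (hg.congr hT') hS hT, hS', hT'⟩

variable {X Y Z : Type u} [TopologicalSpace X] [TopologicalSpace Y] [TopologicalSpace Z] {n m : ℕ}

/-- Serre fibrations have the right lifting property with respect to the inclusions of boxes. -/
theorem IsSerreFibration.fill {f : C(X, Y)} (hf : IsSerreFibration f) (a : Cb (n + 1) → X)
    (ha : ContinuousOn a (horn n)) (b : C(Cb (n + 1), Y)) (hab : ∀ z ∈ horn n, f (a z) = b z) :
    ∃ c : C(Cb (n + 1), X), (∀ z ∈ horn n, c z = a z) ∧ ∀ z, f (c z) = b z := by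
  have hcont : Continuous fun z : Cb (n + 1) ↦ a (hornFlow (z, 0)) :=
    ha.comp_continuous (continuous_hornFlow.comp (by fun_prop)) hornFlow_zero_mem
  obtain ⟨K, hK0, hK⟩ := hf (n + 1) ⟨_, hcont⟩ (b.comp ⟨hornFlow, continuous_hornFlow⟩)
    fun z ↦ (hab _ (hornFlow_zero_mem z)).symm
  refine ⟨⟨fun z ↦ K (z, hornTime z), K.continuous.comp
    (continuous_id.prodMk continuous_hornTime)⟩, fun z hz ↦ ?_, fun z ↦ ?_⟩
  · have h1 := hornFlow_hornTime z
    rw [hornTime_of_mem hz] at h1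
    change K (z, hornTime z) = _
    rw [hornTime_of_mem hz, hK0]
    exact congrArg a h1
  · change f (K _) = _
    rw [hK]
    exact congrArg b (hornFlow_hornTime z)

theorem isSerreFibration_of_subsingleton [Subsingleton Y] (f : C(X, Y)) : IsSerreFibration f :=
  fun _ g _ _ ↦ ⟨g.comp ⟨Prod.fst, continuous_fst⟩, fun _ ↦ rfl, fun _ ↦ Subsingleton.elim _ _⟩

/-- A map on a box extends to the cube. -/
theorem exists_horn_extension (a : Cb (n + 1) → X) (ha : ContinuousOn a (horn n)) :
    ∃ c : C(Cb (n + 1), X), ∀ z ∈ horn n, c z = a z := by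
  obtain ⟨c, hc, -⟩ := (isSerreFibration_of_subsingleton
    (ContinuousMap.const X PUnit.unit.{u + 1})).fill a ha (.const _ _) fun _ _ ↦ rfl
  exact ⟨c, hc⟩

/-- A map on the bottom of a cube and a map on its sides that agree on the common boundary extend
to the cube, over any map on the base of a Serre fibration. -/
theorem IsSerreFibration.fill_of_sides {f : C(X, Y)} (hf : IsSerreFibration f) (u : C(Cb n, X))
    (s : Cb (n + 1) → X) (hs : ContinuousOn s {z | tail z ∈ bd n})
    (hus : ∀ x ∈ bd n, s (cons 0 x) = u x) (b : C(Cb (n + 1), Y))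
    (hb0 : ∀ x, b (cons 0 x) = f (u x)) (hbs : ∀ t, ∀ x ∈ bd n, b (cons t x) = f (s (cons t x))) :
    ∃ c : C(Cb (n + 1), X), (∀ x, c (cons 0 x) = u x) ∧
      (∀ t, ∀ x ∈ bd n, c (cons t x) = s (cons t x)) ∧ ∀ z, f (c z) = b z := by
  have hcl0 : IsClosed {z : Cb (n + 1) | z 0 = 0} :=
    isClosed_eq (continuous_apply 0) continuous_const
  obtain ⟨k, hk, hk0, hks⟩ := exists_continuousOn_union hcl0
    ((isClosed_bd n).preimage continuous_tail)
    (f := fun z ↦ u (tail z)) (g := s) (by fun_prop) hs (fun z hz hz' ↦ by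
      conv_rhs => rw [← cons_tail z, show z 0 = 0 from hz]
      exact (hus _ hz').symm)
  obtain ⟨c, hc, hcb⟩ := hf.fill k hk b fun z hz ↦ by
    rcases hz with hz | hz
    · rw [hk0 _ hz]
      conv_rhs => rw [← cons_tail z, hz]
      exact (hb0 _).symm
    · rw [hks _ hz]
      have := hbs (z 0) (tail z) hz
      rw [cons_tail] at this
      exact this.symm
  exact ⟨c, fun x ↦ (hc _ (Or.inl rfl)).trans (hk0 _ rfl),
    fun t x hx ↦ (hc (cons t x) (Or.inr hx)).trans (hks (cons t x) hx), hcb⟩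

theorem exists_fill_of_sides (u : C(Cb n, X))
    (s : Cb (n + 1) → X) (hs : ContinuousOn s {z | tail z ∈ bd n})
    (hus : ∀ x ∈ bd n, s (cons 0 x) = u x) :
    ∃ c : C(Cb (n + 1), X), (∀ x, c (cons 0 x) = u x) ∧
      (∀ t, ∀ x ∈ bd n, c (cons t x) = s (cons t x)) := by
  obtain ⟨c, hc, hc', -⟩ := (isSerreFibration_of_subsingleton
    (ContinuousMap.const X PUnit.unit.{u + 1})).fill_of_sides u s hs hus (.const _ _)
    (fun _ ↦ rfl) fun _ _ _ ↦ rfl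
  exact ⟨c, hc, hc'⟩

/-- Homotopy relative to the boundary of the cube. -/
abbrev HRel (u v : C(Cb n, X)) : Prop := ContinuousMap.HomotopicRel u v (bd n)

theorem hRel_iff {u v : C(Cb n, X)} : HRel u v ↔ ∃ h : C(Cb (n + 1), X),
    (∀ x, h (cons 0 x) = u x) ∧ (∀ x, h (cons 1 x) = v x) ∧
      ∀ t, ∀ x ∈ bd n, h (cons t x) = u x := by
  constructor
  · rintro ⟨F⟩
    exact ⟨⟨fun z ↦ F (z 0, tail z), by fun_prop⟩, F.map_zero_left, F.map_one_left,
      fun t x hx ↦ F.eq_fst t hx⟩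
  · rintro ⟨h, h0, h1, h2⟩
    exact ⟨{ toFun := fun z ↦ h (cons z.1 z.2), map_zero_left := h0, map_one_left := h1,
             prop' := h2 }⟩

theorem HRel.comp {u v : C(Cb n, X)} (h : HRel u v) (f : C(X, Y)) : HRel (f.comp u) (f.comp v) :=
  ContinuousMap.HomotopicRel.comp_continuousMap h f

/-- The slice of a map on the cube at the first coordinate `t`. -/
def slice (H : C(Cb (n + 1), X)) (t : I) : C(Cb n, X) := ⟨fun x ↦ H (cons t x), by fun_prop⟩

@[simp] theorem slice_apply (H : C(Cb (n + 1), X)) (t : I) (x : Cb n) :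
    slice H t x = H (cons t x) := rfl

/-- Two maps on a cube that agree on the sides and are homotopic on the bottom are homotopic on the
top. -/
theorem HRel.slice_one {U V : C(Cb (n + 1), X)}
    (h : ∀ t, ∀ x ∈ bd n, U (cons t x) = V (cons t x)) (h0 : HRel (slice U 0) (slice V 0)) :
    HRel (slice U 1) (slice V 1) := by
  obtain ⟨A, hA0, hA1, hA⟩ := hRel_iff.1 h0
  have hclA : IsClosed {z : Cb (n + 2) | tail z 0 = 1} :=
    isClosed_eq (by unfold tail; fun_prop) continuous_const
  have hclB : IsClosed {z : Cb (n + 2) | tail z 0 = 0 ∨ tail (tail z) ∈ bd n} :=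
    (isClosed_eq (by unfold tail; fun_prop) continuous_const).union
      ((isClosed_bd n).preimage (by fun_prop))
  obtain ⟨k, hk, hkA, hkB⟩ := exists_continuousOn_union hclA hclB
    (f := fun z ↦ V (cons (z 0) (tail (tail z)))) (g := fun z ↦ U (cons (z 0) (tail (tail z))))
    (by fun_prop) (by fun_prop) (fun z hz hz' ↦ (h _ _ (hz'.resolve_left fun h ↦ by
      rw [show tail z 0 = 1 from hz] at h; exact one_ne_zero h)).symm)
  obtain ⟨c, hc0, hc⟩ := exists_fill_of_sides A k
    (hk.mono fun z hz ↦ by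
      rcases (mem_bd_iff _).1 hz with h | h | h
      · exact Or.inr (Or.inl h)
      · exact Or.inl h
      · exact Or.inr (Or.inr h)) (fun x hx ↦ by
      rcases (mem_bd_iff _).1 hx with h' | h' | h'
      · rw [hkB (cons 0 x) (Or.inl h'), ← cons_tail x, h']; exact (hA0 _).symm
      · rw [hkA (cons 0 x) h', ← cons_tail x, h']; exact (hA1 _).symm
      · rw [hkB (cons 0 x) (Or.inr h'), ← cons_tail x]; exact (hA _ _ h').symm)
  refine hRel_iff.2 ⟨slice c 1, fun x ↦ ?_, fun x ↦ ?_, fun t x hx ↦ ?_⟩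
  · exact (hc _ _ ((mem_bd_iff _).2 (Or.inl rfl))).trans (hkB (cons 1 (cons 0 x)) (Or.inl rfl))
  · exact (hc _ _ ((mem_bd_iff _).2 (Or.inr (Or.inl rfl)))).trans
      (hkA (cons 1 (cons 1 x)) rfl)
  · exact (hc _ _ ((mem_bd_iff (cons t x)).2 (Or.inr (Or.inr hx)))).trans
      (hkB (cons 1 (cons t x)) (Or.inr hx))

/-- Reversal of the first coordinate. -/
def flip (H : C(Cb (n + 1), X)) : C(Cb (n + 1), X) :=
  ⟨fun z ↦ H (cons (σ (z 0)) (tail z)), by fun_prop⟩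

@[simp] theorem flip_cons (H : C(Cb (n + 1), X)) (t : I) (x : Cb n) :
    flip H (cons t x) = H (cons (σ t) x) := rfl

theorem HRel.slice_zero {U V : C(Cb (n + 1), X)}
    (h : ∀ t, ∀ x ∈ bd n, U (cons t x) = V (cons t x)) (h1 : HRel (slice U 1) (slice V 1)) :
    HRel (slice U 0) (slice V 0) := by
  have e (W : C(Cb (n + 1), X)) : slice (flip W) 0 = slice W 1 :=
    ContinuousMap.ext fun x ↦ by simp
  have e' (W : C(Cb (n + 1), X)) : slice (flip W) 1 = slice W 0 :=
    ContinuousMap.ext fun x ↦ by simp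
  have := HRel.slice_one (U := flip U) (V := flip V) (fun t x hx ↦ h _ x hx) (by rwa [e, e])
  rwa [e', e'] at this

/-- The top of a cube can be changed within its homotopy class, without changing the rest of the
boundary. -/
theorem exists_slice_one_eq (H : C(Cb (n + 1), X)) {v : C(Cb n, X)} (hv : HRel (slice H 1) v) :
    ∃ H' : C(Cb (n + 1), X), (∀ z ∈ horn n, H' z = H z) ∧ ∀ x, H' (cons 1 x) = v x := by
  obtain ⟨h, h0, h1, h2⟩ := hRel_iff.1 hv
  have hclA : IsClosed {z : Cb (n + 2) | tail z 0 = 1} :=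
    isClosed_eq (by unfold tail; fun_prop) continuous_const
  have hclB : IsClosed {z : Cb (n + 2) | tail z ∈ horn n} :=
    (isClosed_horn n).preimage continuous_tail
  obtain ⟨k, hk, hkA, hkB⟩ := exists_continuousOn_union hclA hclB
    (f := fun z ↦ h (cons (z 0) (tail (tail z)))) (g := fun z ↦ H (tail z))
    (by fun_prop) (by fun_prop) (fun z hz hz' ↦ by
      have hz1 : tail z 0 = 1 := hz
      rw [h2 _ _ (hz'.resolve_left fun h ↦ by rw [hz1] at h; exact one_ne_zero h), slice_apply,
        ← hz1, cons_tail])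
  obtain ⟨c, hc0, hc⟩ := exists_fill_of_sides H k
    (hk.mono fun z hz ↦ by
      rcases (mem_bd_iff _).1 hz with h | h | h
      · exact Or.inr (Or.inl h)
      · exact Or.inl h
      · exact Or.inr (Or.inr h)) (fun x hx ↦ by
      rcases (mem_bd_iff _).1 hx with h' | h' | h'
      · exact hkB (cons 0 x) (Or.inl h')
      · rw [hkA (cons 0 x) h']
        exact (h0 (tail x)).trans (by rw [slice_apply, ← h', cons_tail])
      · exact hkB (cons 0 x) (Or.inr h'))
  exact ⟨slice c 1, fun z hz ↦ (hc _ _ (horn_subset_bd hz)).trans (hkB (cons 1 z) hz),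
    fun x ↦ ((hc _ _ ((mem_bd_iff _).2 (Or.inr (Or.inl rfl)))).trans
      (hkA (cons 1 (cons 1 x)) rfl)).trans (h1 x)⟩

end Cubes

/-! ### Weak homotopy equivalences through compression of cubes -/

section Compression

open unitInterval Cb

variable {X Y Z : Type u} [TopologicalSpace X] [TopologicalSpace Y] [TopologicalSpace Z]

/-- A map is compressible if every map from a cube to the target with a lift of its restriction
to the boundary is homotopic, relative to the boundary, to a map that lifts to the source. Maps on
the boundary are encoded as functions on the cube, so that the case of the cube of dimension `0`
has to be stated separately to cover an empty source. -/
structure Compressible (f : C(X, Y)) : Prop where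
  joined (y : Y) : ∃ x, Joined (f x) y
  exists_lift (n : ℕ) (a : Cb n → X) (b : C(Cb n, Y)) (ha : ContinuousOn a (bd n))
    (hab : ∀ z ∈ bd n, f (a z) = b z) :
    ∃ c : C(Cb n, X), (∀ z ∈ bd n, c z = a z) ∧ HRel (f.comp c) b

/-- The condition that a map is a weak homotopy equivalence, in terms of maps on cubes that are
constant on the boundary. -/
structure LoopEquiv (f : C(X, Y)) : Prop where
  joined (y : Y) : ∃ x, Joined (f x) y
  inj (n : ℕ) (x : X) (γ : C(Cb n, X)) (hγ : ∀ z ∈ bd n, γ z = x)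
    (h : HRel (.const _ (f x)) (f.comp γ)) : HRel (.const _ x) γ
  surj (n : ℕ) (x : X) (γ : C(Cb n, Y)) (hγ : ∀ z ∈ bd n, γ z = f x) :
    ∃ γ' : C(Cb n, X), (∀ z ∈ bd n, γ' z = x) ∧ HRel (f.comp γ') γ

theorem hRel_zero_iff {u v : C(Cb 0, X)} : HRel u v ↔ Joined (u default) (v default) := by
  constructor
  · rintro ⟨F⟩
    exact ⟨⟨⟨fun t ↦ F (t, default), by fun_prop⟩, F.map_zero_left _, F.map_one_left _⟩⟩
  · rintro ⟨p⟩
    refine hRel_iff.2 ⟨⟨fun z ↦ p (z 0), by fun_prop⟩, fun x ↦ ?_, fun x ↦ ?_,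
      fun t x hx ↦ (bd_zero x hx).elim⟩
    · rw [Subsingleton.elim x default]; exact p.source
    · rw [Subsingleton.elim x default]; exact p.target

theorem IsWeakHomotopyEquiv.loopEquiv {f : C(X, Y)} (hf : IsWeakHomotopyEquiv f) :
    LoopEquiv f := by
  have hj (y : Y) : ∃ x, Joined (f x) y := by
    obtain ⟨q, hq⟩ := hf.1.2 (Quotient.mk _ y)
    obtain ⟨x, rfl⟩ := Quotient.exists_rep q
    exact ⟨x, Quotient.exact hq⟩
  refine ⟨hj, fun n x γ hγ h ↦ ?_, fun n x γ hγ ↦ ?_⟩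
  · cases n with
    | zero =>
      rw [hRel_zero_iff] at h ⊢
      exact Quotient.exact (hf.1.1 (a₁ := Quotient.mk _ x) (a₂ := Quotient.mk _ (γ default))
        (Quotient.sound h))
    | succ n =>
      exact Quotient.exact ((hf.2 n x).1 (a₁ := Quotient.mk _ ⟨.const _ x, fun _ _ ↦ rfl⟩)
        (a₂ := Quotient.mk _ ⟨γ, hγ⟩) (Quotient.sound h))
  · cases n with
    | zero =>
      obtain ⟨x', hx'⟩ := hj (γ default)
      exact ⟨.const _ x', fun z hz ↦ (bd_zero z hz).elim, hRel_zero_iff.2 hx'⟩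
    | succ n =>
      obtain ⟨q, hq⟩ := (hf.2 n x).2 (Quotient.mk _ ⟨γ, hγ⟩)
      obtain ⟨γ', rfl⟩ := Quotient.exists_rep q
      exact ⟨γ'.1, γ'.2, Quotient.exact hq⟩

/-- Contraction of a map on the cube to its value at the vertex `0`. -/
theorem exists_contraction {n : ℕ} (u : C(Cb n, X)) : ∃ U : C(Cb (n + 1), X),
    slice U 0 = u ∧ slice U 1 = .const _ (u 0) := by
  refine ⟨⟨fun z ↦ u fun i ↦ σ (z 0) * tail z i, u.continuous.comp (continuous_pi fun i ↦ ?_)⟩,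
    ContinuousMap.ext fun x ↦ ?_, ContinuousMap.ext fun x ↦ ?_⟩
  · have : Continuous fun z : Cb (n + 1) ↦ tail z i := (continuous_apply i).comp continuous_tail
    fun_prop
  · change u (fun i ↦ σ 0 * x i) = u x
    simp
  · change u (fun i ↦ σ 1 * x i) = u 0
    simp [Pi.zero_def]

/-- Two maps on the cube that agree on the boundary can be moved simultaneously, in the same way on
the boundary, so that the first becomes constant. -/
theorem exists_fill_contraction {n : ℕ} (u : C(Cb n, X)) (f : C(X, Y)) (w : C(Cb n, Y))
    (h : ∀ z ∈ bd n, f (u z) = w z) : ∃ (U : C(Cb (n + 1), X)) (W : C(Cb (n + 1), Y)),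
      slice U 0 = u ∧ slice U 1 = .const _ (u 0) ∧ slice W 0 = w ∧
      ∀ t, ∀ x ∈ bd n, W (cons t x) = f (U (cons t x)) := by
  obtain ⟨U, hU0, hU1⟩ := exists_contraction u
  obtain ⟨W, hW0, hW⟩ := exists_fill_of_sides w (fun z ↦ f (U z)) (by fun_prop) fun x hx ↦ by
    rw [← h x hx, ← hU0]; rfl
  exact ⟨U, W, hU0, hU1, ContinuousMap.ext hW0, hW⟩

theorem LoopEquiv.hRel_of_comp {f : C(X, Y)} (hf : LoopEquiv f) {n : ℕ} {u v : C(Cb n, X)}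
    (huv : ∀ z ∈ bd n, u z = v z) (h : HRel (f.comp u) (f.comp v)) : HRel u v := by
  obtain ⟨U, V, hU0, hU1, hV0, hV⟩ := exists_fill_contraction u (.id X) v huv
  have h1 : HRel (f.comp (slice U 1)) (f.comp (slice V 1)) :=
    HRel.slice_one (U := f.comp U) (V := f.comp V) (fun t x hx ↦ by simp [hV t x hx])
      (by rwa [← hU0, ← hV0] at h)
  rw [hU1] at h1
  have h2 := hf.inj n (u 0) (slice V 1) (fun z hz ↦ by
    rw [slice_apply, hV 1 z hz, ← slice_apply U, hU1]; rfl) h1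
  rw [← hU1] at h2
  have h3 := HRel.slice_zero (fun t x hx ↦ (hV t x hx).symm) h2
  rwa [hU0, hV0] at h3

theorem LoopEquiv.exists_lift {f : C(X, Y)} (hf : LoopEquiv f) {n : ℕ} (u : C(Cb n, X))
    (w : C(Cb n, Y)) (h : ∀ z ∈ bd n, f (u z) = w z) :
    ∃ v : C(Cb n, X), (∀ z ∈ bd n, v z = u z) ∧ HRel (f.comp v) w := by
  obtain ⟨U, W, hU0, hU1, hW0, hW⟩ := exists_fill_contraction u f w h
  have hU1' (z : Cb n) : U (cons 1 z) = u 0 := DFunLike.congr_fun hU1 z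
  obtain ⟨γ, hγ, hγ'⟩ := hf.surj n (u 0) (slice W 1) fun z hz ↦ by
    rw [slice_apply, hW 1 z hz, hU1']
  obtain ⟨V, hV0, hV⟩ := exists_fill_of_sides γ (fun z ↦ flip U z) (by fun_prop) fun x hx ↦ by
    rw [hγ x hx, flip_cons, unitInterval.symm_zero, hU1']
  have e1 : slice (f.comp (flip V)) 1 = f.comp γ := ContinuousMap.ext fun x ↦ by
    simp [hV0]
  refine ⟨slice (flip V) 0, fun z hz ↦ ?_, ?_⟩
  · rw [slice_apply, flip_cons, hV _ z hz, flip_cons, symm_symm, ← hU0, slice_apply]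
  · have := HRel.slice_zero (U := f.comp (flip V)) (V := W) (fun t x hx ↦ by
      rw [hW t x hx, ContinuousMap.comp_apply, flip_cons, hV _ x hx, flip_cons, symm_symm])
      (by rwa [e1])
    rwa [hW0] at this

theorem LoopEquiv.compressible {f : C(X, Y)} (hf : LoopEquiv f) : Compressible f := by
  refine ⟨hf.joined, fun n a b ha hab ↦ ?_⟩
  cases n with
  | zero =>
    obtain ⟨x, hx⟩ := hf.joined (b default)
    exact ⟨.const _ x, fun z hz ↦ (bd_zero z hz).elim, hRel_zero_iff.2 hx⟩
  | succ n =>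
    -- extend `a` from the boundary to the cube, first on the box, and then correct the top
    obtain ⟨A, hA⟩ := exists_horn_extension a (ha.mono horn_subset_bd)
    let u : C(Cb n, X) := ⟨fun x ↦ a (cons 1 x), ha.comp_continuous (by fun_prop)
      fun x ↦ (mem_bd_iff _).2 (Or.inr (Or.inl rfl))⟩
    have hfu : f.comp u = slice b 1 := ContinuousMap.ext fun x ↦
      hab _ ((mem_bd_iff _).2 (Or.inr (Or.inl rfl)))
    have h1 : HRel (slice (f.comp A) 1) (slice b 1) :=
      HRel.slice_one (fun t x hx ↦ by
          rw [ContinuousMap.comp_apply, hA (cons t x) (Or.inr hx)]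
          exact hab _ (horn_subset_bd (Or.inr hx)))
        (by
          have : slice (f.comp A) 0 = slice b 0 := ContinuousMap.ext fun x ↦ by
            rw [slice_apply, ContinuousMap.comp_apply, hA (cons 0 x) (Or.inl rfl)]
            exact hab _ (horn_subset_bd (Or.inl rfl))
          rw [this]
          exact .refl _)
    rw [← hfu] at h1
    obtain ⟨A', hA', hA1⟩ := exists_slice_one_eq A (hf.hRel_of_comp (u := slice A 1) (v := u)
      (fun z hz ↦ hA (cons 1 z) (Or.inr hz)) h1)
    have hA'a : ∀ z ∈ bd (n + 1), A' z = a z := fun z hz ↦ by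
      rcases (mem_bd_iff z).1 hz with h | h | h
      · exact (hA' z (Or.inl h)).trans (hA z (Or.inl h))
      · rw [← cons_tail z, h]; exact hA1 _
      · exact (hA' z (Or.inr h)).trans (hA z (Or.inr h))
    obtain ⟨v, hv, hv'⟩ := hf.exists_lift A' b fun z hz ↦ by rw [hA'a z hz, hab z hz]
    exact ⟨v, fun z hz ↦ (hv z hz).trans (hA'a z hz), hv'⟩

theorem Compressible.loopEquiv {f : C(X, Y)} (hf : Compressible f) : LoopEquiv f := by
  refine ⟨hf.joined, fun n x γ hγ h ↦ ?_, fun n x γ hγ ↦ ?_⟩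
  · obtain ⟨h', h0, h1, h2⟩ := hRel_iff.1 h
    obtain ⟨k, hk, hk1, hkB⟩ := exists_continuousOn_union
      (isClosed_eq (continuous_apply 0) continuous_const : IsClosed {z : Cb (n + 1) | z 0 = 1})
      (isClosed_horn n) (f := fun z ↦ γ (tail z)) (g := fun _ ↦ x) (by fun_prop) (by fun_prop)
      (fun z hz hz' ↦ hγ _ (hz'.resolve_left fun h ↦ by
        rw [show z 0 = 1 from hz] at h; exact one_ne_zero h))
    obtain ⟨c, hc, -⟩ := hf.exists_lift (n + 1) k h' (hk.mono fun z hz ↦ by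
      rcases (mem_bd_iff z).1 hz with h | h | h
      · exact Or.inr (Or.inl h)
      · exact Or.inl h
      · exact Or.inr (Or.inr h)) fun z hz ↦ by
        rcases (mem_bd_iff z).1 hz with h | h | h
        · rw [hkB z (Or.inl h), ← cons_tail z, h, h0]; rfl
        · rw [hk1 z h, ← cons_tail z, h, h1]; rfl
        · rw [hkB z (Or.inr h), ← cons_tail z, h2 _ _ h]; rfl
    refine hRel_iff.2 ⟨c, fun z ↦ ?_, fun z ↦ ?_, fun t z hz ↦ ?_⟩
    · rw [hc _ (horn_subset_bd (Or.inl rfl)), hkB _ (Or.inl rfl)]; rfl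
    · rw [hc _ ((mem_bd_iff _).2 (Or.inr (Or.inl rfl))), hk1 (cons 1 z) rfl]; rfl
    · rw [hc (cons t z) (horn_subset_bd (Or.inr hz)), hkB (cons t z) (Or.inr hz)]; rfl
  · exact hf.exists_lift n (fun _ ↦ x) γ (by fun_prop) fun z hz ↦ (hγ z hz).symm

theorem LoopEquiv.isWeakHomotopyEquiv {f : C(X, Y)} (hf : LoopEquiv f) :
    IsWeakHomotopyEquiv f := by
  refine ⟨⟨fun p q h ↦ ?_, fun q ↦ ?_⟩, fun n x ↦ ⟨fun p q h ↦ ?_, fun q ↦ ?_⟩⟩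
  · obtain ⟨x, rfl⟩ := Quotient.exists_rep p
    obtain ⟨x', rfl⟩ := Quotient.exists_rep q
    have h' : Joined (f x) (f x') := Quotient.exact h
    exact Quotient.sound (hRel_zero_iff.1 (hf.hRel_of_comp (n := 0) (u := .const _ x)
      (v := .const _ x') (fun z hz ↦ (bd_zero z hz).elim) (hRel_zero_iff.2 h')))
  · obtain ⟨y, rfl⟩ := Quotient.exists_rep q
    obtain ⟨x, hx⟩ := hf.joined y
    exact ⟨Quotient.mk _ x, Quotient.sound hx⟩
  · obtain ⟨γ, rfl⟩ := Quotient.exists_rep p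
    obtain ⟨γ', rfl⟩ := Quotient.exists_rep q
    exact Quotient.sound (hf.hRel_of_comp (u := γ.1) (v := γ'.1)
      (fun z hz ↦ (γ.2 z hz).trans (γ'.2 z hz).symm) (Quotient.exact h))
  · obtain ⟨γ, rfl⟩ := Quotient.exists_rep q
    obtain ⟨γ', h1, h2⟩ := hf.surj _ x γ.1 γ.2
    exact ⟨Quotient.mk _ ⟨γ', h1⟩, Quotient.sound h2⟩

theorem isWeakHomotopyEquiv_iff_compressible {f : C(X, Y)} :
    IsWeakHomotopyEquiv f ↔ Compressible f :=
  ⟨fun h ↦ h.loopEquiv.compressible, fun h ↦ h.loopEquiv.isWeakHomotopyEquiv⟩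

end Compression

/-! ### Stability properties of weak homotopy equivalences and Serre fibrations -/

section Stability

open unitInterval Cb

variable {X Y Z : Type u} [TopologicalSpace X] [TopologicalSpace Y] [TopologicalSpace Z]

theorem Compressible.comp {f : C(X, Y)} {g : C(Y, Z)} (hf : Compressible f) (hg : Compressible g) :
    Compressible (g.comp f) := by
  refine ⟨fun z ↦ ?_, fun n a b ha hab ↦ ?_⟩
  · obtain ⟨y, hy⟩ := hg.joined z
    obtain ⟨x, hx⟩ := hf.joined y
    exact ⟨x, (hx.map g.continuous).trans hy⟩
  · obtain ⟨c, hc, hc'⟩ := hg.exists_lift n (fun z ↦ f (a z)) b (by fun_prop) hab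
    obtain ⟨d, hd, hd'⟩ := hf.exists_lift n a c ha fun z hz ↦ (hc z hz).symm
    exact ⟨d, hd, (hd'.comp g).trans hc'⟩

theorem Compressible.of_comp_right {f : C(X, Y)} {g : C(Y, Z)} (hg : Compressible g)
    (hgf : Compressible (g.comp f)) : Compressible f := by
  refine ⟨fun y ↦ ?_, fun n a b ha hab ↦ ?_⟩
  · obtain ⟨x, hx⟩ := hgf.joined (g y)
    have := hg.loopEquiv.hRel_of_comp (n := 0) (u := .const _ (f x)) (v := .const _ y)
      (fun z hz ↦ (bd_zero z hz).elim) (hRel_zero_iff.2 hx)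
    exact ⟨x, hRel_zero_iff.1 this⟩
  · obtain ⟨c, hc, hc'⟩ := hgf.exists_lift n a (g.comp b) ha fun z hz ↦ congrArg g (hab z hz)
    exact ⟨c, hc, hg.loopEquiv.hRel_of_comp (u := f.comp c)
      (fun z hz ↦ (congrArg f (hc z hz)).trans (hab z hz)) hc'⟩

theorem Compressible.of_comp_left {f : C(X, Y)} {g : C(Y, Z)} (hf : Compressible f)
    (hgf : Compressible (g.comp f)) : Compressible g := by
  have hfL := hf.loopEquiv
  have hgfL := hgf.loopEquiv
  -- a map on the cube that is constant on the boundary is transported along a path to a point in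
  -- the image of `f`
  refine LoopEquiv.compressible ⟨fun z ↦ ?_, fun n y γ hγ h ↦ ?_, fun n y γ hγ ↦ ?_⟩
  · obtain ⟨x, hx⟩ := hgf.joined z
    exact ⟨f x, hx⟩
  · obtain ⟨x, hx⟩ := hf.joined y
    obtain ⟨δ⟩ := hx.symm
    obtain ⟨H, hH0, hH⟩ := exists_fill_of_sides γ (fun z ↦ δ (z 0)) (by fun_prop) fun x hx ↦ by
      rw [hγ x hx, cons_zero, δ.source]
    let K : C(Cb (n + 1), Y) := ⟨fun z ↦ δ (z 0), by fun_prop⟩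
    have hK0 : slice K 0 = .const _ y := ContinuousMap.ext fun x ↦ δ.source
    have hK1 : slice K 1 = .const _ (f x) := ContinuousMap.ext fun x ↦ δ.target
    have hH0' : slice H 0 = γ := ContinuousMap.ext hH0
    have h1 : HRel (g.comp (slice K 1)) (g.comp (slice H 1)) :=
      HRel.slice_one (U := g.comp K) (V := g.comp H)
        (fun t x hx ↦ congrArg g (hH t x hx).symm) (by
          change HRel (g.comp (slice K 0)) (g.comp (slice H 0))
          rwa [hK0, hH0'])
    obtain ⟨γ', hγ', hγ''⟩ := hfL.surj n x (slice H 1) fun z hz ↦ by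
      rw [slice_apply, hH 1 z hz, cons_zero, δ.target]
    have h2 := hgfL.inj n x γ' hγ' (by
      rw [hK1] at h1
      exact h1.trans (hγ''.comp g).symm)
    have h3 : HRel (slice K 1) (slice H 1) := by
      rw [hK1]
      exact (h2.comp f).trans hγ''
    have h4 := HRel.slice_zero (fun t x hx ↦ (hH t x hx).symm) h3
    rwa [hK0, hH0'] at h4
  · obtain ⟨x, hx⟩ := hf.joined y
    obtain ⟨δ⟩ := hx.symm
    obtain ⟨H, hH0, hH⟩ := exists_fill_of_sides γ (fun z ↦ g (δ (z 0))) (by fun_prop)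
      fun x hx ↦ by rw [hγ x hx, cons_zero, δ.source]
    have hH0' : slice H 0 = γ := ContinuousMap.ext hH0
    obtain ⟨γ', hγ', hγ''⟩ := hgfL.surj n x (slice H 1) fun z hz ↦ by
      rw [slice_apply, hH 1 z hz, cons_zero, δ.target]; rfl
    obtain ⟨K, hK0, hK⟩ := exists_fill_of_sides (f.comp γ') (fun z ↦ δ (σ (z 0))) (by fun_prop)
      fun z hz ↦ by
        rw [cons_zero, unitInterval.symm_zero, δ.target, ContinuousMap.comp_apply, hγ' z hz]
    have hK' (t : I) (z : Cb n) (hz : z ∈ bd n) : flip K (cons t z) = δ t := by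
      rw [flip_cons, hK _ z hz, cons_zero, symm_symm]
    refine ⟨slice (flip K) 0, fun z hz ↦ by rw [slice_apply, hK' 0 z hz, δ.source], ?_⟩
    have h4 := HRel.slice_zero (U := g.comp (flip K)) (V := H)
      (fun t z hz ↦ by rw [hH t z hz, ContinuousMap.comp_apply, hK' t z hz]; rfl) (by
        have : slice (g.comp (flip K)) 1 = (g.comp f).comp γ' := ContinuousMap.ext fun z ↦ by
          simp [hK0]
        rwa [this])
    rwa [hH0'] at h4

/-- The inclusion of a strong deformation retract is compressible. -/
theorem Compressible.of_deformationRetract {j : C(X, Y)} (r : C(Y, X)) (hr : ∀ x, r (j x) = x)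
    (K : C(I × Y, Y)) (hK0 : ∀ y, K (0, y) = j (r y)) (hK1 : ∀ y, K (1, y) = y)
    (hK : ∀ t x, K (t, j x) = j x) : Compressible j := by
  refine ⟨fun y ↦ ⟨r y, ⟨⟨⟨fun t ↦ K (t, y), by fun_prop⟩, hK0 y, hK1 y⟩⟩⟩,
    fun n a b ha hab ↦ ⟨r.comp b, fun z hz ↦ ?_, ?_⟩⟩
  · rw [ContinuousMap.comp_apply, ← hab z hz, hr]
  · refine hRel_iff.2 ⟨⟨fun z ↦ K (z 0, b (tail z)), by fun_prop⟩, fun x ↦ hK0 _, fun x ↦ hK1 _,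
      fun t x hx ↦ ?_⟩
    change K (t, b x) = j (r (b x))
    rw [← hab x hx, hK, hr]

/-- Weak equivalences are stable under pullback along Serre fibrations. The pullback square is
expressed by maps out of cubes. -/
theorem Compressible.of_isPullback {P : Type u} [TopologicalSpace P] {w : C(X, Z)} {p : C(Y, Z)}
    (hw : Compressible w) (hp : IsSerreFibration p) (p' : C(P, X)) (w' : C(P, Y))
    (hcomm : ∀ q, w (p' q) = p (w' q))
    (hinj : ∀ q q', p' q = p' q' → w' q = w' q' → q = q')
    (hlift : ∀ (n : ℕ) (u : C(Cb n, X)) (v : C(Cb n, Y)), (∀ z, w (u z) = p (v z)) →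
      ∃ q : C(Cb n, P), (∀ z, p' (q z) = u z) ∧ ∀ z, w' (q z) = v z) : Compressible w' := by
  -- a homotopy in the base is lifted, starting from the given map on the cube
  have key (n : ℕ) (c : C(Cb n, X)) (b : C(Cb n, Y)) (h : HRel (w.comp c) (p.comp b)) :
      ∃ q : C(Cb n, P), (∀ z, p' (q z) = c z) ∧ (∀ z ∈ bd n, w' (q z) = b z) ∧
        HRel (w'.comp q) b := by
    obtain ⟨h', h0, h1, h2⟩ := hRel_iff.1 h.symm
    obtain ⟨K, hK0, hK, hpK⟩ := hp.fill_of_sides b (fun z ↦ b (tail z)) (by fun_prop)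
      (fun x hx ↦ rfl) h' h0 h2
    obtain ⟨q, hq, hq'⟩ := hlift n c (slice K 1) fun z ↦ by rw [slice_apply, hpK, h1]; rfl
    refine ⟨q, hq, fun z hz ↦ by rw [hq', slice_apply, hK 1 z hz]; rfl, ?_⟩
    have : w'.comp q = slice K 1 := ContinuousMap.ext hq'
    rw [this]
    exact ContinuousMap.HomotopicRel.symm (hRel_iff.2 ⟨K, hK0, fun x ↦ rfl, fun t x hx ↦ hK t x hx⟩)
  refine ⟨fun y ↦ ?_, fun n a b ha hab ↦ ?_⟩
  · obtain ⟨x, hx⟩ := hw.joined (p y)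
    obtain ⟨q, -, -, hq⟩ := key 0 (.const _ x) (.const _ y) (hRel_zero_iff.2 hx)
    exact ⟨_, hRel_zero_iff.1 hq⟩
  · obtain ⟨c, hc, hc'⟩ := hw.exists_lift n (fun z ↦ p' (a z)) (p.comp b) (by fun_prop)
      fun z hz ↦ by rw [hcomm, hab z hz]; rfl
    obtain ⟨q, hq, hq', hq''⟩ := key n c b hc'
    exact ⟨q, fun z hz ↦ hinj _ _ (by rw [hq, hc z hz]) (by rw [hq' z hz, hab z hz]), hq''⟩

/-- The right lifting property with respect to the inclusions of the boundaries of cubes. The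
boundary is encoded as in `Compressible`. -/
structure LiftsBoundary (f : C(X, Y)) : Prop where
  surjective : Function.Surjective f
  exists_lift (n : ℕ) (a : Cb n → X) (b : C(Cb n, Y)) (ha : ContinuousOn a (bd n))
    (hab : ∀ z ∈ bd n, f (a z) = b z) :
    ∃ c : C(Cb n, X), (∀ z ∈ bd n, c z = a z) ∧ ∀ z, f (c z) = b z

theorem LiftsBoundary.compressible {f : C(X, Y)} (hf : LiftsBoundary f) : Compressible f := by
  refine ⟨fun y ↦ ?_, fun n a b ha hab ↦ ?_⟩
  · obtain ⟨x, rfl⟩ := hf.surjective y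
    exact ⟨x, .refl _⟩
  · obtain ⟨c, hc, hc'⟩ := hf.exists_lift n a b ha hab
    refine ⟨c, hc, ?_⟩
    rw [show f.comp c = b from ContinuousMap.ext hc']
    exact .refl _

theorem IsSerreFibration.liftsBoundary {f : C(X, Y)} (hf : IsSerreFibration f)
    (hc : Compressible f) : LiftsBoundary f := by
  have key (n : ℕ) (c : C(Cb n, X)) (b : C(Cb n, Y)) (h : HRel (f.comp c) b) :
      ∃ d : C(Cb n, X), (∀ z ∈ bd n, d z = c z) ∧ ∀ z, f (d z) = b z := by
    obtain ⟨h', h0, h1, h2⟩ := hRel_iff.1 h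
    obtain ⟨K, hK0, hK, hfK⟩ := hf.fill_of_sides c (fun z ↦ c (tail z)) (by fun_prop)
      (fun x hx ↦ rfl) h' h0 h2
    exact ⟨slice K 1, fun z hz ↦ hK 1 z hz, fun z ↦ (hfK _).trans (h1 z)⟩
  refine ⟨fun y ↦ ?_, fun n a b ha hab ↦ ?_⟩
  · obtain ⟨x, hx⟩ := hc.joined y
    obtain ⟨d, -, hd⟩ := key 0 (.const _ x) (.const _ y) (hRel_zero_iff.2 hx)
    exact ⟨d default, hd _⟩
  · obtain ⟨c, hc, hc'⟩ := hc.exists_lift n a b ha hab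
    obtain ⟨d, hd, hd'⟩ := key n c b hc'
    exact ⟨d, fun z hz ↦ (hd z hz).trans (hc z hz), hd'⟩

/-- The middle part of a cube, over which the box is flat. -/
def cylinderIncl {n : ℕ} (w : Cb n × I) : Cb (n + 1) :=
  cons w.2 fun i ↦ Set.projIcc 0 1 zero_le_one ((w.1 i : ℝ) / 2 + 1 / 4)

/-- A retraction of `cylinderIncl` that sends the box to the bottom. -/
def cylinderRetr {n : ℕ} (z : Cb (n + 1)) : Cb n × I :=
  (fun i ↦ Set.projIcc 0 1 zero_le_one (2 * (tail z i : ℝ) - 1 / 2),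
    z 0 * ∏ i, (Set.projIcc (0 : ℝ) 1 zero_le_one (4 * (tail z i : ℝ)) *
      Set.projIcc (0 : ℝ) 1 zero_le_one (4 * (1 - (tail z i : ℝ)))))

theorem continuous_cylinderIncl {n : ℕ} : Continuous (cylinderIncl : Cb n × I → Cb (n + 1)) :=
  continuous_snd.cbCons (continuous_pi fun i ↦ continuous_projIcc.comp (by fun_prop))

theorem continuous_cylinderRetr {n : ℕ} : Continuous (cylinderRetr : Cb (n + 1) → Cb n × I) := by
  have (i : Fin n) : Continuous fun z : Cb (n + 1) ↦ tail z i :=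
    (continuous_apply i).comp continuous_tail
  refine (continuous_pi fun i ↦ continuous_projIcc.comp (by fun_prop)).prodMk
    ((continuous_apply 0).mul (continuous_finsetProd _ fun i _ ↦
      (continuous_projIcc.comp ?_).mul (continuous_projIcc.comp ?_)))
  · fun_prop
  · fun_prop

theorem cylinderRetr_cylinderIncl {n : ℕ} (w : Cb n × I) :
    cylinderRetr (cylinderIncl w) = w := by
  have h (i : Fin n) : (tail (cylinderIncl w) i : ℝ) = (w.1 i : ℝ) / 2 + 1 / 4 := by
    have := Set.projIcc_of_mem (zero_le_one : (0 : ℝ) ≤ 1) (x := (w.1 i : ℝ) / 2 + 1 / 4)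
      ⟨by linarith [(w.1 i).2.1], by linarith [(w.1 i).2.2]⟩
    exact congrArg Subtype.val this
  refine Prod.ext (funext fun i ↦ ?_) ?_
  · change Set.projIcc 0 1 zero_le_one (2 * (tail (cylinderIncl w) i : ℝ) - 1 / 2) = _
    rw [h, show 2 * ((w.1 i : ℝ) / 2 + 1 / 4) - 1 / 2 = w.1 i by ring, Set.projIcc_val]
  · change w.2 * ∏ i, _ = w.2
    rw [Finset.prod_eq_one, mul_one]
    intro i _
    rw [h, Set.projIcc_of_right_le _ (by linarith [(w.1 i).2.1]),
      Set.projIcc_of_right_le _ (by linarith [(w.1 i).2.2])]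
    exact mul_one _

theorem cylinderRetr_snd_of_mem {n : ℕ} {z : Cb (n + 1)} (hz : z ∈ horn n) :
    (cylinderRetr z).2 = 0 := by
  change z 0 * ∏ i, _ = (0 : I)
  rcases hz with h | ⟨i, h | h⟩
  · rw [h, zero_mul]
  · rw [Finset.prod_eq_zero (Finset.mem_univ i), mul_zero]
    rw [h, Set.projIcc_of_le_left _ (by simp)]
    exact zero_mul _
  · rw [Finset.prod_eq_zero (Finset.mem_univ i), mul_zero]
    rw [h, Set.projIcc_of_le_left (x := 4 * (1 - ((1 : I) : ℝ))) _ (by simp)]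
    exact mul_zero _

theorem LiftsBoundary.isSerreFibration {f : C(X, Y)} (hf : LiftsBoundary f) :
    IsSerreFibration f := by
  intro n g H hgH
  let a : Cb (n + 1) → X := fun z ↦ g (cylinderRetr z).1
  have ha : Continuous a := g.continuous.comp (continuous_fst.comp continuous_cylinderRetr)
  let b : C(Cb (n + 1), Y) := ⟨fun z ↦ H (cylinderRetr z), H.continuous.comp
    continuous_cylinderRetr⟩
  have hab : ∀ z ∈ horn n, f (a z) = b z := fun z hz ↦ by
    change f (g (cylinderRetr z).1) = H ((cylinderRetr z).1, (cylinderRetr z).2)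
    rw [cylinderRetr_snd_of_mem hz, hgH]
  -- the lift is found on the top of the cube first
  obtain ⟨d, hd, hd'⟩ := hf.exists_lift n (fun x ↦ a (cons 1 x)) (slice b 1) (by fun_prop)
    fun x hx ↦ hab (cons 1 x) (Or.inr hx)
  obtain ⟨k, hk, hk1, hkB⟩ := exists_continuousOn_union
    (isClosed_eq (continuous_apply 0) continuous_const : IsClosed {z : Cb (n + 1) | z 0 = 1})
    (isClosed_horn n) (f := fun z ↦ d (tail z)) (g := a) (by fun_prop) ha.continuousOn
    (fun z hz hz' ↦ by
      rw [hd _ (hz'.resolve_left fun h ↦ by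
        rw [show z 0 = 1 from hz] at h; exact one_ne_zero h), ← show z 0 = 1 from hz, cons_tail])
  obtain ⟨c, hc, hc'⟩ := hf.exists_lift (n + 1) k b (hk.mono fun z hz ↦ by
      rcases (mem_bd_iff z).1 hz with h | h | h
      · exact Or.inr (Or.inl h)
      · exact Or.inl h
      · exact Or.inr (Or.inr h)) fun z hz ↦ by
        rcases (mem_bd_iff z).1 hz with h | h | h
        · rw [hkB z (Or.inl h), hab z (Or.inl h)]
        · rw [hk1 z h, hd', slice_apply, ← h, cons_tail]
        · rw [hkB z (Or.inr h), hab z (Or.inr h)]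
  refine ⟨⟨fun w ↦ c (cylinderIncl w), c.continuous.comp continuous_cylinderIncl⟩, fun x ↦ ?_,
    fun w ↦ ?_⟩
  · change c (cylinderIncl (x, 0)) = _
    rw [hc _ (horn_subset_bd (Or.inl rfl)), hkB (cylinderIncl (x, 0)) (Or.inl rfl)]
    change g (cylinderRetr (cylinderIncl (x, 0))).1 = _
    rw [cylinderRetr_cylinderIncl]
  · change f (c (cylinderIncl w)) = _
    rw [hc']
    exact congrArg H (cylinderRetr_cylinderIncl w)

theorem liftsBoundary_iff {f : C(X, Y)} :
    LiftsBoundary f ↔ IsSerreFibration f ∧ IsWeakHomotopyEquiv f :=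
  ⟨fun h ↦ ⟨h.isSerreFibration, isWeakHomotopyEquiv_iff_compressible.2 h.compressible⟩,
    fun h ↦ h.1.liftsBoundary (isWeakHomotopyEquiv_iff_compressible.1 h.2)⟩

end Stability

/-! ### Cells and lifting properties -/

section Lifting

open unitInterval Cb

/-- Every map from `S` with an extension to `D` of its image under `f` extends to `D`, compatibly
with `f`: the lifting property of `i : S → D` against `f`. -/
def HasTopLift {S D X Y : Type u} [TopologicalSpace S] [TopologicalSpace D] [TopologicalSpace X]
    [TopologicalSpace Y] (i : C(S, D)) (f : C(X, Y)) : Prop :=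
  ∀ (a : C(S, X)) (b : C(D, Y)), (∀ s, f (a s) = b (i s)) →
    ∃ c : C(D, X), (∀ s, c (i s) = a s) ∧ ∀ d, f (c d) = b d

/-- The disk is homeomorphic to the cube, by a homeomorphism that respects the boundaries. -/
theorem exists_homeomorph_disk (n : ℕ) :
    ∃ e : Cb n ≃ₜ TopCat.disk.{u} n, ∀ z, z ∈ bd n ↔ ‖(e z).down.1‖ = 1 := by
  let L := EuclideanSpace.equiv (Fin n) ℝ
  let s : Set (Fin n → ℝ) := Set.pi Set.univ fun _ ↦ Set.Icc 0 1
  have hs : IsClosed s := isClosed_set_pi fun _ _ ↦ isClosed_Icc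
  have hint : interior s = Set.pi Set.univ fun _ ↦ Set.Ioo 0 1 := by
    rw [interior_pi_set Set.finite_univ]
    simp only [interior_Icc]
  have hconv : Convex ℝ (L ⁻¹' s) :=
    (convex_pi fun _ _ ↦ convex_Icc 0 1).linear_preimage L.toLinearEquiv.toLinearMap
  have hne : (interior (L ⁻¹' s)).Nonempty := by
    have h0 : interior (L ⁻¹' s) = L ⁻¹' interior s :=
      (L.toHomeomorph.preimage_interior s).symm
    rw [h0, hint]
    refine ⟨L.symm fun _ ↦ 1 / 2, fun i _ ↦ ?_⟩
    change L (L.symm fun _ ↦ (1 / 2 : ℝ)) i ∈ _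
    rw [L.apply_symm_apply]
    norm_num
  have hbdd : Bornology.IsBounded (L ⁻¹' s) := by
    have h1 : IsCompact s := isCompact_univ_pi fun _ ↦ isCompact_Icc
    have h2 : IsCompact (L.symm '' s) := h1.image L.symm.continuous
    rw [ContinuousLinearEquiv.image_symm_eq_preimage] at h2
    exact h2.isBounded
  obtain ⟨h, -, h1, h2⟩ :=
    exists_homeomorph_image_interior_closure_frontier_eq_unitBall hconv hne hbdd
  have hcl : closure (L ⁻¹' s) = L ⁻¹' s := (hs.preimage L.continuous).closure_eq
  have hfr : frontier (L ⁻¹' s) = L ⁻¹' (s \ Set.pi Set.univ fun _ ↦ Set.Ioo 0 1) := by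
    rw [← hint, ← hs.frontier_eq]
    exact (L.toHomeomorph.preimage_frontier s).symm
  rw [hcl] at h1
  rw [hfr] at h2
  have hmem (v : EuclideanSpace ℝ (Fin n)) : v ∈ L ⁻¹' s ↔ h v ∈ Metric.closedBall 0 1 := by
    rw [← h1, h.injective.mem_set_image]
  let v (z : Cb n) : EuclideanSpace ℝ (Fin n) := L.symm fun i ↦ (z i : ℝ)
  have hLv (z : Cb n) (i : Fin n) : L (v z) i = z i :=
    congrFun (L.apply_symm_apply fun i ↦ (z i : ℝ)) i
  have hv (z : Cb n) : v z ∈ L ⁻¹' s := fun i _ ↦ by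
    rw [hLv]; exact (z i).2
  have hw (d : TopCat.disk.{u} n) : h.symm d.down.1 ∈ L ⁻¹' s := by
    rw [hmem, h.apply_symm_apply]; exact d.down.2
  let e : Cb n ≃ₜ TopCat.disk.{u} n :=
    { toFun z := ⟨⟨h (v z), (hmem _).1 (hv z)⟩⟩
      invFun d := fun i ↦ ⟨L (h.symm d.down.1) i, hw d i trivial⟩
      left_inv z := funext fun i ↦ Subtype.ext (by
        change L (h.symm (h (v z))) i = _
        rw [h.symm_apply_apply, hLv])
      right_inv d := ULift.ext _ _ (Subtype.ext (by
        change h (L.symm (L (h.symm d.down.1))) = _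
        rw [L.symm_apply_apply, h.apply_symm_apply]))
      continuous_toFun := by
        refine continuous_uliftUp.comp (Continuous.subtype_mk (h.continuous.comp
          (L.symm.continuous.comp (continuous_pi fun i ↦ ?_))) _)
        fun_prop
      continuous_invFun := continuous_pi fun i ↦ Continuous.subtype_mk
        ((continuous_apply i).comp (L.continuous.comp (h.symm.continuous.comp
          (continuous_subtype_val.comp continuous_uliftDown)))) _ }
  refine ⟨e, fun z ↦ ?_⟩
  have h3 : ‖(e z).down.1‖ = 1 ↔ v z ∈ L ⁻¹' (s \ Set.pi Set.univ fun _ ↦ Set.Ioo 0 1) := by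
    rw [← mem_sphere_zero_iff_norm, ← h2]
    exact h.injective.mem_set_image
  rw [h3]
  constructor
  · rintro ⟨i, hi⟩
    refine ⟨hv z, fun hcon ↦ ?_⟩
    have := hcon i trivial
    rw [hLv] at this
    rcases hi with hi | hi <;> rw [hi] at this
    · exact lt_irrefl _ this.1
    · exact lt_irrefl _ this.2
  · rintro ⟨-, h4⟩
    by_contra hcon
    refine h4 fun i _ ↦ ?_
    rw [hLv]
    have h5 : ¬ (z i = 0 ∨ z i = 1) := fun h ↦ hcon ⟨i, h⟩
    push Not at h5
    exact ⟨unitInterval.pos_iff_ne_zero.2 h5.1, unitInterval.lt_one_iff_ne_one.2 h5.2⟩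

variable {X Y : Type u} [TopologicalSpace X] [TopologicalSpace Y]

theorem norm_sphere {n : ℕ} (s : TopCat.diskBoundary.{u} n) : ‖s.down.1‖ = 1 :=
  mem_sphere_zero_iff_norm.1 s.down.2

theorem exists_homeomorph_disk_sphere (n : ℕ) :
    ∃ (e : Cb n ≃ₜ TopCat.disk.{u} n) (β : C(bd n, TopCat.diskBoundary.{u} n)),
      (∀ z, sphereInclusion n (β z) = e z) ∧ ∀ s, ∃ h : e.symm (sphereInclusion n s) ∈ bd n,
        β ⟨_, h⟩ = s := by
  obtain ⟨e, he⟩ := exists_homeomorph_disk.{u} n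
  let g : bd n → EuclideanSpace ℝ (Fin n) := fun z ↦ (e z.1).down.1
  have hg : Continuous g := continuous_subtype_val.comp (continuous_uliftDown.comp
    (e.continuous.comp continuous_subtype_val))
  have hg' (z : bd n) : g z ∈ Metric.sphere (0 : EuclideanSpace ℝ (Fin n)) 1 :=
    mem_sphere_zero_iff_norm.2 ((he z.1).1 z.2)
  have hc : Continuous fun z ↦ ULift.up.{u} (⟨g z, hg' z⟩ : Metric.sphere _ _) :=
    continuous_uliftUp.comp (hg.subtype_mk hg')
  refine ⟨e, ⟨_, hc⟩, fun z ↦ rfl, fun s ↦ ?_⟩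
  have h0 := e.apply_symm_apply (sphereInclusion n s)
  have hs : e.symm (sphereInclusion n s) ∈ bd n := by
    rw [he, h0]
    exact norm_sphere s
  refine ⟨hs, ULift.ext _ _ (Subtype.ext ?_)⟩
  exact congrArg (fun d : TopCat.disk.{u} n ↦ d.down.1) h0

theorem liftsBoundary_iff_hasTopLift {f : C(X, Y)} :
    LiftsBoundary f ↔ ∀ n, HasTopLift (sphereInclusion.{u} n) f := by
  constructor
  · intro hf n a b hab
    obtain ⟨e, β, hβ, hβ'⟩ := exists_homeomorph_disk_sphere.{u} n
    classical
    obtain ⟨x₀, -⟩ := hf.surjective (b (e 0))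
    let a' : Cb n → X := fun z ↦ if h : z ∈ bd n then a (β ⟨z, h⟩) else x₀
    have ha' (z : Cb n) (h : z ∈ bd n) : a' z = a (β ⟨z, h⟩) := dif_pos h
    have hcont : ContinuousOn a' (bd n) := by
      rw [continuousOn_iff_continuous_domRestrict]
      have : (bd n).domRestrict a' = fun z ↦ a (β z) := funext fun z ↦ ha' z.1 z.2
      rw [this]
      fun_prop
    obtain ⟨c, hc, hc'⟩ := hf.exists_lift n a' (b.comp ⟨e, e.continuous⟩) hcont fun z hz ↦ by
      rw [ha' z hz, hab, hβ]
      rfl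
    refine ⟨c.comp ⟨e.symm, e.symm.continuous⟩, fun s ↦ ?_, fun d ↦ ?_⟩
    · obtain ⟨hs, hs'⟩ := hβ' s
      exact (hc _ hs).trans ((ha' _ hs).trans (congrArg a hs'))
    · exact (hc' _).trans (congrArg b (e.apply_symm_apply d))
  · intro hf
    have key (n : ℕ) (a : C(TopCat.diskBoundary.{u} n, X)) (e : Cb n ≃ₜ TopCat.disk.{u} n)
        (b : C(Cb n, Y)) (hab : ∀ s, f (a s) = b (e.symm (sphereInclusion n s))) :
        ∃ c : C(Cb n, X), (∀ s, c (e.symm (sphereInclusion n s)) = a s) ∧ ∀ z, f (c z) = b z := by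
      obtain ⟨c, hc, hc'⟩ := hf n a (b.comp ⟨e.symm, e.symm.continuous⟩) hab
      refine ⟨c.comp ⟨e, e.continuous⟩, fun s ↦ ?_, fun z ↦ ?_⟩
      · rw [← hc s]
        exact congrArg c (e.apply_symm_apply _)
      · exact (hc' (e z)).trans (congrArg b (e.symm_apply_apply z))
    refine ⟨fun y ↦ ?_, fun n a b ha hab ↦ ?_⟩
    · have : IsEmpty (TopCat.diskBoundary.{u} 0) := ⟨fun x ↦ by
        have h1 := mem_sphere_zero_iff_norm.1 x.down.2
        rw [Subsingleton.elim x.down.1 0, norm_zero] at h1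
        exact zero_ne_one h1⟩
      obtain ⟨e, he⟩ := exists_homeomorph_disk.{u} 0
      obtain ⟨c, -, hc⟩ := key 0 ⟨isEmptyElim, by fun_prop⟩ e (.const _ y) isEmptyElim
      exact ⟨c default, hc _⟩
    · obtain ⟨e, β, hβ, hβ'⟩ := exists_homeomorph_disk_sphere.{u} n
      obtain ⟨c, hc, hc'⟩ := key n ⟨fun s ↦ a (e.symm (sphereInclusion n s)),
        ha.comp_continuous (e.symm.continuous.comp (sphereInclusion n).continuous)
          fun s ↦ (hβ' s).1⟩ e b fun s ↦ hab _ (hβ' s).1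
      refine ⟨c, fun z hz ↦ ?_, hc'⟩
      have h1 := hc (β ⟨z, hz⟩)
      have e1 : e.symm (sphereInclusion n (β ⟨z, hz⟩)) = z := by
        rw [hβ, e.symm_apply_apply]
      exact (congrArg c e1).symm.trans (h1.trans (congrArg a e1))

/-- The inclusion of the bottom of the cylinder on a cube. -/
def cylinderBottom (n : ℕ) : C(ULift.{u} (Cb n), ULift.{u} (Cb n × I)) :=
  ⟨fun x ↦ ⟨(x.down, 0)⟩, by fun_prop⟩

theorem isSerreFibration_iff_hasTopLift {f : C(X, Y)} :
    IsSerreFibration f ↔ ∀ n, HasTopLift (cylinderBottom.{u} n) f := by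
  constructor
  · intro hf n a b hab
    obtain ⟨K, hK0, hK⟩ := hf n ⟨fun x ↦ a ⟨x⟩, by fun_prop⟩ ⟨fun z ↦ b ⟨z⟩, by fun_prop⟩
      fun x ↦ (hab ⟨x⟩).symm
    exact ⟨⟨fun z ↦ K z.down, by fun_prop⟩, fun s ↦ hK0 s.down, fun d ↦ hK d.down⟩
  · intro hf n g H hgH
    obtain ⟨c, hc, hc'⟩ := hf n ⟨fun x ↦ g x.down, by fun_prop⟩ ⟨fun z ↦ H z.down, by fun_prop⟩
      fun s ↦ (hgH s.down).symm
    exact ⟨⟨fun z ↦ c ⟨z⟩, by fun_prop⟩, fun t ↦ hc ⟨t⟩, fun z ↦ hc' ⟨z⟩⟩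

end Lifting

section Cells

open unitInterval Cb

variable {ν : Ordinal.{u}} [Fact (Cardinal.aleph0 ≤ ν.card)] {A : NuAlg ν}

/-- Pointed maps out of `Z₊` are maps out of `Z`. -/
def ptMapPlusEquiv (Z : Type u) [TopologicalSpace Z] [CompactSpace Z] [T2Space Z] (W : Type u)
    [TopologicalSpace W] [Zero W] : PtMap (PtCpt.plus Z) W ≃ C(Z, W) where
  toFun f := f.1.comp ⟨Sum.inl, continuous_inl⟩
  invFun g := ⟨⟨Sum.elim g fun _ ↦ 0, g.continuous.sumElim continuous_const⟩, rfl⟩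
  left_inv f := Subtype.ext (ContinuousMap.ext fun z ↦ by
    rcases z with z | z
    · rfl
    · exact f.2.symm)
  right_inv _ := rfl

/-- Morphisms out of `A ∧̂ Z₊` are maps from `Z` to `Hom(A, –)`. -/
def cellEquiv (h₁ : PartialLeftAdjoint (hatSmash A) A) (Z : Type u) [TopologicalSpace Z]
    [CompactSpace Z] [T2Space Z] (B : NuAlg ν) :
    ((hatSmash A).obj (PtCpt.plus Z) ⟶ B) ≃ C(Z, A ⟶ B) :=
  (h₁.homEquiv (PtCpt.plus Z) B).trans (ptMapPlusEquiv Z (A ⟶ B))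

theorem cellEquiv_comp (h₁ : PartialLeftAdjoint (hatSmash A) A) {Z : Type u} [TopologicalSpace Z]
    [CompactSpace Z] [T2Space Z] {B D : NuAlg ν} (f : (hatSmash A).obj (PtCpt.plus Z) ⟶ B)
    (g : B ⟶ D) (z : Z) :
    cellEquiv h₁ Z D (f ≫ g) z = A.homMap g (cellEquiv h₁ Z B f z) :=
  h₁.naturality_right f g (Sum.inl z)

theorem cellEquiv_map_comp (h₁ : PartialLeftAdjoint (hatSmash A) A) {Z W : Type u}
    [TopologicalSpace Z] [CompactSpace Z] [T2Space Z] [TopologicalSpace W] [CompactSpace W]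
    [T2Space W] {B : NuAlg ν} (i : C(Z, W)) (f : (hatSmash A).obj (PtCpt.plus W) ⟶ B) (z : Z) :
    cellEquiv h₁ Z B ((hatSmash A).map (PtCpt.plusMap i) ≫ f) z = cellEquiv h₁ W B f (i z) :=
  h₁.naturality_left (PtCpt.plusMap i) f (Sum.inl z)

theorem hasLiftingProperty_iff (h₁ : PartialLeftAdjoint (hatSmash A) A) {Z W : Type u}
    [TopologicalSpace Z] [CompactSpace Z] [T2Space Z] [TopologicalSpace W] [CompactSpace W]
    [T2Space W] (i : C(Z, W)) {B D : NuAlg ν} (f : B ⟶ D) :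
    HasLiftingProperty ((hatSmash A).map (PtCpt.plusMap i)) f ↔ HasTopLift i (A.homMap f) := by
  constructor
  · intro h a b hab
    have sq : CommSq ((cellEquiv h₁ Z B).symm a) ((hatSmash A).map (PtCpt.plusMap i)) f
        ((cellEquiv h₁ W D).symm b) := ⟨(cellEquiv h₁ Z D).injective (ContinuousMap.ext fun z ↦ by
      rw [cellEquiv_comp, cellEquiv_map_comp, Equiv.apply_symm_apply, Equiv.apply_symm_apply,
        hab])⟩
    refine ⟨cellEquiv h₁ W B sq.lift, fun z ↦ ?_, fun w ↦ ?_⟩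
    · rw [← cellEquiv_map_comp, sq.fac_left, Equiv.apply_symm_apply]
    · rw [← cellEquiv_comp, sq.fac_right, Equiv.apply_symm_apply]
  · intro h
    refine ⟨fun {a b} sq ↦ ?_⟩
    obtain ⟨c, hc, hc'⟩ := h (cellEquiv h₁ Z B a) (cellEquiv h₁ W D b) fun z ↦ by
      rw [← cellEquiv_comp, sq.w, cellEquiv_map_comp]
    refine ⟨⟨⟨(cellEquiv h₁ W B).symm c, ?_, ?_⟩⟩⟩
    · refine (cellEquiv h₁ Z B).injective (ContinuousMap.ext fun z ↦ ?_)
      rw [cellEquiv_map_comp, Equiv.apply_symm_apply, hc]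
    · refine (cellEquiv h₁ W D).injective (ContinuousMap.ext fun w ↦ ?_)
      rw [cellEquiv_comp, Equiv.apply_symm_apply, hc']

variable (A) in
/-- The class of the morphisms `A ∧̂ (I^n₊ → (I^n × I)₊)`. -/
def generatingTrivialCells : MorphismProperty (NuAlg ν) :=
  MorphismProperty.ofHoms fun n : ℕ ↦ (hatSmash A).map (PtCpt.plusMap (cylinderBottom.{u} n))

theorem generatingTrivialCells_rlp_iff (h₁ : PartialLeftAdjoint (hatSmash A) A) {B D : NuAlg ν}
    (f : B ⟶ D) : (generatingTrivialCells A).rlp f ↔ IsSerreFibration (A.homMap f) := by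
  rw [isSerreFibration_iff_hasTopLift]
  constructor
  · exact fun h n ↦ (hasLiftingProperty_iff h₁ _ f).1 (h _ (MorphismProperty.ofHoms.mk n))
  · rintro h _ _ _ ⟨n⟩
    exact (hasLiftingProperty_iff h₁ _ f).2 (h n)

theorem generatingCells_rlp_iff (h₁ : PartialLeftAdjoint (hatSmash A) A) {B D : NuAlg ν}
    (f : B ⟶ D) : (generatingCells A).rlp f ↔
      IsSerreFibration (A.homMap f) ∧ IsWeakHomotopyEquiv (A.homMap f) := by
  rw [← liftsBoundary_iff, liftsBoundary_iff_hasTopLift]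
  constructor
  · exact fun h n ↦ (hasLiftingProperty_iff h₁ _ f).1 (h _ (MorphismProperty.ofHoms.mk n))
  · rintro h _ _ _ ⟨n⟩
    exact (hasLiftingProperty_iff h₁ _ f).2 (h n)

theorem generatingTrivialCells_le_seminormExtensions :
    generatingTrivialCells A ≤ seminormExtensions ν := by
  rintro _ _ _ ⟨n⟩
  let r : C(ULift.{u} (Cb n × I), ULift.{u} (Cb n)) := ⟨fun z ↦ ⟨z.down.1⟩, by fun_prop⟩
  refine .of_splitMono _ ((hatSmash A).map (PtCpt.plusMap r)) ?_
  rw [← Functor.map_comp, ← (hatSmash A).map_id]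
  congr 1
  refine PtCpt.Hom.ext (ContinuousMap.ext fun x ↦ ?_)
  rcases x with x | x <;> rfl

end Cells

/-! ### Path objects -/

section Square

variable {ν : Ordinal.{u}}

/-- The binary product `D × D`. -/
def square (D : NuAlg ν) : NuAlg ν := NuAlg.pi fun _ : ULift.{u} Bool ↦ D

/-- The first (`false`) and second (`true`) projection. -/
def squareProj (D : NuAlg ν) (i : Bool) : square D ⟶ D :=
  NuAlg.piProj (fun _ : ULift.{u} Bool ↦ D) ⟨i⟩

theorem square_hom_ext {B D : NuAlg ν} {f g : B ⟶ square D}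
    (h : ∀ i, f ≫ squareProj D i = g ≫ squareProj D i) : f = g :=
  NuAlg.hom_ext fun b ↦ funext fun i ↦ DFunLike.congr_fun (h i.down) b

end Square

section PathObjects

open unitInterval Cb

variable {ν : Ordinal.{u}} [Fact (Cardinal.aleph0 ≤ ν.card)] {A : NuAlg ν}

/-- A continuous family of maps from `K` to `W`, as a continuous family of pointed maps. -/
def ptMapCurry {Z : Type*} [TopologicalSpace Z] {K : Type u} [TopologicalSpace K] [CompactSpace K]
    [T2Space K] {W : Type u} [TopologicalSpace W] [Zero W] (q : C(Z × K, W)) :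
    C(Z, PtMap (PtCpt.plus K) W) where
  toFun z := ⟨⟨Sum.elim (fun k ↦ q (z, k)) fun _ ↦ 0, by fun_prop⟩, rfl⟩
  continuous_toFun := by
    refine Continuous.subtype_mk (ContinuousMap.continuous_of_continuous_uncurry _ ?_) _
    have h : Continuous ((fun w : Z × (K ⊕ PUnit.{u + 1}) ↦
        Sum.elim (fun k ↦ q (w.1, k)) (fun _ ↦ (0 : W)) w.2) ∘ Homeomorph.prodSumDistrib.symm) := by
      refine continuous_sum_dom.2 ⟨?_, ?_⟩
      · exact q.continuous
      · exact continuous_const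
    exact (Homeomorph.comp_continuous_iff' _).1 h

/-- Evaluation at a point. -/
def ptcofEval (X : PtCpt.{u}) (B : NuAlg ν) (x : X) : ptcof X B ⟶ B where
  toStarHom :=
    { toFun := fun g : ptSubalgebra X B ↦ g.1 x
      map_smul' := fun _ _ ↦ rfl
      map_zero' := rfl
      map_add' := fun _ _ ↦ rfl
      map_mul' := fun _ _ ↦ rfl
      map_star' := fun _ ↦ rfl }
  continuous := (continuous_eval_const (F := C(X, B)) x).comp continuous_subtype_val

/-- The inclusion of the constant maps. -/
def ptcofConst (K : Type u) [TopologicalSpace K] [CompactSpace K] [T2Space K] (B : NuAlg ν) :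
    B ⟶ ptcof (PtCpt.plus K) B where
  toStarHom :=
    { toFun := fun b ↦ (⟨(ptMapCurry (⟨Prod.fst, continuous_fst⟩ : C(B × K, B)) b).1, rfl⟩ :
        ptSubalgebra (PtCpt.plus K) B)
      map_smul' := fun c b ↦ Subtype.ext (ContinuousMap.ext fun x ↦ by
        rcases x with x | x
        · rfl
        · exact (smul_zero c).symm)
      map_zero' := Subtype.ext (ContinuousMap.ext fun x ↦ by rcases x with x | x <;> rfl)
      map_add' := fun _ _ ↦ Subtype.ext (ContinuousMap.ext fun x ↦ by
        rcases x with x | x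
        · rfl
        · exact (add_zero (0 : B)).symm)
      map_mul' := fun _ _ ↦ Subtype.ext (ContinuousMap.ext fun x ↦ by
        rcases x with x | x
        · rfl
        · exact (mul_zero (0 : B)).symm)
      map_star' := fun _ ↦ Subtype.ext (ContinuousMap.ext fun x ↦ by
        rcases x with x | x
        · rfl
        · exact (star_zero B).symm) }
  continuous := Continuous.subtype_mk (continuous_subtype_val.comp (map_continuous _)) _

section

variable {K : Type u} [TopologicalSpace K] [CompactSpace K] [T2Space K] {D : NuAlg ν}

theorem ptcof_hom_ext {B : NuAlg ν} {f g : B ⟶ ptcof (PtCpt.plus K) D}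
    (h : ∀ k, f ≫ ptcofEval (PtCpt.plus K) D (Sum.inl k) =
      g ≫ ptcofEval (PtCpt.plus K) D (Sum.inl k)) : f = g := by
  refine NuAlg.hom_ext fun b ↦ Subtype.ext (ContinuousMap.ext fun x ↦ ?_)
  rcases x with x | x
  · exact DFunLike.congr_fun (h x) b
  · exact (f b).2.trans (g b).2.symm

/-- The pointed map `pt₊ → K₊` given by a point. -/
def plusPoint (k : K) : PtCpt.plus PUnit.{u + 1} ⟶ PtCpt.plus K :=
  PtCpt.plusMap (.const _ k)

theorem ptcofPrecomp_plusPoint (k : K) : ptcofPrecomp (plusPoint k) D =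
    ptcofEval (PtCpt.plus K) D (Sum.inl k) ≫ ptcofConst PUnit.{u + 1} D :=
  ptcof_hom_ext fun _ ↦ rfl

/-- The self-map of `Hom(A, D) ≅ Hom(A, C_*(pt₊, D)) ≅ C_*(pt₊, Hom(A, D)) ≅ Hom(A, D)` given by
a mapping space homeomorphism. It measures the difference between that homeomorphism and the
canonical map. -/
def twist (h₂ : MappingSpaceHomeo A) (D : NuAlg ν) : C(A ⟶ D, A ⟶ D) where
  toFun h := (h₂.homeo _ D (h ≫ ptcofConst PUnit.{u + 1} D)).1 (Sum.inl PUnit.unit)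
  continuous_toFun := (continuous_eval_const _).comp (continuous_subtype_val.comp
    ((h₂.homeo _ D).continuous.comp (A.homMap (ptcofConst PUnit.{u + 1} D)).continuous))

/-- The inverse of `twist`. -/
def untwist (h₂ : MappingSpaceHomeo A) (D : NuAlg ν) : C(A ⟶ D, A ⟶ D) where
  toFun h := (h₂.homeo _ D).symm (ptMapCurry
    (⟨Prod.fst, continuous_fst⟩ : C((A ⟶ D) × PUnit.{u + 1}, A ⟶ D)) h) ≫
      ptcofEval (PtCpt.plus PUnit.{u + 1}) D (Sum.inl PUnit.unit)
  continuous_toFun := (A.homMap (ptcofEval (PtCpt.plus PUnit.{u + 1}) D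
    (Sum.inl PUnit.unit))).continuous.comp ((h₂.homeo _ D).symm.continuous.comp (map_continuous _))

theorem twist_untwist (h₂ : MappingSpaceHomeo A) (h : A ⟶ D) :
    twist h₂ D (untwist h₂ D h) = h := by
  have e : untwist h₂ D h ≫ ptcofConst PUnit.{u + 1} D = (h₂.homeo _ D).symm (ptMapCurry
      (⟨Prod.fst, continuous_fst⟩ : C((A ⟶ D) × PUnit.{u + 1}, A ⟶ D)) h) :=
    ptcof_hom_ext fun _ ↦ rfl
  change (h₂.homeo _ D (untwist h₂ D h ≫ ptcofConst PUnit.{u + 1} D)).1 _ = h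
  rw [e, Homeomorph.apply_symm_apply]
  rfl

theorem twist_injective (h₂ : MappingSpaceHomeo A) : Function.Injective (twist h₂ D) := by
  intro h h' hh
  have h1 : h ≫ ptcofConst PUnit.{u + 1} D = h' ≫ ptcofConst PUnit.{u + 1} D := by
    refine (h₂.homeo _ D).injective (Subtype.ext (ContinuousMap.ext fun x ↦ ?_))
    rcases x with x | x
    · exact hh
    · exact (h₂.homeo _ D (h ≫ ptcofConst _ D)).2.trans (h₂.homeo _ D (h' ≫ ptcofConst _ D)).2.symm
  exact congrArg (· ≫ ptcofEval (PtCpt.plus PUnit.{u + 1}) D (Sum.inl PUnit.unit)) h1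

theorem twist_comp_eval (h₂ : MappingSpaceHomeo A) (g : A ⟶ ptcof (PtCpt.plus K) D) (k : K) :
    twist h₂ D (g ≫ ptcofEval (PtCpt.plus K) D (Sum.inl k)) =
      (h₂.homeo _ D g).1 (Sum.inl k) := by
  refine Eq.trans ?_ (h₂.naturality_left (plusPoint k) g (Sum.inl PUnit.unit))
  rw [ptcofPrecomp_plusPoint]
  rfl

/-- The canonical map from `Hom(A, C_*(K₊, D))` to the maps from `K` to `Hom(A, D)` is
continuous. -/
theorem continuous_comp_eval (h₂ : MappingSpaceHomeo A) :
    Continuous fun w : (A ⟶ ptcof (PtCpt.plus K) D) × K ↦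
      w.1 ≫ ptcofEval (PtCpt.plus K) D (Sum.inl w.2) := by
  have h1 : (fun w : (A ⟶ ptcof (PtCpt.plus K) D) × K ↦
      w.1 ≫ ptcofEval (PtCpt.plus K) D (Sum.inl w.2)) =
      fun w ↦ untwist h₂ D ((h₂.homeo _ D w.1).1 (Sum.inl w.2)) :=
    funext fun w ↦ twist_injective h₂ (by rw [twist_untwist, twist_comp_eval])
  rw [h1]
  refine (untwist h₂ D).continuous.comp ?_
  exact ContinuousEval.continuous_eval.comp ((continuous_subtype_val.comp
    ((h₂.homeo _ D).continuous.comp continuous_fst)).prodMk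
      (continuous_inl.comp continuous_snd))

/-- A continuous family of maps from `K` to `Hom(A, D)` is a continuous family of morphisms
to `C_*(K₊, D)`. -/
theorem exists_lift_ptcof (h₂ : MappingSpaceHomeo A) {Z : Type*} [TopologicalSpace Z]
    (q : C(Z × K, A ⟶ D)) : ∃ g : C(Z, A ⟶ ptcof (PtCpt.plus K) D),
      ∀ z k, g z ≫ ptcofEval (PtCpt.plus K) D (Sum.inl k) = q (z, k) := by
  refine ⟨⟨fun z ↦ (h₂.homeo _ D).symm (ptMapCurry ((twist h₂ D).comp q) z),
    (h₂.homeo _ D).symm.continuous.comp (map_continuous _)⟩, fun z k ↦ twist_injective h₂ ?_⟩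
  refine (twist_comp_eval h₂ _ k).trans ?_
  change ((h₂.homeo _ D) ((h₂.homeo _ D).symm _)).1 _ = _
  rw [Homeomorph.apply_symm_apply]
  rfl

end

/-- A family of maps on the square, given on three sides. -/
theorem exists_fill_square {n : ℕ} {W : Type u} [TopologicalSpace W] (a b₀ b₁ : C(Cb n × I, W))
    (h0 : ∀ x, a (x, 0) = b₀ (x, 0)) (h1 : ∀ x, a (x, 1) = b₁ (x, 0)) :
    ∃ c : C((Cb n × I) × I, W), (∀ x t, c ((x, 0), t) = a (x, t)) ∧
      (∀ x s, c ((x, s), 0) = b₀ (x, s)) ∧ ∀ x s, c ((x, s), 1) = b₁ (x, s) := by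
  let cur (k : C(Cb n × I, W)) : C(I, C(Cb n, W)) :=
    ContinuousMap.curry (k.comp ⟨Prod.swap, continuous_swap⟩)
  have hbd (x : Cb 1) : x ∈ bd 1 ↔ x 0 = 0 ∨ x 0 = 1 := by
    rw [mem_bd_iff]
    exact or_congr Iff.rfl (or_iff_left (bd_zero _))
  obtain ⟨k, hk, hk0, hk1⟩ := exists_continuousOn_union
    (S := {z : Cb 2 | tail z 0 = 0}) (T := {z : Cb 2 | tail z 0 = 1})
    (isClosed_eq (by unfold tail; fun_prop) continuous_const)
    (isClosed_eq (by unfold tail; fun_prop) continuous_const)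
    (f := fun z ↦ cur b₀ (z 0)) (g := fun z ↦ cur b₁ (z 0)) (by fun_prop) (by fun_prop)
    (fun z hz hz' ↦ (zero_ne_one ((show tail z 0 = 0 from hz).symm.trans hz')).elim)
  obtain ⟨c, hc0, hc⟩ := exists_fill_of_sides (⟨fun x ↦ cur a (x 0), by fun_prop⟩ :
    C(Cb 1, C(Cb n, W))) k (hk.mono fun z hz ↦ (hbd _).1 hz) (fun x hx ↦ by
      rcases (hbd x).1 hx with h | h
      · rw [hk0 (cons 0 x) h]
        refine ContinuousMap.ext fun y ↦ (h0 y).symm.trans ?_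
        exact congrArg (fun t ↦ a (y, t)) h.symm
      · rw [hk1 (cons 0 x) h]
        refine ContinuousMap.ext fun y ↦ (h1 y).symm.trans ?_
        exact congrArg (fun t ↦ a (y, t)) h.symm)
  have h2 (s t : I) (ht : t = 0 ∨ t = 1) : c (cons s fun _ ↦ t) = k (cons s fun _ ↦ t) :=
    hc s _ ((hbd _).2 ht)
  refine ⟨⟨fun w ↦ c (cons w.1.2 fun _ ↦ w.2) w.1.1, ?_⟩, fun x t ↦ ?_, fun x s ↦ ?_,
    fun x s ↦ ?_⟩
  · exact ContinuousEval.continuous_eval.comp ((c.continuous.comp (by fun_prop)).prodMk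
      (by fun_prop))
  · exact DFunLike.congr_fun (hc0 fun _ ↦ t) x
  · refine (DFunLike.congr_fun (h2 s 0 (Or.inl rfl)) x).trans ?_
    exact DFunLike.congr_fun (hk0 (cons s fun _ ↦ 0) rfl) x
  · refine (DFunLike.congr_fun (h2 s 1 (Or.inr rfl)) x).trans ?_
    exact DFunLike.congr_fun (hk1 (cons s fun _ ↦ 1) rfl) x

/-- The interval, as a space of the given universe. -/
abbrev UI : Type u := ULift.{u} I

/-- The path object of `D`. -/
def pathObj (D : NuAlg ν) : NuAlg ν := ptcof (PtCpt.plus UI.{u}) D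

/-- The value of a path at a time. -/
def pathEval (D : NuAlg ν) (t : I) : pathObj D ⟶ D :=
  ptcofEval (PtCpt.plus UI.{u}) D (Sum.inl ⟨t⟩)

/-- The end points of a path. -/
def pathEnds (D : NuAlg ν) : pathObj D ⟶ square D :=
  NuAlg.piLift fun i ↦ if i.down then pathEval D 1 else pathEval D 0

theorem pathEnds_proj_false (D : NuAlg ν) :
    pathEnds D ≫ squareProj D false = pathEval D 0 := rfl

theorem pathEnds_proj_true (D : NuAlg ν) :
    pathEnds D ≫ squareProj D true = pathEval D 1 := rfl

/-- The end point morphism of the path object is a fibration. -/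
theorem isSerreFibration_pathEnds (h₂ : MappingSpaceHomeo A) (D : NuAlg ν) :
    IsSerreFibration (A.homMap (pathEnds D)) := by
  intro n g H hgH
  have h0 (x : Cb n) : H (x, 0) = g x ≫ pathEnds D := hgH x
  let a : C(Cb n × I, A ⟶ D) := ⟨fun z ↦ g z.1 ≫ pathEval D z.2,
    (continuous_comp_eval (K := UI.{u}) h₂).comp ((g.continuous.comp continuous_fst).prodMk
      (continuous_uliftUp.comp continuous_snd))⟩
  obtain ⟨c, hc, hc0, hc1⟩ := exists_fill_square a ((A.homMap (squareProj D false)).comp H)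
    ((A.homMap (squareProj D true)).comp H)
    (fun x ↦ by
      change g x ≫ pathEval D 0 = H (x, 0) ≫ squareProj D false
      rw [h0, Category.assoc, pathEnds_proj_false])
    (fun x ↦ by
      change g x ≫ pathEval D 1 = H (x, 0) ≫ squareProj D true
      rw [h0, Category.assoc, pathEnds_proj_true])
  obtain ⟨K, hK⟩ := exists_lift_ptcof (K := UI.{u}) h₂
    (c.comp ⟨fun w : (Cb n × I) × UI.{u} ↦ (w.1, w.2.down), by fun_prop⟩)
  refine ⟨K, fun x ↦ ptcof_hom_ext fun k ↦ (hK _ k).trans (hc x k.down), fun z ↦ ?_⟩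
  refine square_hom_ext fun i ↦ ?_
  cases i
  · exact (hK z ⟨0⟩).trans (hc0 z.1 z.2)
  · exact (hK z ⟨1⟩).trans (hc1 z.1 z.2)

/-- Morphisms with the left lifting property with respect to the fibrations are inclusions of
deformation retracts after applying `Hom(A, –)`, hence weak equivalences. -/
theorem compressible_of_llp (h₁ : PartialLeftAdjoint (hatSmash A) A) (h₂ : MappingSpaceHomeo A)
    {B D : NuAlg ν} (j : B ⟶ D) (hj : (generatingTrivialCells A).rlp.llp j) :
    Compressible (A.homMap j) := by
  have hB : HasLiftingProperty j (0 : B ⟶ NuAlg.pi fun i : PEmpty.{u + 1} ↦ i.elim) := hj _ <| by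
    have : Subsingleton (A ⟶ NuAlg.pi fun i : PEmpty.{u + 1} ↦ i.elim) :=
      ⟨fun f g ↦ NuAlg.hom_ext fun a ↦ funext fun i ↦ i.elim⟩
    exact (generatingTrivialCells_rlp_iff h₁ _).2 (isSerreFibration_of_subsingleton _)
  have hP : HasLiftingProperty j (pathEnds D) :=
    hj _ ((generatingTrivialCells_rlp_iff h₁ _).2 (isSerreFibration_pathEnds h₂ D))
  have sq : CommSq (𝟙 B) j (0 : B ⟶ NuAlg.pi fun i : PEmpty.{u + 1} ↦ i.elim) 0 :=
    ⟨NuAlg.hom_ext fun a ↦ funext fun i ↦ i.elim⟩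
  let r := sq.lift
  have hr : j ≫ r = 𝟙 B := sq.fac_left
  let e : D ⟶ square D := NuAlg.piLift fun i ↦ if i.down then 𝟙 D else r ≫ j
  have sq' : CommSq (j ≫ ptcofConst UI.{u} D) j (pathEnds D) e := ⟨square_hom_ext fun i ↦ by
    cases i
    · change j = j ≫ r ≫ j
      rw [← Category.assoc, hr, Category.id_comp]
    · rfl⟩
  have hl : sq'.HasLift := hP.sq_hasLift sq'
  let k : D ⟶ pathObj D := sq'.lift
  have hk : j ≫ k = j ≫ ptcofConst UI.{u} D := sq'.fac_left
  have hk' : k ≫ pathEnds D = e := sq'.fac_right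
  refine Compressible.of_deformationRetract (A.homMap r) (fun x ↦ ?_)
    ⟨fun w ↦ (w.2 ≫ k) ≫ pathEval D w.1, (continuous_comp_eval (K := UI.{u}) h₂).comp
      (((A.homMap k).continuous.comp continuous_snd).prodMk
        (continuous_uliftUp.comp continuous_fst))⟩ (fun y ↦ ?_) (fun y ↦ ?_) fun t x ↦ ?_
  · change (x ≫ j) ≫ r = x
    rw [Category.assoc, hr, Category.comp_id]
  · change (y ≫ k) ≫ pathEval D 0 = (y ≫ r) ≫ j
    rw [← pathEnds_proj_false, Category.assoc, ← Category.assoc k, hk', Category.assoc]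
    rfl
  · change (y ≫ k) ≫ pathEval D 1 = y
    rw [← pathEnds_proj_true, Category.assoc, ← Category.assoc k, hk']
    rfl
  · change ((x ≫ j) ≫ k) ≫ pathEval D t = x ≫ j
    rw [Category.assoc, Category.assoc, ← Category.assoc j, hk]
    rfl

end PathObjects

/-! ### The model structure -/

section ModelStructure

open MorphismProperty

variable {ν : Ordinal.{u}} {A : NuAlg ν}

variable (A) in
/-- The class of the morphisms that `Hom(A, –)` sends to weak homotopy equivalences. -/
def weakEquivs : MorphismProperty (NuAlg ν) := fun _ _ f ↦ IsWeakHomotopyEquiv (A.homMap f)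

theorem weakEquivs_iff {B D : NuAlg ν} {f : B ⟶ D} :
    weakEquivs A f ↔ Compressible (A.homMap f) :=
  isWeakHomotopyEquiv_iff_compressible

instance : (weakEquivs A).HasTwoOutOfThreeProperty where
  comp_mem _ _ hf hg := weakEquivs_iff.2 ((weakEquivs_iff.1 hf).comp (weakEquivs_iff.1 hg))
  of_postcomp _ _ hg hfg :=
    weakEquivs_iff.2 ((weakEquivs_iff.1 hg).of_comp_right (weakEquivs_iff.1 hfg))
  of_precomp _ _ hf hfg :=
    weakEquivs_iff.2 ((weakEquivs_iff.1 hf).of_comp_left (weakEquivs_iff.1 hfg))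

variable [Fact (Cardinal.aleph0 ≤ ν.card)]

instance : MorphismProperty.IsSmall.{u} (generatingCells A) :=
  isSmall_ofHoms _

instance : MorphismProperty.IsSmall.{u} (generatingTrivialCells A) :=
  isSmall_ofHoms _

theorem isSmallRelativeTo_relativeCells {W : MorphismProperty (NuAlg ν)}
    (hW : W ≤ seminormExtensions ν) (B : NuAlg ν) : IsSmallRelativeTo B (relativeCells W) :=
  isSmallRelativeTo_of_le_seminormExtensions (relativeCells_le_seminormExtensions hW) B

theorem generatingCells_rlp (h₁ : PartialLeftAdjoint (hatSmash A) A) :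
    (generatingCells A).rlp = (generatingTrivialCells A).rlp ⊓ weakEquivs A := by
  ext B D f
  exact (generatingCells_rlp_iff h₁ f).trans
    (and_congr (generatingTrivialCells_rlp_iff h₁ f).symm Iff.rfl)

theorem llp_inf_weakEquivs (h₁ : PartialLeftAdjoint (hatSmash A) A) (h₂ : MappingSpaceHomeo A) :
    (generatingCells A).rlp.llp ⊓ weakEquivs A = (generatingTrivialCells A).rlp.llp := by
  have := NuAlg.hasColimitsOfSize (ν := ν)
  have hJ := hasSmallObjectArgument_of_le_seminormExtensions
    (generatingTrivialCells_le_seminormExtensions (A := A))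
  have hwe : (generatingTrivialCells A).rlp.llp ≤ weakEquivs A := fun _ _ j hj ↦
    weakEquivs_iff.2 (compressible_of_llp h₁ h₂ j hj)
  refine le_antisymm (fun B D f hf ↦ ?_) (le_inf (antitone_llp ?_) hwe)
  · -- `f` is a retract of the first part of its factorization
    have h := factorizationData (generatingTrivialCells A).rlp.llp (generatingTrivialCells A).rlp f
    have hp : (generatingCells A).rlp h.p := by
      rw [generatingCells_rlp h₁]
      exact ⟨h.hp, (weakEquivs A).of_precomp h.i h.p (hwe _ h.hi) (by
        rw [h.fac]; exact hf.2)⟩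
    have : HasLiftingProperty f h.p := hf.1 _ hp
    exact of_retract (RetractArrow.ofLeftLiftingProperty h.fac) h.hi
  · rw [generatingCells_rlp h₁]
    exact inf_le_left

variable (A) in
/-- The model structure determined by `Hom(A, –)`. -/
@[reducible] def modelStructure (h₁ : PartialLeftAdjoint (hatSmash A) A)
    (h₂ : MappingSpaceHomeo A) (h₃ : StrongCylinderSeminormExtension A) :
    ModelCategory (NuAlg ν) :=
  have := NuAlg.hasLimitsOfSize (ν := ν)
  have := NuAlg.hasColimitsOfSize (ν := ν)
  let _ : CategoryWithFibrations (NuAlg ν) := ⟨(generatingTrivialCells A).rlp⟩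
  let _ : CategoryWithCofibrations (NuAlg ν) := ⟨(generatingCells A).rlp.llp⟩
  let _ : CategoryWithWeakEquivalences (NuAlg ν) := ⟨weakEquivs A⟩
  have : (weakEquivalences (NuAlg ν)).HasTwoOutOfThreeProperty :=
    inferInstanceAs (weakEquivs A).HasTwoOutOfThreeProperty
  have hI := hasSmallObjectArgument_of_le_seminormExtensions
    (generatingCells_le_seminormExtensions h₃)
  have hJ := hasSmallObjectArgument_of_le_seminormExtensions
    (generatingTrivialCells_le_seminormExtensions (A := A))
  have eI : trivialFibrations (NuAlg ν) = (generatingCells A).rlp := (generatingCells_rlp h₁).symm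
  have eJ : trivialCofibrations (NuAlg ν) = (generatingTrivialCells A).rlp.llp :=
    llp_inf_weakEquivs h₁ h₂
  have : IsWeakFactorizationSystem (cofibrations (NuAlg ν)) (trivialFibrations (NuAlg ν)) := by
    rw [eI]
    have : HasFactorization (generatingCells A).rlp.llp (generatingCells A).rlp := inferInstance
    exact ⟨rlp_llp_rlp _, rfl, this⟩
  have : IsWeakFactorizationSystem (trivialCofibrations (NuAlg ν)) (fibrations (NuAlg ν)) := by
    rw [eJ]
    have : HasFactorization (generatingTrivialCells A).rlp.llp (generatingTrivialCells A).rlp :=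
      inferInstance
    exact ⟨rlp_llp_rlp _, rfl, this⟩
  ModelCategory.mk' (NuAlg ν)

/-- Weak equivalences are stable under pullback along fibrations. -/
theorem compressible_of_isPullback (h₁ : PartialLeftAdjoint (hatSmash A) A) {P X Y Z : NuAlg ν}
    {p' : P ⟶ X} {w' : P ⟶ Y} {w : X ⟶ Z} {p : Y ⟶ Z} (sq : IsPullback p' w' w p)
    (hp : IsSerreFibration (A.homMap p)) (hw : Compressible (A.homMap w)) :
    Compressible (A.homMap w') := by
  refine hw.of_isPullback hp (A.homMap p') (A.homMap w') (fun q ↦ ?_) (fun q q' h h' ↦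
    sq.hom_ext h h') fun n u v huv ↦ ?_
  · change (q ≫ p') ≫ w = (q ≫ w') ≫ p
    rw [Category.assoc, sq.w, Category.assoc]
  · let Q : Type u := ULift.{u} (Cb n)
    let u' := (cellEquiv h₁ Q X).symm ⟨fun z : ULift.{u} (Cb n) ↦ u z.down, by fun_prop⟩
    let v' := (cellEquiv h₁ Q Y).symm ⟨fun z : ULift.{u} (Cb n) ↦ v z.down, by fun_prop⟩
    have h : u' ≫ w = v' ≫ p := (cellEquiv h₁ Q Z).injective (ContinuousMap.ext fun z ↦ by
      rw [cellEquiv_comp, cellEquiv_comp, Equiv.apply_symm_apply, Equiv.apply_symm_apply]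
      exact huv z.down)
    refine ⟨⟨fun z ↦ cellEquiv h₁ Q P (sq.lift u' v' h) ⟨z⟩, by fun_prop⟩, fun z ↦ ?_, fun z ↦ ?_⟩
    · refine (cellEquiv_comp h₁ (sq.lift u' v' h) p' ⟨z⟩).symm.trans ?_
      rw [sq.lift_fst, Equiv.apply_symm_apply]
      rfl
    · refine (cellEquiv_comp h₁ (sq.lift u' v' h) w' ⟨z⟩).symm.trans ?_
      rw [sq.lift_snd, Equiv.apply_symm_apply]
      rfl

/-- `A` is cofibrant, because the morphisms with the right lifting property with respect to the
cells induce surjections on `Hom(A, –)`. -/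
theorem llp_initial_to [HasInitial (NuAlg ν)] (h₁ : PartialLeftAdjoint (hatSmash A) A) :
    (generatingCells A).rlp.llp (initial.to A) := by
  intro B D p hp
  have hp' := liftsBoundary_iff.2 ((generatingCells_rlp_iff h₁ p).1 hp)
  refine ⟨fun {a b} sq ↦ ?_⟩
  obtain ⟨x, hx⟩ := hp'.surjective b
  exact ⟨⟨⟨x, initialIsInitial.hom_ext _ _, hx⟩⟩⟩

theorem rlp_terminal_from [HasTerminal (NuAlg ν)] (h₁ : PartialLeftAdjoint (hatSmash A) A)
    (B : NuAlg ν) :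
    (generatingTrivialCells A).rlp (terminal.from B) := by
  have : Subsingleton (A ⟶ ⊤_ (NuAlg ν)) := ⟨fun f g ↦ terminalIsTerminal.hom_ext f g⟩
  exact (generatingTrivialCells_rlp_iff h₁ _).2 (isSerreFibration_of_subsingleton _)

end ModelStructure

end LMCStar

end

theorem mainTheorem3 (ν : Ordinal.{u}) [Fact (Cardinal.aleph0 ≤ ν.card)] (A : LMCStar.NuAlg ν)
    (h₁ : Nonempty (LMCStar.PartialLeftAdjoint (LMCStar.hatSmash A) A))
    (h₂ : Nonempty (LMCStar.MappingSpaceHomeo A))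
    (h₃ : LMCStar.StrongCylinderSeminormExtension A) :
    HasLimitsOfSize.{u, u} (LMCStar.NuAlg ν) ∧ HasColimitsOfSize.{u, u} (LMCStar.NuAlg ν) ∧
    ∃ _ : ModelCategory (LMCStar.NuAlg ν),
      (∀ ⦃B D : LMCStar.NuAlg ν⦄ (f : B ⟶ D),
        Fibration f ↔ LMCStar.IsSerreFibration (A.homMap f)) ∧
      (∀ ⦃B D : LMCStar.NuAlg ν⦄ (f : B ⟶ D),
        WeakEquivalence f ↔ LMCStar.IsWeakHomotopyEquiv (A.homMap f)) ∧
      IsCofibrant A ∧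
      (∀ B : LMCStar.NuAlg ν, IsFibrant B) ∧
      LMCStar.IsRightProper (LMCStar.NuAlg ν) ∧
      ∃ J : MorphismProperty (LMCStar.NuAlg ν),
        LMCStar.IsCofibrantlyGeneratedBy (LMCStar.generatingCells A) J := by
  obtain ⟨h₁⟩ := h₁
  obtain ⟨h₂⟩ := h₂
  let _ := LMCStar.modelStructure A h₁ h₂ h₃
  have hfib {B D : LMCStar.NuAlg ν} (f : B ⟶ D) :
      Fibration f ↔ LMCStar.IsSerreFibration (A.homMap f) :=
    (fibration_iff f).trans (LMCStar.generatingTrivialCells_rlp_iff h₁ f)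
  have hwe {B D : LMCStar.NuAlg ν} (f : B ⟶ D) :
      WeakEquivalence f ↔ LMCStar.IsWeakHomotopyEquiv (A.homMap f) :=
    weakEquivalence_iff f
  refine ⟨LMCStar.NuAlg.hasLimitsOfSize, LMCStar.NuAlg.hasColimitsOfSize,
    LMCStar.modelStructure A h₁ h₂ h₃, @hfib, @hwe,
    ⟨LMCStar.llp_initial_to h₁⟩, fun B ↦ ⟨LMCStar.rlp_terminal_from h₁ B⟩,
    fun P X Y Z p' w' w p sq hp hw ↦ ?_, LMCStar.generatingTrivialCells A, ?_⟩
  · rw [hwe, LMCStar.isWeakHomotopyEquiv_iff_compressible] at hw ⊢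
    exact LMCStar.compressible_of_isPullback h₁ sq ((hfib p).1 hp) hw
  · exact
      { isSmall_I := inferInstance
        isSmall_J := inferInstance
        small_I := fun B _ _ _ ↦ LMCStar.isSmallRelativeTo_relativeCells
          (LMCStar.generatingCells_le_seminormExtensions h₃) B
        small_J := fun B _ _ _ ↦ LMCStar.isSmallRelativeTo_relativeCells
          LMCStar.generatingTrivialCells_le_seminormExtensions B
        fibrations_eq := rfl
        trivialFibrations_eq := (LMCStar.generatingCells_rlp h₁).symm }
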